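/- For a group $G$ let the Zariski topology be the topology generated by the sets $\{x\in G : x^{\epsilon_1}g_1x^{\epsilon_2}g_2\cdots x^{\epsilon_n}g_n\neq 1\}$ with $n\in\mathbb N$, $g_i\in G$, $\epsilon_i\in\{1,-1\}$. It is a group topology if multiplication and inversion are continuous for it. Let $M$ be the (countable, ultrahomogeneous) Fraïssé limit of a Fraïssé class $\mathcal K$. Then the Zariski topology on $\mathrm{Aut}(M)$ is not a group topology in each of the following cases. 1. $\mathcal K$ is a non-trivial free amalgamation class in a relational language, and $\mathrm{Aut}(M)$ acts transitively on $M$. 2. $M$ is the rational Urysohn space or the rational Urysohn $b$-sphere for some rational $b>0$. That is, $\mathcal K$ is the class of all finite metric spaces with distances in $R$, where $R=\mathbb Q_{\ge 0}$ or $R=\mathbb Q\cap[0,b]$, regarded as structures with one binary relation "$d(x,y)\le q$" for each $q\in R$. 3. $M$ is the random tournament, i.e. $\mathcal K$ is the class of all finite tournaments. 4. $\mathcal K=\mathcal K_1\otimes\mathcal K_2$, the class of all structures in the disjoint union of the languages of $\mathcal K_1$ and $\mathcal K_2$ whose reducts belong to $\mathcal K_1$ and $\mathcal K_2$, respectively.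 Here $\mathcal K_1$ is a strong amalgamation class in a relational language and $\mathcal K_2$ is a strong amalgamation class, with Fraïssé limits $M_1$ and $M_2$, such that: - $\mathcal K_1$ is non-trivial, and either $M_1$ is one of the spaces in case 2 (in the language given there), or $\mathrm{Aut}(M_1)$ acts transitively on the ordered pairs of distinct elements of $M_1$, or $\mathcal K_1$ is a free amalgamation class and $\mathrm{Aut}(M_1)$ acts transitively on $M_1$; - $M_2$ is $(\mathbb Q,<)$, the cyclic tournament $S(2)$, or the countable dense meet tree in the language $\{\le,\wedge\}$ with the meet as a binary function. Here a class with Fraïssé limit $M$ is trivial if $\mathrm{Aut}(M)$ is the full symmetric group of $M$. A class of finite structures in a relational language is a free amalgamation class if it is closed under isomorphism and substructures and contains, with any $B$ and $C$ having a common substructure $A$, the structure on $B\sqcup_A C$ in which a relation holds if and only if it holds in $B$ or in $C$. A Fraïssé class is a strong amalgamation class if any two extensions $A_1,A_2$ of a common substructure $B$ can be amalgamated in the class so that the images of $A_1$ and $A_2$ meet exactly in the image of $B$. $S(2)$ is a countable dense subset of the unit circle without antipodal points, with an edge $x\to y$ when the counterclockwise angle from $x$ to $y$ lies in $(0,\pi)$.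 The countable dense meet tree is the countable non-empty partial order in which the elements below any given one form a dense linear order without first element, any two elements have a greatest lower bound, and every element $t$ has infinitely many elements above it whose pairwise meets are all $t$. -/

import Mathlib

open CategoryTheory
open scoped FirstOrder

universe u v u' v' w

namespace ZariskiAut

/-! ### The Zariski topology of a group -/

/-- The Zariski topology of a group `G`: it is generated by the sets
`{x | x ^ ε₁ * g₁ * x ^ ε₂ * g₂ * ⋯ * x ^ εₙ * gₙ ≠ 1}` with `gᵢ ∈ G` and `εᵢ ∈ {1, -1}`. A word is
given by the list of the pairs `(εᵢ, gᵢ)`. -/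
@[reducible] def zariskiTopology (G : Type*) [Group G] : TopologicalSpace G :=
  TopologicalSpace.generateFrom
    {U : Set G | ∃ l : List (ℤˣ × G),
      U = {x : G | (l.map (fun p => x ^ (p.1 : ℤ) * p.2)).prod ≠ 1}}

/-- The Zariski topology of `G` is a group topology: multiplication and inversion are continuous. -/
def ZariskiIsGroupTopology (G : Type*) [Group G] : Prop :=
  @IsTopologicalGroup G (zariskiTopology G) _

/-- The group of automorphisms of a first order structure, under composition. -/
instance autGroup {L : FirstOrder.Language.{u, v}} {M : Type w} [L.Structure M] : Group (M ≃[L] M) where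
  mul f g := f.comp g
  one := FirstOrder.Language.Equiv.refl L M
  inv f := f.symm
  mul_assoc _ _ _ := rfl
  one_mul _ := rfl
  mul_one _ := rfl
  inv_mul_cancel f := by
    apply FirstOrder.Language.Equiv.ext
    intro x
    exact f.symm_apply_apply x

/-! ### Classes of finite structures -/

section Classes

variable {L : FirstOrder.Language.{u, v}}

/-- Strong amalgamation: two extensions of a common substructure can be amalgamated inside the
class without identifying any points outside of that substructure. -/
def StrongAmalgamation (K : Set (Bundled.{w} L.Structure)) : Prop :=
  ∀ (B A₁ A₂ : Bundled.{w} L.Structure) (g₁ : B ↪[L] A₁) (g₂ : B ↪[L] A₂),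
    B ∈ K → A₁ ∈ K → A₂ ∈ K →
      ∃ (C : Bundled.{w} L.Structure) (h₁ : A₁ ↪[L] C) (h₂ : A₂ ↪[L] C),
        C ∈ K ∧ h₁.comp g₁ = h₂.comp g₂ ∧
          Set.range h₁ ∩ Set.range h₂ = Set.range (h₁.comp g₁)

/-- `D`, with the embeddings `i` and `j`, is the free amalgam of `B` and `C` over `A`: its domain is
the union of `B` and `C` glued along `A`, and a relation holds in `D` if and only if it already
does in `B` or in `C`. (Used for relational languages.) -/
structure IsFreeAmalgam {A B C D : Type w} [L.Structure A] [L.Structure B] [L.Structure C]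
    [L.Structure D] (f : A ↪[L] B) (g : A ↪[L] C) (i : B ↪[L] D) (j : C ↪[L] D) : Prop where
  comm : i.comp f = j.comp g
  union : Set.range i ∪ Set.range j = Set.univ
  inter : Set.range i ∩ Set.range j = Set.range (i.comp f)
  rel : ∀ (n : ℕ) (R : L.Relations n) (x : Fin n → D),
    FirstOrder.Language.Structure.RelMap R x ↔
      (∃ y : Fin n → B, x = i ∘ y ∧ FirstOrder.Language.Structure.RelMap R y) ∨
      (∃ z : Fin n → C, x = j ∘ z ∧ FirstOrder.Language.Structure.RelMap R z)

/-- A free amalgamation class: a hereditary class of finite structures (in a relational language)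
which contains all free amalgams of its members. -/
structure IsFreeAmalgamationClass (K : Set (Bundled.{w} L.Structure)) : Prop where
  finite : ∀ A ∈ K, Finite A
  hereditary : FirstOrder.Language.Hereditary K
  amalgam : ∀ (A B C : Bundled.{w} L.Structure) (f : A ↪[L] B) (g : A ↪[L] C),
    A ∈ K → B ∈ K → C ∈ K →
      ∃ (D : Bundled.{w} L.Structure) (i : B ↪[L] D) (j : C ↪[L] D),
        D ∈ K ∧ IsFreeAmalgam f g i j

/-- A class with Fraïssé limit `M` is trivial if `Aut M` is the full symmetric group of `M`. -/
def IsTrivial (L : FirstOrder.Language.{u, v}) (M : Type w) [L.Structure M] : Prop :=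
  ∀ σ : Equiv.Perm M, ∃ g : M ≃[L] M, ∀ x, g x = σ x

/-- `Aut M` acts transitively on `M`. -/
def IsTransitive (L : FirstOrder.Language.{u, v}) (M : Type w) [L.Structure M] : Prop :=
  ∀ a b : M, ∃ g : M ≃[L] M, g a = b

/-- `Aut M` acts transitively on the ordered pairs of distinct elements of `M`. -/
def IsTwoTransitive (L : FirstOrder.Language.{u, v}) (M : Type w) [L.Structure M] : Prop :=
  ∀ a b c d : M, a ≠ b → c ≠ d → ∃ g : M ≃[L] M, g a = c ∧ g b = d

/-- The product `K₁ ⊗ K₂`: all structures in the disjoint union of the two languages whose reducts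
belong to `K₁` and to `K₂` respectively. -/
def prodClass {L₁ : FirstOrder.Language.{u, v}} {L₂ : FirstOrder.Language.{u', v'}}
    (K₁ : Set (Bundled.{w} L₁.Structure)) (K₂ : Set (Bundled.{w} L₂.Structure)) :
    Set (Bundled.{w} (L₁.sum L₂).Structure) :=
  {A | (⟨A, (FirstOrder.Language.LHom.sumInl : L₁ →ᴸ L₁.sum L₂).reduct A⟩ : Bundled L₁.Structure) ∈ K₁ ∧
    (⟨A, (FirstOrder.Language.LHom.sumInr : L₂ →ᴸ L₁.sum L₂).reduct A⟩ : Bundled L₂.Structure) ∈ K₂}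

instance countable_functions_of_isRelational [L.IsRelational] :
    Countable (Σ l, L.Functions l) :=
  inferInstance

instance countable_functions_sum {L₁ : FirstOrder.Language.{u, v}} {L₂ : FirstOrder.Language.{u', v'}}
    [L₁.IsRelational] [Countable (Σ l, L₂.Functions l)] :
    Countable (Σ l, (L₁.sum L₂).Functions l) := by
  refine Function.Surjective.countable (f := fun p : Σ l, L₂.Functions l =>
    (⟨p.1, Sum.inr p.2⟩ : Σ l, (L₁.sum L₂).Functions l)) ?_
  rintro ⟨l, f | f⟩
  · exact isEmptyElim f
  · exact ⟨⟨l, f⟩, rfl⟩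

end Classes

/-! ### Rational metric spaces -/

/-- The two kinds of distance sets: all non-negative rationals, or the rationals in `[0, b]` for
some rational `b > 0`. -/
def IsRatDistanceSet (R : Set ℚ) : Prop :=
  R = Set.Ici 0 ∨ ∃ b : ℚ, 0 < b ∧ R = Set.Icc 0 b

/-- One binary relation symbol for each distance `q ∈ R`. -/
inductive RatMetricRel (R : Set ℚ) : ℕ → Type
  | dist (q : R) : RatMetricRel R 2

/-- The relational language of metric spaces with distances in `R`. -/
def ratMetricLanguage (R : Set ℚ) : FirstOrder.Language.{0, 0} :=
  ⟨fun _ => Empty, RatMetricRel R⟩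

instance (R : Set ℚ) : (ratMetricLanguage R).IsRelational :=
  fun _ => inferInstanceAs (IsEmpty Empty)

/-- The relation symbol expressing that two points are at distance at most `q`. -/
def distLE {R : Set ℚ} (q : R) : (ratMetricLanguage R).Relations 2 := RatMetricRel.dist q

/-- The class of all finite metric spaces with distances in `R`, as relational structures in which
the symbol of index `q` is interpreted as `d x y ≤ q`. -/
def ratMetricClass (R : Set ℚ) : Set (Bundled.{w} (ratMetricLanguage R).Structure) :=
  {A | Finite A ∧ ∃ d : A → A → ℚ,
    (∀ x y, d x y ∈ R) ∧
    (∀ x y, d x y = 0 ↔ x = y) ∧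
    (∀ x y, d x y = d y x) ∧
    (∀ x y z, d x z ≤ d x y + d y z) ∧
    ∀ (q : R) (x y : A), FirstOrder.Language.Structure.RelMap (distLE q) ![x, y] ↔ d x y ≤ (q : ℚ)}

/-! ### Structures with one binary relation: tournaments and orders -/

/-- A single binary relation symbol. -/
inductive BinRel : ℕ → Type
  | edge : BinRel 2

/-- The relational language with a single binary relation symbol. -/
def binLanguage : FirstOrder.Language.{0, 0} := ⟨fun _ => Empty, BinRel⟩

instance : binLanguage.IsRelational := fun _ => inferInstanceAs (IsEmpty Empty)

/-- The binary relation of a structure in the language `binLanguage`. -/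
def Edge {M : Type w} [binLanguage.Structure M] (x y : M) : Prop :=
  FirstOrder.Language.Structure.RelMap (L := binLanguage) (n := 2) BinRel.edge ![x, y]

/-- The class of all finite tournaments. -/
def tournamentClass : Set (Bundled.{w} binLanguage.Structure) :=
  {A | Finite A ∧ (∀ x : A, ¬ Edge x x) ∧ ∀ x y : A, x ≠ y → Xor (Edge x y) (Edge y x)}

/-- `M` is isomorphic to `(ℚ, <)`. -/
def IsRatOrder (M : Type w) [binLanguage.Structure M] : Prop :=
  ∃ e : M ≃ ℚ, ∀ x y, Edge x y ↔ e x < e y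

/-- `M` is isomorphic to the cyclic tournament `S(2)`: its vertices form a dense subset (which is
countable whenever `M` is) of the unit circle that contains no two antipodal points, with an edge
from `x` to `y` if and only if the counterclockwise angle from `x` to `y` lies in `(0, π)`. -/
def IsCyclicTournament (M : Type w) [binLanguage.Structure M] : Prop :=
  ∃ f : M → Circle, Function.Injective f ∧ DenseRange f ∧
    (∀ x y, (f x : ℂ) ≠ -(f y : ℂ)) ∧
    ∀ x y, Edge x y ↔ 0 < ((f y : ℂ) / (f x : ℂ)).im

/-! ### Dense meet trees -/

/-- A binary function symbol for meets. -/
inductive MeetTreeFunc : ℕ → Type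
  | meet : MeetTreeFunc 2

/-- A binary relation symbol for the order. -/
inductive MeetTreeRel : ℕ → Type
  | le : MeetTreeRel 2

/-- The language of meet trees. -/
def meetTreeLanguage : FirstOrder.Language.{0, 0} := ⟨MeetTreeFunc, MeetTreeRel⟩

instance : Countable (Σ l, meetTreeLanguage.Functions l) := by
  have : Subsingleton (Σ l, meetTreeLanguage.Functions l) := by
    constructor
    rintro ⟨_, ⟨⟩⟩ ⟨_, ⟨⟩⟩
    rfl
  infer_instance

section MeetTree

variable {M : Type w} [meetTreeLanguage.Structure M]

/-- The order of a structure in the language of meet trees. -/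
def TreeLE (x y : M) : Prop :=
  FirstOrder.Language.Structure.RelMap (L := meetTreeLanguage) (n := 2) MeetTreeRel.le ![x, y]

/-- The strict order of a structure in the language of meet trees. -/
def TreeLT (x y : M) : Prop := TreeLE x y ∧ x ≠ y

/-- The meet operation of a structure in the language of meet trees. -/
def treeMeet (x y : M) : M :=
  FirstOrder.Language.Structure.funMap (L := meetTreeLanguage) (n := 2) MeetTreeFunc.meet ![x, y]

end MeetTree

/-- `M` is a dense meet tree: a non-empty partial order in which the elements below any given one
form a dense linear order without a first element, any two elements have a greatest lower bound,
and every element `t` is the meet of any two members of some infinite set of elements above `t`. -/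
structure IsDenseMeetTree (M : Type w) [meetTreeLanguage.Structure M] : Prop where
  nonempty : Nonempty M
  refl : ∀ x : M, TreeLE x x
  antisymm : ∀ x y : M, TreeLE x y → TreeLE y x → x = y
  trans : ∀ x y z : M, TreeLE x y → TreeLE y z → TreeLE x z
  linear : ∀ t x y : M, TreeLE x t → TreeLE y t → TreeLE x y ∨ TreeLE y x
  meet : ∀ x y s : M, TreeLE s (treeMeet x y) ↔ TreeLE s x ∧ TreeLE s y
  dense : ∀ x y : M, TreeLT x y → ∃ z, TreeLT x z ∧ TreeLT z y
  noFirst : ∀ t : M, ∃ s, TreeLT s t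
  branching : ∀ t : M, ∃ S : Set M, S.Infinite ∧ (∀ x ∈ S, TreeLT t x) ∧
    ∀ x ∈ S, ∀ y ∈ S, x ≠ y → treeMeet x y = t

/-! ### The second factor of a product -/

/-- `K₂` is a class whose Fraïssé limit is `(ℚ, <)`, the cyclic tournament `S(2)`, or the countable
dense meet tree. -/
inductive IsSecondFactor : ∀ L₂ : FirstOrder.Language.{0, 0}, Set (Bundled.{w} L₂.Structure) → Prop
  | ratOrder (K₂ : Set (Bundled.{w} binLanguage.Structure)) (M₂ : Type w)
      [binLanguage.Structure M₂] [Countable M₂] :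
      FirstOrder.Language.IsFraisseLimit K₂ M₂ → IsRatOrder M₂ → IsSecondFactor binLanguage K₂
  | cyclicTournament (K₂ : Set (Bundled.{w} binLanguage.Structure)) (M₂ : Type w)
      [binLanguage.Structure M₂] [Countable M₂] :
      FirstOrder.Language.IsFraisseLimit K₂ M₂ → IsCyclicTournament M₂ → IsSecondFactor binLanguage K₂
  | denseMeetTree (K₂ : Set (Bundled.{w} meetTreeLanguage.Structure)) (M₂ : Type w)
      [meetTreeLanguage.Structure M₂] [Countable M₂] :
      FirstOrder.Language.IsFraisseLimit K₂ M₂ → IsDenseMeetTree M₂ → IsSecondFactor meetTreeLanguage K₂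

end ZariskiAut

open ZariskiAut

/-! The Zariski topology is always T1, and a T1 group topology is Hausdorff. So it is enough that
any two non-empty Zariski open sets meet: finitely many words with constants, each of them
non-trivial somewhere, must be non-trivial at a common point. This is a genericity argument. For
each such word, every finite approximation of a group element can be refined to a finite
approximation that already forces the word to be non-trivial, and then the words are treated one
after the other (`MovesTypes.exists_wordValue_ne`, `MovesTypes.sInter_nonempty`).

To force a reduced word, a point is followed along it, and every new value of the variable is chosen
away from everything used so far. The one obstruction is a constant `g` between opposite powers of
the variable: there `g` must move the value just chosen, or the path folds back. This explains the
criterion `MovesTypes`: for `q` outside of `A`, the orbit of `q` over `A` escapes every finite set,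
and an element that fixes all but finitely many members of the orbit is the identity. In the
presence of function symbols only closed finite sets have extendable partial maps, hence the family
`𝒞`.

The rest is rigidity: if `g` fixes almost all conjugates of `q` over `A`, then `g = 1`. If `g` fixes
`z`, then `z` has the same relations to `x` and to `g x`; so one constructs conjugates of `q`, and
later other points known to be fixed, that would tell `x` from `g x`. In tournaments and Urysohn
spaces the extension property supplies them, with distances chosen as large as possible in the
metric case. In a free amalgamation class one glues copies of a minimal non-constant relation to the
point in question (`exists_aut_glue`, `eq_of_glue`).

In a product the two structures are independent, so a point may be given any type for the first
factor and any position in the second (`prod_place`). A conjugate of `q` placed right beside `c` in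
the second factor shows that `g` fixes points `c` near `q`. A relation of the first factor between
such points and `a`, but not `g a`, then gives `g a = a` (`prod_eq_of_fixes`). -/

namespace ZariskiAut

/-! ### Words with constants -/

section Words

variable {G : Type*} [Group G]

/-- The value of a word with constants at `x`. -/
def wordValue (l : List (ℤˣ × G)) (x : G) : G :=
  (l.map (fun p => x ^ (p.1 : ℤ) * p.2)).prod

@[simp]
theorem wordValue_nil (x : G) : wordValue [] x = 1 := rfl

@[simp]
theorem wordValue_cons (p : ℤˣ × G) (l : List (ℤˣ × G)) (x : G) :
    wordValue (p :: l) x = x ^ (p.1 : ℤ) * p.2 * wordValue l x := by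
  simp [wordValue]

/-- A word is reduced if the constants between opposite powers of the variable are non-trivial. -/
def IsReducedWord (l : List (ℤˣ × G)) : Prop :=
  l.IsChain (fun p q => p.1 = -q.1 → p.2 ≠ 1)

/-- Read from the right, a letter absorbs the constant `c` left in front of the tail. If it then
cancels against the first letter of the tail, the constant of that letter becomes the new `c`. -/
theorem exists_reducedWord (l : List (ℤˣ × G)) :
    ∃ (c : G) (l' : List (ℤˣ × G)), IsReducedWord l' ∧
      ∀ x, wordValue l x = c * wordValue l' x := by
  induction l with
  | nil => exact ⟨1, [], List.IsChain.nil, fun x => by simp⟩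
  | cons p l ih =>
    obtain ⟨c, l', hl', h⟩ := ih
    cases l' with
    | nil => exact ⟨1, [(p.1, p.2 * c)], List.IsChain.singleton _, fun x => by simp [h, mul_assoc]⟩
    | cons q l'' =>
      by_cases hpq : p.1 = -q.1 ∧ p.2 * c = 1
      · refine ⟨q.2, l'', hl'.tail, fun x => ?_⟩
        have hc : c = p.2⁻¹ := eq_inv_of_mul_eq_one_right hpq.2
        simp [h, hpq.1, hc, mul_assoc]
      · refine ⟨1, (p.1, p.2 * c) :: q :: l'', ?_, fun x => by simp [h, mul_assoc]⟩
        refine List.IsChain.cons_cons (fun h1 h2 => hpq ⟨h1, h2⟩) hl'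

/-- The word obtained by inverting the variable. -/
def flipWord (l : List (ℤˣ × G)) : List (ℤˣ × G) := l.map (fun p => (-p.1, p.2))

/-- This symmetry makes it possible to treat only words that start with a negative power. -/
theorem wordValue_flipWord (l : List (ℤˣ × G)) (x : G) :
    wordValue (flipWord l) x⁻¹ = wordValue l x := by
  induction l with
  | nil => rfl
  | cons p l ih =>
    have : flipWord (p :: l) = (-p.1, p.2) :: flipWord l := rfl
    rw [this, wordValue_cons, ih, wordValue_cons]
    simp

theorem IsReducedWord.flip {l : List (ℤˣ × G)} (h : IsReducedWord l) :
    IsReducedWord (flipWord l) := by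
  unfold IsReducedWord flipWord
  rw [List.isChain_map]
  refine List.IsChain.imp (fun p q hpq h' => hpq ?_) h
  simpa [neg_eq_iff_eq_neg] using h'

end Words

/-! ### A criterion for the absence of mixed identities -/

section Criterion

variable {G M : Type*} [Group G] [MulAction G M] [DecidableEq M]

variable (G) in
/-- A group action, with a family of finite sets called closed, in which every non-trivial element
moves some member of every orbit of the pointwise stabiliser of a closed set. -/
structure MovesTypes (𝒞 : Set (Finset M)) : Prop where
  image_mem : ∀ A ∈ 𝒞, ∀ g : G, A.image (g • ·) ∈ 𝒞
  empty_mem : ∅ ∈ 𝒞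
  step : ∀ A ∈ 𝒞, ∀ u ∉ A, ∃ A₁ ∈ 𝒞, A ⊆ A₁ ∧ u ∉ A₁ ∧ insert u A₁ ∈ 𝒞
  infinite : ∀ A ∈ 𝒞, ∀ q ∉ A, insert q A ∈ 𝒞 → ∀ F : Finset M,
    ∃ h : G, (∀ a ∈ A, h • a = a) ∧ h • q ∉ F
  moves : ∀ A ∈ 𝒞, ∀ q ∉ A, insert q A ∈ 𝒞 → ∀ F : Finset M, ∀ g : G, g ≠ 1 →
    ∃ h : G, (∀ a ∈ A, h • a = a) ∧ h • q ∉ F ∧ g • h • q ≠ h • q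

variable {𝒞 : Set (Finset M)}

/-- The element `x` can be changed outside of `A` so that a finite piece of it guarantees that the
inverse of the value of the word `l` does not map `u` to `t`. -/
def CanAvoid (𝒞 : Set (Finset M)) (l : List (ℤˣ × G)) (x : G) (A : Finset M) (u t : M) : Prop :=
  ∃ y : G, ∃ B ∈ 𝒞, A ⊆ B ∧ (∀ a ∈ A, y • a = x • a) ∧
    ∀ z : G, (∀ b ∈ B, z • b = y • b) → (wordValue l z)⁻¹ • u ≠ t

/-- Prescribing `x` on `A` is the same as prescribing `x⁻¹` on the image of `A`, so domain and range
of the approximation change roles. -/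
theorem CanAvoid.of_flip (h𝒞 : MovesTypes G 𝒞) {l : List (ℤˣ × G)} {x : G} {A : Finset M} {u t : M}
    (h : CanAvoid 𝒞 (flipWord l) x⁻¹ (A.image (x • ·)) u t) : CanAvoid 𝒞 l x A u t := by
  obtain ⟨y, B, hB, hAB, hy, hz⟩ := h
  have hy' : ∀ a ∈ A, y • x • a = a := fun a ha => by
    rw [hy _ (Finset.mem_image_of_mem _ ha), inv_smul_smul]
  refine ⟨y⁻¹, B.image (y • ·), h𝒞.image_mem B hB y, fun a ha => ?_, fun a ha => ?_,
    fun z hzz => ?_⟩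
  · exact Finset.mem_image.2 ⟨x • a, hAB (Finset.mem_image_of_mem _ ha), hy' a ha⟩
  · rw [inv_smul_eq_iff, hy' a ha]
  · rw [← wordValue_flipWord]
    refine hz z⁻¹ fun b hb => ?_
    rw [inv_smul_eq_iff, hzz _ (Finset.mem_image_of_mem _ hb), inv_smul_smul]

/-- The inverse of `z⁻¹ * g * w` acts on `u` by `z` first, then by `g⁻¹`, then by `w⁻¹`. As `u ∉ A`,
the value `z • u` may still be varied within an orbit. It is chosen so that `g⁻¹ • z • u` is again a
point at which the approximation needed for the next letter is undetermined. -/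
theorem CanAvoid.of_neg (h𝒞 : MovesTypes G 𝒞) (n : ℕ) : ∀ (l : List (ℤˣ × G)), l.length = n →
    ∀ (g x : G) (A : Finset M) (u t : M), IsReducedWord ((-1, g) :: l) → A ∈ 𝒞 → u ∉ A →
      CanAvoid 𝒞 ((-1, g) :: l) x A u t := by
  induction n with
  | zero =>
    intro l hl g x A u t _ hA hu
    obtain rfl := List.length_eq_zero_iff.1 hl
    obtain ⟨A₁, hA₁, hAA₁, hu₁, huA₁⟩ := h𝒞.step A hA u hu
    have hins : insert (x • u) (A₁.image (x • ·)) ∈ 𝒞 := by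
      have := h𝒞.image_mem _ huA₁ x
      rwa [Finset.image_insert] at this
    have hxu : x • u ∉ A₁.image (x • ·) := by
      simpa [Finset.mem_image] using hu₁
    obtain ⟨h, hfix, hq⟩ := h𝒞.infinite _ (h𝒞.image_mem A₁ hA₁ x) _ hxu hins {g • t}
    refine ⟨h * x, _, huA₁, hAA₁.trans (Finset.subset_insert _ _), fun a ha => ?_, fun z hz => ?_⟩
    · rw [mul_smul, hfix _ (Finset.mem_image_of_mem _ (hAA₁ ha))]
    · have := hz u (Finset.mem_insert_self _ _)
      simp only [wordValue_cons, wordValue_nil, mul_one, Units.val_neg, Units.val_one, zpow_neg,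
        zpow_one, mul_inv_rev, inv_inv, mul_smul, this]
      rw [Ne, inv_smul_eq_iff]
      simpa using hq
  | succ n ih =>
    intro l hl g x A u t hred hA hu
    cases l with
    | nil => simp at hl
    | cons p l =>
    obtain ⟨e, g'⟩ := p
    obtain ⟨A₁, hA₁, hAA₁, hu₁, huA₁⟩ := h𝒞.step A hA u hu
    have hins : insert (x • u) (A₁.image (x • ·)) ∈ 𝒞 := by
      have := h𝒞.image_mem _ huA₁ x
      rwa [Finset.image_insert] at this
    have hxu : x • u ∉ A₁.image (x • ·) := by
      simpa [Finset.mem_image] using hu₁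
    have key : ∃ h : G, (∀ a ∈ A₁.image (x • ·), h • a = a) ∧
        CanAvoid 𝒞 ((e, g') :: l) (h * x) (insert u A₁) (g⁻¹ • h • x • u) t := by
      rcases Int.units_eq_one_or e with rfl | rfl
      -- Next `z⁻¹` is applied, so `g⁻¹ • h • x • u` has to avoid the range of the approximation.
      -- The range contains the value `h • x • u` just chosen, which `g⁻¹` must therefore move.
      · have hg : g ≠ 1 := (List.isChain_cons_cons.1 hred).1 rfl
        obtain ⟨h, hfix, hq, hm⟩ := h𝒞.moves _ (h𝒞.image_mem A₁ hA₁ x) _ hxu hins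
          ((A₁.image (x • ·)).image (g • ·)) g⁻¹ (inv_ne_one.2 hg)
        refine ⟨h, hfix, CanAvoid.of_flip h𝒞 ?_⟩
        have hred' := (IsReducedWord.flip hred.tail)
        refine ih (flipWord l) (by simpa [flipWord] using hl) g' _ _ _ _ hred'
          (h𝒞.image_mem _ huA₁ _) ?_
        rw [Finset.image_insert, Finset.mem_insert, not_or]
        refine ⟨by rwa [mul_smul], fun hmem => hq ?_⟩
        obtain ⟨a, ha, hae⟩ := Finset.mem_image.1 hmem
        simp only [mul_smul] at hae
        rw [hfix _ (Finset.mem_image_of_mem _ ha)] at hae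
        exact Finset.mem_image.2 ⟨x • a, Finset.mem_image_of_mem _ ha, by rw [hae, smul_inv_smul]⟩
      -- Next `z` is applied again, and only the domain `insert u A₁` has to be avoided.
      · obtain ⟨h, hfix, hq⟩ := h𝒞.infinite _ (h𝒞.image_mem A₁ hA₁ x) _ hxu hins
          ((insert u A₁).image (g • ·))
        refine ⟨h, hfix, ih l (by simpa using hl) g' _ _ _ _ hred.tail huA₁ fun hmem => hq ?_⟩
        exact Finset.mem_image.2 ⟨_, hmem, by rw [smul_inv_smul]⟩
    obtain ⟨h, hfix, y, B, hB, hAB, hy, hz⟩ := key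
    refine ⟨y, B, hB, (hAA₁.trans (Finset.subset_insert _ _)).trans hAB, fun a ha => ?_,
      fun z hzz => ?_⟩
    · rw [hy a (Finset.mem_insert_of_mem (hAA₁ ha)), mul_smul,
        hfix _ (Finset.mem_image_of_mem _ (hAA₁ ha))]
    · have hzu : z • u = h • x • u := by
        rw [hzz u (hAB (Finset.mem_insert_self _ _)), hy u (Finset.mem_insert_self _ _), mul_smul]
      rw [wordValue_cons, mul_inv_rev, mul_smul]
      simpa [mul_smul, hzu] using hz z hzz

theorem MovesTypes.exists_notMem [Nonempty M] (h𝒞 : MovesTypes G 𝒞) (F : Finset M) :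
    ∃ u : M, u ∉ F := by
  obtain ⟨p⟩ := ‹Nonempty M›
  obtain ⟨A, hA, -, hp, hpA⟩ := h𝒞.step ∅ h𝒞.empty_mem p (Finset.notMem_empty _)
  obtain ⟨h, -, hh⟩ := h𝒞.infinite A hA p hp hpA F
  exact ⟨_, hh⟩

/-- If `c * w = 1`, then `w⁻¹` maps every `u` to `c • u`, which can be avoided at one `u` as soon as
`w` has a letter. If it has none, the value is the constant `c`, and only then does the assumption
`hl` matter. -/
theorem MovesTypes.exists_wordValue_ne [Nonempty M] (h𝒞 : MovesTypes G 𝒞) (l : List (ℤˣ × G))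
    (hl : ∃ x, wordValue l x ≠ 1) (x : G) {A : Finset M} (hA : A ∈ 𝒞) :
    ∃ y : G, ∃ B ∈ 𝒞, A ⊆ B ∧ (∀ a ∈ A, y • a = x • a) ∧
      ∀ z : G, (∀ b ∈ B, z • b = y • b) → wordValue l z ≠ 1 := by
  obtain ⟨c, l', hred, hval⟩ := exists_reducedWord l
  cases l' with
  | nil =>
    obtain ⟨x₀, hx₀⟩ := hl
    refine ⟨x, A, hA, subset_rfl, fun _ _ => rfl, fun z _ => ?_⟩
    rw [hval] at hx₀ ⊢
    exact hx₀
  | cons p l' =>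
    suffices ∃ u, CanAvoid 𝒞 (p :: l') x A u (c • u) by
      obtain ⟨u, y, B, hB, hAB, hy, hz⟩ := this
      refine ⟨y, B, hB, hAB, hy, fun z hzz h1 => hz z hzz ?_⟩
      rw [hval] at h1
      rw [inv_eq_of_mul_eq_one_left h1]
    obtain ⟨e, g⟩ := p
    rcases Int.units_eq_one_or e with rfl | rfl
    · obtain ⟨u, hu⟩ := h𝒞.exists_notMem (A.image (x • ·))
      exact ⟨u, CanAvoid.of_flip h𝒞 (CanAvoid.of_neg h𝒞 _ (flipWord l') rfl g _ _ _ _ hred.flip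
        (h𝒞.image_mem A hA x) hu)⟩
    · obtain ⟨u, hu⟩ := h𝒞.exists_notMem A
      exact ⟨u, CanAvoid.of_neg h𝒞 _ l' rfl g _ _ _ _ hred hA hu⟩

/-- For the induction the common point is strengthened to a whole neighbourhood, given by a finite
closed set, which is refined once for each word. -/
theorem MovesTypes.sInter_nonempty [Nonempty M] (h𝒞 : MovesTypes G 𝒞) {S : Set (Set G)}
    (hS : S.Finite) (hw : ∀ U ∈ S, ∃ l : List (ℤˣ × G), U = {x | wordValue l x ≠ 1})
    (hne : ∀ U ∈ S, U.Nonempty) : (⋂₀ S).Nonempty := by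
  suffices ∃ y : G, ∃ B ∈ 𝒞, ∀ z : G, (∀ b ∈ B, z • b = y • b) → z ∈ ⋂₀ S by
    obtain ⟨y, B, -, h⟩ := this
    exact ⟨y, h y fun _ _ => rfl⟩
  induction S, hS using Set.Finite.induction_on with
  | empty => exact ⟨1, ∅, h𝒞.empty_mem, by simp⟩
  | @insert U S _ _ ih =>
    obtain ⟨x, A, hA, h⟩ := ih (fun V hV => hw V (Or.inr hV)) (fun V hV => hne V (Or.inr hV))
    obtain ⟨l, rfl⟩ := hw U (Or.inl rfl)
    obtain ⟨y, B, hB, hAB, hy, hz⟩ := h𝒞.exists_wordValue_ne l (hne _ (Or.inl rfl)) x hA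
    refine ⟨y, B, hB, fun z hzz => ?_⟩
    rw [Set.sInter_insert]
    exact ⟨hz z hzz, h z fun a ha => by rw [hzz a (hAB ha), hy a ha]⟩

theorem MovesTypes.not_zariskiIsGroupTopology [Nonempty M] (h𝒞 : MovesTypes G 𝒞) :
    ¬ ZariskiIsGroupTopology G := by
  intro hG
  let _ : TopologicalSpace G := zariskiTopology G
  have : IsTopologicalGroup G := hG
  have : T1Space G := by
    rw [t1Space_iff_exists_open]
    intro x y hxy
    -- The word `x * y⁻¹` defines the complement of `y`.
    refine ⟨_, TopologicalSpace.isOpen_generateFrom_of_mem ⟨[(1, y⁻¹)], rfl⟩, ?_, ?_⟩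
    · simpa [mul_inv_eq_one] using hxy
    · simp
  obtain ⟨g, hg⟩ : ∃ g : G, g ≠ 1 := by
    obtain ⟨p⟩ := ‹Nonempty M›
    obtain ⟨A, hA, -, hp, hpA⟩ := h𝒞.step ∅ h𝒞.empty_mem p (Finset.notMem_empty _)
    obtain ⟨h, -, hh⟩ := h𝒞.infinite A hA p hp hpA {p}
    exact ⟨h, by rintro rfl; simp at hh⟩
  obtain ⟨U, V, hU, hV, hgU, h1V, hUV⟩ := t2_separation hg
  have hbasis := TopologicalSpace.isTopologicalBasis_of_subbasis
    (rfl : (inferInstance : TopologicalSpace G) = zariskiTopology G)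
  obtain ⟨_, ⟨S, ⟨hS, hSw⟩, rfl⟩, hgS, hSU⟩ := hbasis.exists_subset_of_mem_open hgU hU
  obtain ⟨_, ⟨T, ⟨hT, hTw⟩, rfl⟩, h1T, hTV⟩ := hbasis.exists_subset_of_mem_open h1V hV
  obtain ⟨x, hx⟩ := h𝒞.sInter_nonempty (S := S ∪ T) (hS.union hT)
    (fun W hW => hW.elim (fun h => hSw h) (fun h => hTw h))
    (fun W hW => hW.elim (fun h => ⟨g, hgS W h⟩) (fun h => ⟨1, h1T W h⟩))
  rw [Set.sInter_union] at hx
  exact Set.disjoint_left.1 hUV (hSU hx.1) (hTV hx.2)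

end Criterion

end ZariskiAut

namespace ZariskiAut

open FirstOrder FirstOrder.Language FirstOrder.Language.Structure

/-! ### Automorphism groups of ultrahomogeneous structures -/

section Aut

variable {L : FirstOrder.Language.{u, v}} {M : Type w} [L.Structure M]

instance autAction : MulAction (M ≃[L] M) M where
  smul f x := f x
  one_smul _ := rfl
  mul_smul _ _ _ := rfl

theorem aut_relMap (g : M ≃[L] M) {n : ℕ} (R : L.Relations n) (x : Fin n → M) :
    RelMap R (fun i => g (x i)) ↔ RelMap R x := StrongHomClass.map_rel g R x

/-- Meant for relational languages, where every finite set is a substructure. The condition on moved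
points is put in the contrapositive form in which it is verified below. -/
theorem movesTypes_univ [DecidableEq M]
    (hinf : ∀ (A : Finset M), ∀ q ∉ A, ∀ F : Finset M,
      ∃ h : M ≃[L] M, (∀ a ∈ A, h a = a) ∧ h q ∉ F)
    (hmov : ∀ (A : Finset M), ∀ q ∉ A, ∀ F : Finset M, ∀ g : M ≃[L] M,
      (∀ h : M ≃[L] M, (∀ a ∈ A, h a = a) → h q ∉ F → g (h q) = h q) → ∀ a, g a = a) :
    MovesTypes (M ≃[L] M) (Set.univ : Set (Finset M)) where
  image_mem _ _ _ := trivial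
  empty_mem := trivial
  step A _ u hu := ⟨A, trivial, subset_rfl, hu, trivial⟩
  infinite A _ q hq _ F := hinf A q hq F
  moves A _ q hq _ F g hg := by
    by_contra! hcon
    exact hg (FirstOrder.Language.Equiv.ext fun a =>
      hmov A q hq F g (fun h h1 h2 => hcon h h1 h2) a)

end Aut

/-! ### Finite partial maps and one-step extensions in relational Fraïssé limits -/

section Relational

variable {L : FirstOrder.Language.{u, v}}

/-- An injection that preserves the relations in both directions. -/
structure IsRelEmb (L : FirstOrder.Language.{u, v}) {X Y : Type*} [L.Structure X] [L.Structure Y]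
    (f : X → Y) : Prop where
  inj : Function.Injective f
  rel : ∀ (n : ℕ) (R : L.Relations n) (x : Fin n → X), RelMap R (fun i => f (x i)) ↔ RelMap R x

theorem isRelEmb_of_embedding {X Y : Type*} [L.Structure X] [L.Structure Y] (f : X ↪[L] Y) :
    IsRelEmb L f := ⟨f.injective, fun _ R x => f.map_rel R x⟩

variable [L.IsRelational]

/-- An injection which preserves the relations, as an embedding of relational structures. -/
def IsRelEmb.toEmbedding {X Y : Type*} [L.Structure X] [L.Structure Y] {f : X → Y}
    (hf : IsRelEmb L f) : X ↪[L] Y where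
  toFun := f
  inj' := hf.inj
  map_fun' F := isEmptyElim F
  map_rel' {n} R x := hf.rel n R x

/-- The relational structure induced along a map. -/
@[reducible] def pullback (L : FirstOrder.Language.{u, v}) [L.IsRelational] {X Y : Type*}
    [L.Structure Y] (f : X → Y) : L.Structure X where
  funMap F := isEmptyElim F
  RelMap R x := RelMap R (fun i => f (x i))

theorem isRelEmb_pullback {X Y : Type*} [L.Structure Y] {f : X → Y} (hf : Function.Injective f) :
    @IsRelEmb L X Y (pullback L f) _ f :=
  @IsRelEmb.mk L X Y (pullback L f) _ f hf fun _ _ _ => Iff.rfl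

theorem mem_pullback {K : Set (Bundled.{w} L.Structure)} (hK : Hereditary K) {D : Type w}
    [L.Structure D] (hD : (⟨D, inferInstance⟩ : Bundled L.Structure) ∈ K) {X : Type w} [Finite X]
    {f : X → D} (hf : Function.Injective f) : (⟨X, pullback L f⟩ : Bundled L.Structure) ∈ K := by
  let _ := pullback L f
  exact hK _ hD ⟨Structure.FG.of_finite, ⟨(isRelEmb_pullback hf).toEmbedding⟩⟩

/-- A subset of a relational structure, as a substructure. -/
def setSubstructure (L : FirstOrder.Language.{u, v}) [L.IsRelational] {M : Type*} [L.Structure M]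
    (X : Set M) : L.Substructure M := ⟨X, fun F => isEmptyElim F⟩

variable {K : Set (Bundled.{w} L.Structure)} {M : Type w} [L.Structure M] [Countable M]

theorem exists_aut_eqOn (hM : IsFraisseLimit K M) (X : Finset M) (f : M → M)
    (hf : Set.InjOn f X) (hrel : ∀ (n : ℕ) (R : L.Relations n) (x : Fin n → M), (∀ i, x i ∈ X) →
      (RelMap R (fun i => f (x i)) ↔ RelMap R x)) :
    ∃ h : M ≃[L] M, ∀ x ∈ X, h x = f x := by
  let S : L.Substructure M := setSubstructure L X
  have : Finite S := X.finite_toSet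
  have hemb : IsRelEmb L (fun x : S => f x) :=
    ⟨fun x y hxy => Subtype.ext (hf x.2 y.2 hxy), fun n R x => hrel n R _ fun i => (x i).2⟩
  obtain ⟨h, hh⟩ := hM.ultrahomogeneous S Substructure.FG.of_finite hemb.toEmbedding
  exact ⟨h, fun x hx => (DFunLike.congr_fun hh ⟨x, hx⟩).symm⟩

/-- The extension property of a Fraïssé limit, arranged so that the points of `X` stay in place. -/
theorem exists_isRelEmb_extending (hM : IsFraisseLimit K M) (X : Finset M) {D : Type w}
    [L.Structure D] (hD : (⟨D, inferInstance⟩ : Bundled L.Structure) ∈ K) (ι : X → D)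
    (hι : Function.Injective ι) (hrel : ∀ (n : ℕ) (R : L.Relations n) (x : Fin n → X),
      RelMap R (fun i => ι (x i)) ↔ RelMap R (fun i => (x i : M))) :
    ∃ j : D → M, IsRelEmb L j ∧ ∀ x : X, j (ι x) = x := by
  let S : L.Substructure M := setSubstructure L X
  have : Finite S := X.finite_toSet
  have hemb : IsRelEmb L (fun x : S => ι x) := ⟨hι, hrel⟩
  rw [← hM.age] at hD
  have := hD.2
  obtain ⟨j, hj⟩ := hM.ultrahomogeneous.extend_embedding (Structure.FG.of_finite (M := S))
    S.subtype hemb.toEmbedding (T := D)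
  exact ⟨j, isRelEmb_of_embedding j, fun x => (DFunLike.congr_fun hj x).symm⟩

theorem mem_class_of_finset (hM : IsFraisseLimit K M) (X : Finset M) :
    (⟨X, pullback L (Subtype.val : X → M)⟩ : Bundled L.Structure) ∈ K := by
  let _ := pullback L (Subtype.val : X → M)
  rw [← hM.age]
  exact ⟨Structure.FG.of_finite, ⟨(isRelEmb_pullback Subtype.val_injective).toEmbedding⟩⟩

theorem finite_of_mem_class (hM : IsFraisseLimit K M) {D : Bundled.{w} L.Structure} (hD : D ∈ K) :
    Finite D := by
  rw [← hM.age] at hD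
  exact hD.1.finite

end Relational

/-! ### Structures with one binary relation -/

section Binary

/-- The structure with a given binary relation. -/
@[reducible] def binStructure {X : Type*} (r : X → X → Prop) : binLanguage.Structure X where
  funMap F := nomatch F
  RelMap {n} R x := match n, R, x with
    | _, BinRel.edge, x => r (x 0) (x 1)

theorem bin_rel_iff {X Y : Type*} [binLanguage.Structure X] [binLanguage.Structure Y] (f : X → Y)
    {n : ℕ} (R : binLanguage.Relations n) (x : Fin n → X)
    (h : ∀ i j, Edge (f (x i)) (f (x j)) ↔ Edge (x i) (x j)) :
    RelMap R (fun i => f (x i)) ↔ RelMap R x := by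
  cases R
  have h1 : x = ![x 0, x 1] := List.ofFn_inj.mp rfl
  have h2 : (fun i => f (x i)) = ![f (x 0), f (x 1)] := List.ofFn_inj.mp rfl
  rw [h2, h1]
  exact h 0 1

/-- The relation symbol of `binLanguage`. -/
def edgeRel : binLanguage.Relations 2 := BinRel.edge

theorem edge_iff_relMap {X Y : Type*} [binLanguage.Structure Y] (f : X → Y) (x y : X) :
    Edge (f x) (f y) ↔ RelMap edgeRel (fun i => f (![x, y] i)) := by
  have : (fun i => f (![x, y] i)) = ![f x, f y] := by
    ext i
    fin_cases i <;> rfl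
  rw [this]
  rfl

theorem edge_map_iff {X Y : Type*} [binLanguage.Structure X] [binLanguage.Structure Y] {f : X → Y}
    (hf : ∀ (n : ℕ) (R : binLanguage.Relations n) (x : Fin n → X),
      RelMap R (fun i => f (x i)) ↔ RelMap R x) (x y : X) : Edge (f x) (f y) ↔ Edge x y := by
  rw [edge_iff_relMap f, hf]
  rfl

theorem edge_pullback {X Y : Type*} [binLanguage.Structure Y] (f : X → Y) (x y : X) :
    @Edge X (pullback binLanguage f) x y ↔ Edge (f x) (f y) :=
  (edge_iff_relMap f x y).symm

variable {M : Type w} [binLanguage.Structure M] [Countable M]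

theorem tournament_edge (hM : IsFraisseLimit (tournamentClass.{w}) M) :
    (∀ x : M, ¬ Edge x x) ∧ ∀ x y : M, x ≠ y → Xor (Edge x y) (Edge y x) := by
  classical
  have key := fun x y : M => mem_class_of_finset hM {x, y}
  refine ⟨fun x hx => ?_, fun x y hxy => ?_⟩
  · have := (key x x).2.1 ⟨x, by simp⟩
    exact this ((edge_pullback _ _ _).2 hx)
  · have := (key x y).2.2 ⟨x, by simp⟩ ⟨y, by simp⟩ (by simpa using hxy)
    simpa only [edge_pullback] using this

/-- A vertex added to a finite tournament may have its edges directed at will, and the limit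
realises every such extension. -/
theorem tournament_extension (hM : IsFraisseLimit (tournamentClass.{w}) M) (X : Finset M)
    (P : M → Prop) : ∃ q ∉ X, ∀ x ∈ X, (Edge q x ↔ P x) := by
  classical
  obtain ⟨hirr, htot⟩ := tournament_edge hM
  let r : Option X → Option X → Prop
    | none, none => False
    | none, some b => P b
    | some a, none => ¬ P a
    | some a, some b => Edge (a : M) (b : M)
  let s : binLanguage.Structure (Option X) := binStructure r
  have hEr : ∀ x y : Option X, Edge x y ↔ r x y := fun x y => Iff.rfl
  have hD : (⟨Option X, s⟩ : Bundled binLanguage.Structure) ∈ tournamentClass := by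
    refine ⟨inferInstanceAs (Finite (Option X)), ?_, ?_⟩
    · rintro (_ | a)
      · exact fun h => h
      · exact hirr a
    · rintro (_ | a) (_ | b) hab
      · exact absurd rfl hab
      · rw [hEr, hEr]
        by_cases h : P b <;> simp [r, h, Xor]
      · rw [hEr, hEr]
        by_cases h : P a <;> simp [r, h, Xor]
      · exact htot a b fun h => hab (congrArg some (Subtype.ext h))
  obtain ⟨j, hj, hjx⟩ := exists_isRelEmb_extending hM X hD some (Option.some_injective _) (by
    intro n R x
    let _ := pullback binLanguage (Subtype.val : X → M)
    exact bin_rel_iff (f := some) R x fun i j => (edge_pullback Subtype.val (x i) (x j)).symm)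
  have hjE : ∀ x y : Option X, Edge (j x) (j y) ↔ r x y := fun x y => edge_map_iff hj.rel x y
  refine ⟨j none, fun h => ?_, fun x hx => ?_⟩
  · have := hj.inj (hjx ⟨_, h⟩)
    simp at this
  · have := hjE none (some ⟨x, hx⟩)
    rwa [hjx] at this

/-- Outgoing edges determine incoming ones in a tournament, so they alone give the type of a vertex
over `A`. -/
theorem tournament_homogeneous (hM : IsFraisseLimit (tournamentClass.{w}) M) (A : Finset M)
    {q q' : M} (hq : q ∉ A) (hq' : q' ∉ A) (h : ∀ a ∈ A, (Edge q' a ↔ Edge q a)) :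
    ∃ h : M ≃[binLanguage] M, (∀ a ∈ A, h a = a) ∧ h q = q' := by
  classical
  obtain ⟨hirr, htot⟩ := tournament_edge hM
  have h' : ∀ a ∈ A, (Edge a q' ↔ Edge a q) := by
    intro a ha
    have h1 := htot a q' (by rintro rfl; exact hq' ha)
    have h2 := htot a q (by rintro rfl; exact hq ha)
    have := h a ha
    unfold Xor at h1 h2
    tauto
  obtain ⟨k, hk⟩ := exists_aut_eqOn hM (insert q A) (fun x => if x = q then q' else x) (by
    intro x hx y hy hxy
    rw [Finset.mem_coe, Finset.mem_insert] at hx hy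
    dsimp only at hxy
    split_ifs at hxy with h1 h2 h2
    · exact h1.trans h2.symm
    · exact absurd (hxy ▸ hy.resolve_left h2) hq'
    · exact absurd (hxy ▸ hx.resolve_left h1) hq'
    · exact hxy) (by
    intro n R x hx
    refine bin_rel_iff (f := fun x => if x = q then q' else x) R x fun i j => ?_
    have hi := Finset.mem_insert.1 (hx i)
    have hj := Finset.mem_insert.1 (hx j)
    split_ifs with h1 h2 h2
    · simp [h1, h2, hirr]
    · rw [h1]; exact h _ (hj.resolve_left h2)
    · rw [h2]; exact h' _ (hi.resolve_left h1)
    · rfl)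
  refine ⟨k, fun a ha => ?_, ?_⟩
  · rw [hk a (Finset.mem_insert_of_mem ha), if_neg]
    rintro rfl
    exact hq ha
  · rw [hk q (Finset.mem_insert_self _ _), if_pos rfl]

theorem not_zariski_tournament (hM : IsFraisseLimit (tournamentClass.{w}) M) :
    ¬ ZariskiIsGroupTopology (M ≃[binLanguage] M) := by
  classical
  obtain ⟨hirr, htot⟩ := tournament_edge hM
  obtain ⟨p, -⟩ := tournament_extension hM ∅ fun _ => True
  have : Nonempty M := ⟨p⟩
  have hE : ∀ (g : M ≃[binLanguage] M) (x y : M), Edge (g x) (g y) ↔ Edge x y :=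
    fun g => edge_map_iff fun _ => aut_relMap g
  -- Conjugates of `q` over `A` can have arbitrary edges to finitely many points outside of `A`.
  have conj : ∀ (A : Finset M), ∀ q ∉ A, ∀ (F : Finset M) (P : M → Prop),
      ∃ h : M ≃[binLanguage] M, (∀ a ∈ A, h a = a) ∧ h q ∉ F ∧
        ∀ x ∈ F, x ∉ A → (Edge (h q) x ↔ P x) := by
    intro A q hq F P
    obtain ⟨q', hq', hE'⟩ := tournament_extension hM (A ∪ F) fun x => if x ∈ A then Edge q x else P x
    rw [Finset.mem_union, not_or] at hq'
    obtain ⟨h, hA, rfl⟩ := tournament_homogeneous hM A hq hq'.1 fun a ha => by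
      rw [hE' a (Finset.mem_union_left _ ha), if_pos ha]
    exact ⟨h, hA, hq'.2, fun x hx hxA => by rw [hE' x (Finset.mem_union_right _ hx), if_neg hxA]⟩
  refine (movesTypes_univ (fun A q hq F => ?_) fun A q hq F g hg => ?_).not_zariskiIsGroupTopology
  · obtain ⟨h, h1, h2, -⟩ := conj A q hq F fun _ => True
    exact ⟨h, h1, h2⟩
  -- points outside of `A` with image outside of `A` are fixed
  have h1 : ∀ a ∉ A, g a ∉ A → g a = a := by
    intro a ha hga
    by_contra hne
    -- A fixed conjugate with an edge to `a` and none to `g a` is impossible.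
    obtain ⟨h, hA, hF, hP⟩ := conj A q hq (F ∪ {a, g a}) (fun x => x = a)
    have hfix := hg h hA fun h => hF (Finset.mem_union_left _ h)
    have e1 := (hP a (by simp) ha).2 rfl
    have e2 := mt (hP (g a) (by simp) hga).1 hne
    rw [← hE g, hfix] at e1
    exact e2 e1
  intro b
  by_contra hne
  -- Neither `c` nor `g c` lies in `A`, so `c` is fixed by `h1`, and it distinguishes `b` from `g
  -- b`.
  obtain ⟨c, hc, hcP⟩ := tournament_extension hM (A ∪ A.image g.symm ∪ {b, g b}) (fun x => x = b)
  simp only [Finset.mem_union, not_or] at hc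
  have hfix := h1 c hc.1.1 fun h => hc.1.2 (Finset.mem_image.2 ⟨_, h, g.symm_apply_apply c⟩)
  have e1 := (hcP b (by simp)).2 rfl
  have e2 := mt (hcP (g b) (by simp)).1 hne
  rw [← hE g, hfix] at e1
  exact e2 e1

end Binary

end ZariskiAut

namespace ZariskiAut

open FirstOrder FirstOrder.Language FirstOrder.Language.Structure

/-! ### Rational metric spaces -/

section DistanceSet

variable {R : Set ℚ}

theorem IsRatDistanceSet.mem_of_le (hR : IsRatDistanceSet R) {x y : ℚ} (hx : x ∈ R) (hy : 0 ≤ y)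
    (hyx : y ≤ x) : y ∈ R := by
  rcases hR with rfl | ⟨b, -, rfl⟩
  · exact hy
  · exact ⟨hy, hyx.trans hx.2⟩

theorem IsRatDistanceSet.exists_upperBound (hR : IsRatDistanceSet R) (S : Finset ℚ)
    (hS : ∀ x ∈ S, x ∈ R) : ∃ K ∈ R, 0 < K ∧ ∀ x ∈ S, x ≤ K := by
  rcases hR with rfl | ⟨b, hb, rfl⟩
  · obtain ⟨K, hK⟩ := S.exists_le
    exact ⟨max K 1, Set.mem_Ici.2 (le_max_of_le_right zero_le_one), lt_max_of_lt_right one_pos,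
      fun x hx => (hK x hx).trans (le_max_left _ _)⟩
  · exact ⟨b, ⟨hb.le, le_rfl⟩, hb, fun x hx => (hS x hx).2⟩

theorem IsRatDistanceSet.exists_pos (hR : IsRatDistanceSet R) : ∃ b ∈ R, 0 < b := by
  obtain ⟨b, hb, h, -⟩ := hR.exists_upperBound ∅ (by simp)
  exact ⟨b, hb, h⟩

theorem IsRatDistanceSet.zero_mem (hR : IsRatDistanceSet R) : (0 : ℚ) ∈ R := by
  obtain ⟨b, hb, h⟩ := hR.exists_pos
  exact hR.mem_of_le hb le_rfl h.le

end DistanceSet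

/-- A metric with values in a set of rationals. -/
structure IsRatMetric (R : Set ℚ) {X : Type*} (d : X → X → ℚ) : Prop where
  mem : ∀ x y, d x y ∈ R
  zero : ∀ x y, d x y = 0 ↔ x = y
  symm : ∀ x y, d x y = d y x
  tri : ∀ x y z, d x z ≤ d x y + d y z

namespace IsRatMetric

variable {R : Set ℚ} {X : Type*} {d : X → X → ℚ}

theorem self (hd : IsRatMetric R d) (x : X) : d x x = 0 := (hd.zero x x).2 rfl

theorem nonneg (hd : IsRatMetric R d) (x y : X) : 0 ≤ d x y := by
  have h1 := hd.tri x y x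
  rw [hd.self, hd.symm y x] at h1
  linarith

theorem pos (hd : IsRatMetric R d) {x y : X} (h : x ≠ y) : 0 < d x y :=
  lt_of_le_of_ne (hd.nonneg x y) fun h' => h ((hd.zero x y).1 h'.symm)

theorem comap (hd : IsRatMetric R d) {Y : Type*} {f : Y → X} (hf : Function.Injective f) :
    IsRatMetric R (fun x y => d (f x) (f y)) :=
  ⟨fun _ _ => hd.mem _ _, fun _ _ => (hd.zero _ _).trans hf.eq_iff, fun _ _ => hd.symm _ _,
    fun _ _ _ => hd.tri _ _ _⟩

/-- The extension of a metric by a point with given distances to the other points. -/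
def optionDist (d : X → X → ℚ) (f : X → ℚ) : Option X → Option X → ℚ
  | none, none => 0
  | none, some y => f y
  | some x, none => f x
  | some x, some y => d x y

theorem option (hR : IsRatDistanceSet R) (hd : IsRatMetric R d) {f : X → ℚ} (hf : ∀ x, f x ∈ R)
    (hpos : ∀ x, 0 < f x) (hle : ∀ x y, f x ≤ f y + d x y) (hge : ∀ x y, d x y ≤ f x + f y) :
    IsRatMetric R (optionDist d f) where
  mem := by
    rintro (_ | x) (_ | y)
    exacts [hR.zero_mem, hf y, hf x, hd.mem x y]
  zero := by
    rintro (_ | x) (_ | y)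
    · simp [optionDist]
    · simp [optionDist, (hpos y).ne']
    · simp [optionDist, (hpos x).ne']
    · simp [optionDist, hd.zero]
  symm := by
    rintro (_ | x) (_ | y)
    exacts [rfl, rfl, rfl, hd.symm x y]
  tri := by
    rintro (_ | x) (_ | y) (_ | z) <;> simp only [optionDist]
    · simp
    · simp
    · linarith [hpos y]
    · rw [hd.symm]; exact (hle z y).trans (by linarith [hd.symm y z])
    · simp
    · exact hge x z
    · linarith [hle x y]
    · exact hd.tri x y z

/-- A function that is a possible distance to a new point on a finite set `S` extends to such a
function on a larger finite set, with values which are as large as possible below some bound. -/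
theorem exists_extension (hR : IsRatDistanceSet R) (hd : IsRatMetric R d) (S : Finset X)
    (f : X → ℚ) (hf : ∀ x ∈ S, f x ∈ R) (hpos : ∀ x ∈ S, 0 < f x)
    (hle : ∀ x ∈ S, ∀ y ∈ S, f x ≤ f y + d x y) (hge : ∀ x ∈ S, ∀ y ∈ S, d x y ≤ f x + f y)
    (T : Finset X) {K₀ : ℚ} (hK₀ : K₀ ∈ R) :
    ∃ g : X → ℚ, (∀ x ∈ S, g x = f x) ∧ (∀ x ∈ T, g x ∈ R) ∧ (∀ x ∈ T, 0 < g x) ∧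
      (∀ x ∈ T, ∀ y ∈ T, g x ≤ g y + d x y) ∧ (∀ x ∈ T, ∀ y ∈ T, d x y ≤ g x + g y) ∧
      ∀ x, K₀ ≤ g x ∨ ∃ y ∈ S, g x = f y + d y x := by
  classical
  obtain ⟨K, hK, hK0, hKle⟩ := hR.exists_upperBound
    (insert K₀ (S.image f ∪ (T ×ˢ T).image fun p => d p.1 p.2)) (by
      intro x hx
      simp only [Finset.mem_insert, Finset.mem_union, Finset.mem_image] at hx
      rcases hx with rfl | ⟨y, hy, rfl⟩ | ⟨p, -, rfl⟩
      exacts [hK₀, hf y hy, hd.mem _ _])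
  have hKf : ∀ x ∈ S, f x ≤ K := fun x hx => hKle _ (by
    simp only [Finset.mem_insert, Finset.mem_union, Finset.mem_image]
    exact Or.inr (Or.inl ⟨x, hx, rfl⟩))
  have hKd : ∀ x ∈ T, ∀ y ∈ T, d x y ≤ K := fun x hx y hy => hKle _ (by
    simp only [Finset.mem_insert, Finset.mem_union, Finset.mem_image]
    exact Or.inr (Or.inr ⟨(x, y), by simp [hx, hy], rfl⟩))
  -- The largest Lipschitz extension cut off at `K`: the minimum of `K` and all `f x + d x y`. Since
  -- `K` bounds `f` on `S` and the distances within `T`, the cut-off violates no triangle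
  -- inequality.
  have hex : ∀ y, ∃ v : ℚ, v ≤ K ∧ (∀ x ∈ S, v ≤ f x + d x y) ∧
      (v = K ∨ ∃ x ∈ S, v = f x + d x y) := by
    intro y
    have hne : (insert K (S.image fun x => f x + d x y)).Nonempty := Finset.insert_nonempty _ _
    refine ⟨Finset.min' _ hne, Finset.min'_le _ _ (Finset.mem_insert_self _ _), fun x hx =>
      Finset.min'_le _ _ (Finset.mem_insert_of_mem (Finset.mem_image_of_mem _ hx)), ?_⟩
    rcases Finset.mem_insert.1 (Finset.min'_mem _ hne) with h | h
    · exact Or.inl h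
    · obtain ⟨x, hx, hxe⟩ := Finset.mem_image.1 h
      exact Or.inr ⟨x, hx, hxe.symm⟩
  choose g hgK hgS hg using hex
  have hgpos : ∀ x, 0 < g x := by
    intro x
    rcases hg x with h | ⟨y, hy, h⟩
    · rw [h]; exact hK0
    · rw [h]; linarith [hpos y hy, hd.nonneg y x]
  refine ⟨g, fun x hx => le_antisymm ?_ ?_, fun x _ => hR.mem_of_le hK (hgpos x).le (hgK x),
    fun x _ => hgpos x, fun x _ y _ => ?_, fun x hx y hy => ?_, fun x => ?_⟩
  · simpa [hd.self] using hgS x x hx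
  · rcases hg x with h | ⟨y, hy, h⟩
    · rw [h]; exact hKf x hx
    · rw [h, hd.symm]; exact hle x hx y hy
  · rcases hg y with h | ⟨z, hz, h⟩
    · rw [h]; linarith [hgK x, hd.nonneg x y]
    · rw [h]; linarith [hgS x z hz, hd.tri z y x, hd.symm x y]
  · rcases hg x with h | ⟨z, hz, h⟩
    · rw [h]; linarith [hKd x hx y hy, hgpos y]
    · rcases hg y with h' | ⟨z', hz', h'⟩
      · rw [h']; linarith [hKd x hx y hy, hgpos x]
      · rw [h, h']
        linarith [hge z hz z' hz', hd.tri x z y, hd.tri z z' y, hd.symm x z]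
  · exact (hg x).imp (fun h => by rw [h]; exact hKle _ (Finset.mem_insert_self _ _)) id

end IsRatMetric

/-! ### Translation between metrics and relational structures -/

section MetricStructure

variable {R : Set ℚ}

/-- The relational structure of a metric space. -/
@[reducible] def distStructure (R : Set ℚ) {X : Type*} (d : X → X → ℚ) :
    (ratMetricLanguage R).Structure X where
  funMap F := nomatch F
  RelMap {n} S x := match n, S, x with
    | _, RatMetricRel.dist q, x => d (x 0) (x 1) ≤ q

/-- The relations of a structure are those given by the function `d`. -/
def InterpretsDist (R : Set ℚ) {X : Type*} [(ratMetricLanguage R).Structure X]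
    (d : X → X → ℚ) : Prop :=
  ∀ (q : R) (x y : X), RelMap (distLE q) ![x, y] ↔ d x y ≤ q

theorem interpretsDist_distStructure {X : Type*} (d : X → X → ℚ) :
    @InterpretsDist R X (distStructure R d) d := fun _ _ _ => Iff.rfl

theorem dist_relMap_comp {X Y : Type*} [(ratMetricLanguage R).Structure Y] (f : X → Y) (q : R)
    (x y : X) : RelMap (distLE q) ![f x, f y] ↔ RelMap (distLE q) (fun i => f (![x, y] i)) := by
  have : (fun i => f (![x, y] i)) = ![f x, f y] := by
    ext i
    fin_cases i <;> rfl
  rw [this]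

theorem InterpretsDist.pullback {X Y : Type*} [(ratMetricLanguage R).Structure Y]
    {d : Y → Y → ℚ} (hd : InterpretsDist R d) (f : X → Y) :
    @InterpretsDist R X (pullback (ratMetricLanguage R) f) (fun x y => d (f x) (f y)) :=
  fun q x y => (dist_relMap_comp f q x y).symm.trans (hd q _ _)

theorem InterpretsDist.rel_iff {X Y : Type*} [(ratMetricLanguage R).Structure X]
    [(ratMetricLanguage R).Structure Y] {d : X → X → ℚ} {d' : Y → Y → ℚ}
    (hd : InterpretsDist R d) (hd' : InterpretsDist R d') (f : X → Y)
    {n : ℕ} (S : (ratMetricLanguage R).Relations n) (x : Fin n → X)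
    (h : ∀ i j, d' (f (x i)) (f (x j)) = d (x i) (x j)) :
    RelMap S (fun i => f (x i)) ↔ RelMap S x := by
  cases S with
  | dist q =>
  have h1 : x = ![x 0, x 1] := List.ofFn_inj.mp rfl
  have h2 : (fun i => f (x i)) = ![f (x 0), f (x 1)] := List.ofFn_inj.mp rfl
  have e1 := hd q (x 0) (x 1)
  have e2 := hd' q (f (x 0)) (f (x 1))
  rw [← h1] at e1
  rw [← h2, h] at e2
  exact e2.trans e1.symm

/-- Both numbers are themselves admissible thresholds. This is what makes a distance recoverable
from the relations. -/
theorem eq_of_forall_le_iff_mem {a b : ℚ} (ha : a ∈ R) (hb : b ∈ R)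
    (h : ∀ q : R, a ≤ q ↔ b ≤ q) : a = b :=
  le_antisymm ((h ⟨b, hb⟩).2 le_rfl) ((h ⟨a, ha⟩).1 le_rfl)

theorem InterpretsDist.map_eq {X Y : Type*} [(ratMetricLanguage R).Structure X]
    [(ratMetricLanguage R).Structure Y] {d : X → X → ℚ} {d' : Y → Y → ℚ}
    (hd : InterpretsDist R d) (hd' : InterpretsDist R d') (hm : IsRatMetric R d)
    (hm' : IsRatMetric R d') {f : X → Y}
    (hf : ∀ (n : ℕ) (S : (ratMetricLanguage R).Relations n) (x : Fin n → X),
      RelMap S (fun i => f (x i)) ↔ RelMap S x) (x y : X) : d' (f x) (f y) = d x y :=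
  eq_of_forall_le_iff_mem (hm'.mem _ _) (hm.mem _ _) fun q => by
    rw [← hd' q, dist_relMap_comp, hf, hd q]

theorem mem_ratMetricClass {X : Type w} [Finite X] {s : (ratMetricLanguage R).Structure X}
    {d : X → X → ℚ} (hm : IsRatMetric R d) (hd : InterpretsDist R d) :
    (⟨X, s⟩ : Bundled (ratMetricLanguage R).Structure) ∈ ratMetricClass R :=
  ⟨‹Finite X›, d, hm.mem, hm.zero, hm.symm, hm.tri, hd⟩

theorem exists_dist_of_mem {D : Bundled.{w} (ratMetricLanguage R).Structure}
    (hD : D ∈ ratMetricClass R) : ∃ d : D → D → ℚ, IsRatMetric R d ∧ InterpretsDist R d := by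
  obtain ⟨-, d, h1, h2, h3, h4, h5⟩ := hD
  exact ⟨d, ⟨h1, h2, h3, h4⟩, h5⟩

end MetricStructure

/-! ### Rational Urysohn spaces and spheres -/

section Urysohn

variable {R : Set ℚ} {M : Type w} [(ratMetricLanguage R).Structure M] [Countable M]

/-- The metrics of the finite subsets fit together because each distance is determined by the
relations; every axiom concerns at most three points. -/
theorem exists_dist_of_isFraisseLimit (hM : IsFraisseLimit (ratMetricClass.{w} R) M) :
    ∃ d : M → M → ℚ, IsRatMetric R d ∧ InterpretsDist R d := by
  classical
  have hloc : ∀ X : Finset M, ∃ dX : X → X → ℚ, IsRatMetric R dX ∧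
      ∀ (q : R) (x y : X), RelMap (distLE q) ![(x : M), (y : M)] ↔ dX x y ≤ q := by
    intro X
    obtain ⟨dX, h1, h2⟩ := exists_dist_of_mem (mem_class_of_finset hM X)
    exact ⟨dX, h1, fun q x y => (dist_relMap_comp Subtype.val q x y).trans (h2 q x y)⟩
  have hd : ∀ x y : M, ∃ u ∈ R, ∀ q : R, RelMap (distLE q) ![x, y] ↔ u ≤ q := by
    intro x y
    obtain ⟨dX, h1, h2⟩ := hloc {x, y}
    exact ⟨_, h1.mem ⟨x, by simp⟩ ⟨y, by simp⟩, fun q => h2 q ⟨x, by simp⟩ ⟨y, by simp⟩⟩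
  choose d hdR hd using hd
  have hX : ∀ (X : Finset M), IsRatMetric R (fun x y : X => d x y) := by
    intro X
    obtain ⟨dX, h1, h2⟩ := hloc X
    have : (fun x y : X => d x y) = dX := by
      funext x y
      exact eq_of_forall_le_iff_mem (hdR _ _) (h1.mem _ _) fun q => by rw [← hd, h2]
    rwa [this]
  refine ⟨d, ⟨hdR, fun x y => ?_, fun x y => ?_, fun x y z => ?_⟩, fun q x y => hd x y q⟩
  · simpa using (hX {x, y}).zero ⟨x, by simp⟩ ⟨y, by simp⟩
  · simpa using (hX {x, y}).symm ⟨x, by simp⟩ ⟨y, by simp⟩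
  · simpa using (hX {x, y, z}).tri ⟨x, by simp⟩ ⟨y, by simp⟩ ⟨z, by simp⟩

variable {d : M → M → ℚ}

/-- The last clause says that distances to the points of `T` are as large as `K₀` or the prescribed
values permit. It is used to show that `g a` cannot have the same distance from the new point as
`a`. -/
theorem urysohn_extension (hM : IsFraisseLimit (ratMetricClass.{w} R) M) (hR : IsRatDistanceSet R)
    (hm : IsRatMetric R d) (hd : InterpretsDist R d) (S : Finset M) (f : M → ℚ)
    (hf : ∀ x ∈ S, f x ∈ R) (hpos : ∀ x ∈ S, 0 < f x)
    (hle : ∀ x ∈ S, ∀ y ∈ S, f x ≤ f y + d x y) (hge : ∀ x ∈ S, ∀ y ∈ S, d x y ≤ f x + f y)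
    (T : Finset M) {K₀ : ℚ} (hK₀ : K₀ ∈ R) :
    ∃ z : M, z ∉ S ∧ z ∉ T ∧ (∀ x ∈ S, d z x = f x) ∧
      ∀ x ∈ T, K₀ ≤ d z x ∨ ∃ y ∈ S, d z x = f y + d y x := by
  classical
  obtain ⟨g, h1, h2, h3, h4, h5, h6⟩ := hm.exists_extension hR S f hf hpos hle hge (S ∪ T) hK₀
  have hmX : IsRatMetric R (fun x y : (S ∪ T : Finset M) => d x y) :=
    hm.comap Subtype.val_injective
  have hmO : IsRatMetric R (IsRatMetric.optionDist (fun x y : (S ∪ T : Finset M) => d x y)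
      (fun x => g x)) :=
    hmX.option hR (fun x => h2 x x.2) (fun x => h3 x x.2) (fun x y => h4 x x.2 y y.2)
      (fun x y => h5 x x.2 y y.2)
  let s := distStructure R (IsRatMetric.optionDist (fun x y : (S ∪ T : Finset M) => d x y)
    (fun x => g x))
  have hdO := interpretsDist_distStructure (R := R)
    (IsRatMetric.optionDist (fun x y : (S ∪ T : Finset M) => d x y) (fun x => g x))
  obtain ⟨j, hj, hjx⟩ := exists_isRelEmb_extending hM (S ∪ T) (mem_ratMetricClass hmO hdO) some
    (Option.some_injective _) (by
      intro n Q x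
      let _ := pullback (ratMetricLanguage R) (Subtype.val : (S ∪ T : Finset M) → M)
      exact (hd.pullback Subtype.val).rel_iff hdO some Q x fun _ _ => rfl)
  have hjd := hdO.map_eq hd hmO hm hj.rel
  have hz : j none ∉ S ∪ T := fun h => by
    have := hj.inj (hjx ⟨_, h⟩)
    simp at this
  have hzd : ∀ x ∈ S ∪ T, d (j none) x = g x := fun x hx => by
    have := hjd none (some ⟨x, hx⟩)
    rwa [hjx] at this
  rw [Finset.mem_union, not_or] at hz
  refine ⟨j none, hz.1, hz.2, fun x hx => ?_, fun x hx => ?_⟩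
  · rw [hzd x (Finset.mem_union_left _ hx), h1 x hx]
  · rw [hzd x (Finset.mem_union_right _ hx)]
    exact h6 x

theorem urysohn_homogeneous (hM : IsFraisseLimit (ratMetricClass.{w} R) M)
    (hm : IsRatMetric R d) (hd : InterpretsDist R d) (A : Finset M) {q q' : M} (hq : q ∉ A)
    (hq' : q' ∉ A) (h : ∀ a ∈ A, d q' a = d q a) :
    ∃ h : M ≃[ratMetricLanguage R] M, (∀ a ∈ A, h a = a) ∧ h q = q' := by
  classical
  obtain ⟨k, hk⟩ := exists_aut_eqOn hM (insert q A) (fun x => if x = q then q' else x) (by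
    intro x hx y hy hxy
    rw [Finset.mem_coe, Finset.mem_insert] at hx hy
    dsimp only at hxy
    split_ifs at hxy with h1 h2 h2
    · exact h1.trans h2.symm
    · exact absurd (hxy ▸ hy.resolve_left h2) hq'
    · exact absurd (hxy ▸ hx.resolve_left h1) hq'
    · exact hxy) (by
    intro n Q x hx
    refine hd.rel_iff hd (fun x => if x = q then q' else x) Q x fun i j => ?_
    have hi := Finset.mem_insert.1 (hx i)
    have hj := Finset.mem_insert.1 (hx j)
    split_ifs with h1 h2 h2
    · simp [h1, h2, hm.self]
    · rw [h1]; exact h _ (hj.resolve_left h2)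
    · rw [h2, hm.symm, hm.symm _ q]; exact h _ (hi.resolve_left h1)
    · rfl)
  refine ⟨k, fun a ha => ?_, ?_⟩
  · rw [hk a (Finset.mem_insert_of_mem ha), if_neg]
    rintro rfl
    exact hq ha
  · rw [hk q (Finset.mem_insert_self _ _), if_pos rfl]

theorem not_zariski_urysohn (hR : IsRatDistanceSet R)
    (hM : IsFraisseLimit (ratMetricClass.{w} R) M) :
    ¬ ZariskiIsGroupTopology (M ≃[ratMetricLanguage R] M) := by
  classical
  obtain ⟨d, hm, hd⟩ := exists_dist_of_isFraisseLimit hM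
  obtain ⟨b, hb, hb0⟩ := hR.exists_pos
  obtain ⟨p, -⟩ := urysohn_extension hM hR hm hd ∅ (fun _ => 0) (by simp) (by simp) (by simp)
    (by simp) ∅ hb
  have : Nonempty M := ⟨p⟩
  have hiso : ∀ (g : M ≃[ratMetricLanguage R] M) (x y : M), d (g x) (g y) = d x y :=
    fun g => hd.map_eq hd hm hm fun _ => aut_relMap g
  refine (movesTypes_univ (fun A q hq F => ?_) fun A q hq F g hg => ?_).not_zariskiIsGroupTopology
  · have hne : ∀ x ∈ A, q ≠ x := fun x hx h => hq (h ▸ hx)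
    obtain ⟨z, hzA, hzF, hzd, -⟩ := urysohn_extension hM hR hm hd A (d q) (fun x _ => hm.mem q x)
      (fun x hx => hm.pos (hne x hx)) (fun x _ y _ => by rw [hm.symm x y]; exact hm.tri _ _ _)
      (fun x _ y _ => by rw [hm.symm q x]; exact hm.tri _ _ _) F hb
    obtain ⟨h, h1, h2⟩ := urysohn_homogeneous hM hm hd A hq hzA hzd
    exact ⟨h, h1, h2 ▸ hzF⟩
  -- A lower bound for the distances from `q` to `A`, cut off at `b` so that `r / 2` is an
  -- admissible distance even when `A` is empty.
  obtain ⟨r, hr0, hrb, hrA⟩ : ∃ r : ℚ, 0 < r ∧ r ≤ b ∧ ∀ a ∈ A, r ≤ d q a := by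
    have hne : (insert b (A.image (d q))).Nonempty := Finset.insert_nonempty _ _
    refine ⟨Finset.min' _ hne, ?_, Finset.min'_le _ _ (Finset.mem_insert_self _ _), fun a ha =>
      Finset.min'_le _ _ (Finset.mem_insert_of_mem (Finset.mem_image_of_mem _ ha))⟩
    rw [Finset.lt_min'_iff]
    intro y hy
    rcases Finset.mem_insert.1 hy with rfl | hy
    · exact hb0
    · obtain ⟨a, ha, rfl⟩ := Finset.mem_image.1 hy
      exact hm.pos fun h => hq (h ▸ ha)
  have hrR : r / 2 ∈ R := hR.mem_of_le hb (by linarith) (by linarith)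
  -- the points close to `q` are fixed
  have hball : ∀ a, d q a < r / 2 → g a = a := by
    intro a ha
    by_contra hne
    have haA : a ∉ A := fun h => by linarith [hrA a h]
    have hif : ∀ x ∈ A, (if x = a then r / 2 else d q x) = d q x := fun x hx =>
      if_neg (ne_of_mem_of_not_mem hx haA)
    -- A conjugate of `q` at distance `r / 2` from `a`. Its distance to `g a` would have to be `r /
    -- 2` too, but the possible values are at least `b`, or `r / 2 + d a (g a)`, or at least `r`
    -- through `A`.
    obtain ⟨z, hzA, hzF, hzd, hzK⟩ := urysohn_extension hM hR hm hd (insert a A)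
      (fun x => if x = a then r / 2 else d q x)
      (by
        intro x hx
        split_ifs
        exacts [hrR, hm.mem q x])
      (by
        intro x hx
        split_ifs with h
        · linarith
        · linarith [hrA x ((Finset.mem_insert.1 hx).resolve_left h)])
      (by
        intro x hx y hy
        split_ifs with h1 h2 h2
        · linarith [hm.nonneg x y]
        · linarith [hrA y ((Finset.mem_insert.1 hy).resolve_left h2), hm.nonneg x y]
        · subst h2
          linarith [hm.tri q y x, hm.symm x y]
        · linarith [hm.tri q y x, hm.symm x y])
      (by
        intro x hx y hy
        split_ifs with h1 h2 h2
        · rw [h1, h2, hm.self]; linarith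
        · subst h1
          linarith [hm.tri x q y, hm.symm q x]
        · subst h2
          linarith [hm.tri x q y, hm.symm q x]
        · linarith [hm.tri x q y, hm.symm q x])
      (insert (g a) F) hb
    obtain ⟨h, hA, rfl⟩ := urysohn_homogeneous hM hm hd A hq
      (fun h => hzA (Finset.mem_insert_of_mem h)) (fun x hx => by
        rw [hzd x (Finset.mem_insert_of_mem hx), hif x hx])
    have hfix := hg h hA fun h => hzF (Finset.mem_insert_of_mem h)
    have e1 := hzd a (Finset.mem_insert_self _ _)
    rw [if_pos rfl] at e1
    have e2 : d (h q) (g a) = r / 2 := by rw [← e1, ← hiso g (h q) a, hfix]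
    rcases hzK (g a) (Finset.mem_insert_self _ _) with h | ⟨x, hx, h⟩
    · linarith
    · rw [e2] at h
      rcases Finset.mem_insert.1 hx with rfl | hx
      · rw [if_pos rfl] at h
        linarith [hm.pos (Ne.symm hne)]
      · rw [hif x hx] at h
        linarith [hrA x hx, hm.nonneg x (g a)]
  intro a
  by_contra hne
  have hq0 : g q = q := hball q (by rw [hm.self]; linarith)
  have hqa : q ≠ a := by
    rintro rfl
    exact hne hq0
  have hD := hm.pos hqa
  obtain ⟨δ, hδ0, hδD, hδr⟩ : ∃ δ : ℚ, 0 < δ ∧ δ < d q a ∧ δ < r / 2 := by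
    obtain ⟨δ, h1, h2⟩ := exists_between (lt_min hD (half_pos hr0))
    exact ⟨δ, h1, h2.trans_le (min_le_left _ _), h2.trans_le (min_le_right _ _)⟩
  -- A point on a geodesic from `q` to `a`, close enough to `q` to be fixed. Then `g a` has the
  -- distances of `a` to both `q` and `z`; by maximality `d z (g a)` exceeds `d q a - δ` unless `g a
  -- = a`.
  obtain ⟨z, hzA, -, hzd, hzK⟩ := urysohn_extension hM hR hm hd {q, a}
    (fun x => if x = q then δ else d q a - δ)
    (by
      intro x hx
      split_ifs
      exacts [hR.mem_of_le (hm.mem q a) hδ0.le hδD.le,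
        hR.mem_of_le (hm.mem q a) (by linarith) (by linarith)])
    (by
      intro x hx
      split_ifs <;> linarith)
    (by
      intro x hx y hy
      simp only [Finset.mem_insert, Finset.mem_singleton] at hx hy
      rcases hx with rfl | rfl <;> rcases hy with rfl | rfl
      · simp [hm.self]
      · simp only [if_neg hqa.symm, if_true]; linarith
      · simp only [if_neg hqa.symm, if_true, hm.symm x y]; linarith
      · simp [hm.self])
    (by
      intro x hx y hy
      simp only [Finset.mem_insert, Finset.mem_singleton] at hx hy
      rcases hx with rfl | rfl <;> rcases hy with rfl | rfl
      · simp only [hm.self, if_true]; linarith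
      · simp only [if_neg hqa.symm, if_true]; linarith
      · simp only [if_neg hqa.symm, if_true, hm.symm x y]; linarith
      · simp only [hm.self, if_neg hqa.symm]; linarith)
    {g a} (hm.mem q a)
  have e1 := hzd q (by simp)
  have e2 := hzd a (by simp)
  rw [if_pos rfl] at e1
  rw [if_neg hqa.symm] at e2
  have hfix : g z = z := hball z (by rw [hm.symm, e1]; exact hδr)
  have e3 : d z (g a) = d q a - δ := by rw [← e2, ← hiso g z a, hfix]
  have e4 : d q (g a) = d q a := by rw [← hiso g q a, hq0]
  rcases hzK (g a) (by simp) with h | ⟨x, hx, h⟩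
  · linarith
  · simp only [Finset.mem_insert, Finset.mem_singleton] at hx
    rcases hx with rfl | rfl
    · rw [if_pos rfl, e3, e4] at h
      linarith
    · rw [if_neg hqa.symm, e3] at h
      linarith [hm.pos (Ne.symm hne)]

end Urysohn

end ZariskiAut

namespace ZariskiAut

open FirstOrder FirstOrder.Language FirstOrder.Language.Structure

/-! ### Free amalgamation classes -/

section Free

variable {L : FirstOrder.Language.{u, v}} [L.IsRelational] {K : Set (Bundled.{w} L.Structure)}
  {M : Type w} [L.Structure M] [Countable M] [DecidableEq M]

/-- The free amalgam of `B` and `C` over `A` is realised in `M` with `C` in place; homogeneity turns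
the new copy of `B` into the image of `B`. -/
theorem exists_aut_free (hM : IsFraisseLimit K M) (hK : IsFreeAmalgamationClass K)
    {A B C : Finset M} (hAB : A ⊆ B) (hAC : A ⊆ C) :
    ∃ k : M ≃[L] M, (∀ a ∈ A, k a = a) ∧ (∀ b ∈ B, k b ∈ C → b ∈ A) ∧
      ∀ (n : ℕ) (R : L.Relations n) (x : Fin n → M), (∀ i, x i ∈ B.image k ∪ C) → RelMap R x →
        (∀ i, x i ∈ B.image k) ∨ ∀ i, x i ∈ C := by
  let _ := pullback L (Subtype.val : A → M)
  let _ := pullback L (Subtype.val : B → M)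
  let _ := pullback L (Subtype.val : C → M)
  have hf : IsRelEmb L (fun a : A => (⟨a, hAB a.2⟩ : B)) :=
    ⟨fun a b h => Subtype.ext (congrArg (fun x : B => (x : M)) h), fun _ _ _ => Iff.rfl⟩
  have hg : IsRelEmb L (fun a : A => (⟨a, hAC a.2⟩ : C)) :=
    ⟨fun a b h => Subtype.ext (congrArg (fun x : C => (x : M)) h), fun _ _ _ => Iff.rfl⟩
  obtain ⟨D, i, j, hD, hfree⟩ := hK.amalgam ⟨A, inferInstance⟩ ⟨B, inferInstance⟩
    ⟨C, inferInstance⟩ hf.toEmbedding hg.toEmbedding (mem_class_of_finset hM A)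
    (mem_class_of_finset hM B) (mem_class_of_finset hM C)
  obtain ⟨J, hJ, hJC⟩ := exists_isRelEmb_extending hM C (D := D) hD j j.injective
    fun n R x => j.map_rel R x
  obtain ⟨k, hk⟩ := exists_aut_eqOn hM B (fun x => if h : x ∈ B then J (i ⟨x, h⟩) else x) (by
      intro x hx y hy hxy
      rw [Finset.mem_coe] at hx hy
      simp only [dif_pos hx, dif_pos hy] at hxy
      exact congrArg Subtype.val (i.injective (hJ.inj hxy))) (by
      intro n R x hx
      simp only [dif_pos (hx _)]
      rw [hJ.rel n R (fun l => i ⟨x l, hx l⟩)]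
      exact i.map_rel R (fun l => (⟨x l, hx l⟩ : B)))
  have hkB : ∀ b (hb : b ∈ B), k b = J (i ⟨b, hb⟩) := fun b hb => by rw [hk b hb, dif_pos hb]
  have hcomm : ∀ a (ha : a ∈ A), i ⟨a, hAB ha⟩ = j ⟨a, hAC ha⟩ := fun a ha =>
    DFunLike.congr_fun hfree.comm (⟨a, ha⟩ : A)
  refine ⟨k, fun a ha => by rw [hkB a (hAB ha), hcomm a ha, hJC], fun b hb hbC => ?_,
    fun n R x hx hRx => ?_⟩
  · rw [hkB b hb] at hbC
    have h1 : i ⟨b, hb⟩ = j ⟨_, hbC⟩ := hJ.inj (hJC ⟨_, hbC⟩).symm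
    have h2 : i ⟨b, hb⟩ ∈ Set.range i ∩ Set.range j := ⟨⟨_, rfl⟩, ⟨_, h1.symm⟩⟩
    rw [hfree.inter] at h2
    obtain ⟨a, ha⟩ := h2
    have : (a : M) = b := congrArg Subtype.val (i.injective ha)
    exact this ▸ a.2
  · have hy : ∀ l, ∃ d : D, J d = x l := by
      intro l
      rcases Finset.mem_union.1 (hx l) with h | h
      · obtain ⟨b, hb, hbx⟩ := Finset.mem_image.1 h
        exact ⟨_, (hkB b hb).symm.trans hbx⟩
      · exact ⟨_, hJC ⟨x l, h⟩⟩
    choose y hy using hy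
    have hRy : RelMap R y := by
      rw [← hJ.rel]
      simpa only [hy] using hRx
    rcases (hfree.rel n R y).1 hRy with ⟨z, rfl, -⟩ | ⟨z, rfl, -⟩
    · refine Or.inl fun l => Finset.mem_image.2 ⟨z l, (z l).2, ?_⟩
      rw [hkB _ (z l).2]
      exact hy l
    · refine Or.inr fun l => ?_
      have := (hJC (z l)).symm.trans (hy l)
      exact this ▸ (z l).2

/-- All relations between elements of `Z` are constant tuples. -/
def RelFree (L : FirstOrder.Language.{u, v}) {M : Type w} [L.Structure M] (Z : Finset M) : Prop :=
  ∀ (n : ℕ) (R : L.Relations n) (x : Fin n → M), (∀ i, x i ∈ Z) → RelMap R x → ∀ i j, x i = x j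

omit [L.IsRelational] [Countable M] [DecidableEq M] in
-- Transitivity makes constant tuples carry no information, so only non-constant relations matter in
-- what follows.
theorem relMap_iff_of_constant (htr : IsTransitive L M) {n : ℕ} (R : L.Relations n)
    {x y : Fin n → M} (hx : ∀ i j, x i = x j) (hy : ∀ i j, y i = y j) :
    RelMap R x ↔ RelMap R y := by
  cases n with
  | zero => rw [Subsingleton.elim x y]
  | succ n =>
    obtain ⟨g, hg⟩ := htr (x 0) (y 0)
    rw [← aut_relMap g]
    have : (fun i => g (x i)) = y := by
      funext i
      rw [hx i 0, hg, hy 0 i]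
    rw [this]

omit [Countable M] in
/-- A minimal set on which there is a relation other than a constant tuple. -/
theorem exists_minimal_relation (htr : IsTransitive L M) (hnt : ¬ IsTrivial L M) :
    ∃ (Z : Finset M) (c : M) (n : ℕ) (R : L.Relations n) (t : Fin n → M), c ∈ Z ∧ RelMap R t ∧
      (∀ i, t i ∈ Z) ∧ (∀ z ∈ Z, ∃ i, t i = z) ∧ (∃ i, t i ≠ c) ∧ RelFree L (Z.erase c) := by
  have hne : {Z : Finset M | ¬ RelFree L Z}.Nonempty := by
    by_contra hcon
    rw [Set.not_nonempty_iff_eq_empty, Set.eq_empty_iff_forall_notMem] at hcon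
    have hcon' : ∀ (n : ℕ) (R : L.Relations n) (x : Fin n → M), RelMap R x →
        ∀ i j, x i = x j := by
      intro n R x hx
      have := hcon (Finset.univ.image x)
      rw [Set.mem_ofPred_eq, not_not] at this
      exact this n R x (fun i => Finset.mem_image_of_mem _ (Finset.mem_univ i)) hx
    -- With relations on constant tuples only, every permutation would be an automorphism.
    refine hnt fun σ => ⟨⟨σ, fun F => isEmptyElim F, fun {n} R x => ?_⟩, fun x => rfl⟩
    constructor
    · intro h
      have hc := hcon' n R _ h
      refine (relMap_iff_of_constant htr R (fun i j => σ.injective (hc i j)) hc).2 h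
    · intro h
      have hc := hcon' n R _ h
      exact (relMap_iff_of_constant htr R hc (fun i j => congrArg σ (hc i j))).1 h
  obtain ⟨Z, hZ, hmin⟩ := (wellFounded_lt : WellFounded
    ((· < ·) : Finset M → Finset M → Prop)).has_min _ hne
  have hZ' : ¬ RelFree L Z := hZ
  unfold RelFree at hZ'
  push Not at hZ'
  obtain ⟨n, R, t, htZ, hRt, i, j, hij⟩ := hZ'
  -- By minimality `Z` consists of the entries of `t`.
  have himg : Finset.univ.image t = Z := by
    by_contra hcon
    refine hmin (Finset.univ.image t) (fun h => hij ?_) (lt_of_le_of_ne ?_ hcon)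
    · exact h n R t (fun i => Finset.mem_image_of_mem _ (Finset.mem_univ i)) hRt i j
    · intro z hz
      obtain ⟨i, -, rfl⟩ := Finset.mem_image.1 hz
      exact htZ i
  refine ⟨Z, t j, n, R, t, htZ j, hRt, htZ, fun z hz => ?_, ⟨i, hij⟩, ?_⟩
  · rw [← himg] at hz
    obtain ⟨i, -, rfl⟩ := Finset.mem_image.1 hz
    exact ⟨i, rfl⟩
  · by_contra hcon
    exact hmin _ hcon (Finset.erase_ssubset (htZ j))

/-- The set `Z` can be moved so that `c` goes to `b` and the rest of `Z` is free from any given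
finite set over `b`. -/
theorem exists_aut_glue (hM : IsFraisseLimit K M) (hK : IsFreeAmalgamationClass K)
    (htr : IsTransitive L M) {Z : Finset M} {c : M} (hc : c ∈ Z) {W : Finset M} {b : M}
    (hb : b ∈ W) :
    ∃ k : M ≃[L] M, k c = b ∧ (∀ z ∈ Z, k z ∈ W → z = c) ∧
      ∀ (n : ℕ) (R : L.Relations n) (x : Fin n → M), (∀ i, x i ∈ Z.image k ∪ W) → RelMap R x →
        (∀ i, x i ∈ Z.image k) ∨ ∀ i, x i ∈ W := by
  obtain ⟨k₁, hk₁⟩ := htr c b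
  obtain ⟨k₂, h1, h2, h3⟩ := exists_aut_free hM hK (A := {b}) (B := Z.image k₁) (C := W)
    (Finset.singleton_subset_iff.2 (Finset.mem_image.2 ⟨c, hc, hk₁⟩))
    (Finset.singleton_subset_iff.2 hb)
  refine ⟨k₂ * k₁, ?_, fun z hz hzW => ?_, ?_⟩
  · show k₂ (k₁ c) = b
    rw [hk₁, h1 b (Finset.mem_singleton_self b)]
  · have := h2 (k₁ z) (Finset.mem_image_of_mem _ hz) hzW
    rw [Finset.mem_singleton, ← hk₁] at this
    exact k₁.injective this
  · have : Z.image (k₂ * k₁ : M ≃[L] M) = (Z.image k₁).image k₂ := by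
      rw [Finset.image_image]
      rfl
    rw [this]
    exact h3

omit [L.IsRelational] [Countable M] in
-- By freeness the relation lies within the copy of `Z` or within `W`. An entry other than `b'` lies
-- outside of `W`, so it is the copy, which meets `W` in `b` alone. With `b' = g b` this yields `g b
-- = b` once the other entries are fixed.
theorem eq_of_glue {Z : Finset M} {c : M} {n : ℕ} {R : L.Relations n} {t : Fin n → M}
    (htZ : ∀ i, t i ∈ Z) (hZt : ∀ z ∈ Z, ∃ i, t i = z) (hc : c ∈ Z)
    (hi : ∃ i, t i ≠ c) {W : Finset M} {b : M} {k : M ≃[L] M} (hkc : k c = b)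
    (hkW : ∀ z ∈ Z, k z ∈ W → z = c)
    (hk : ∀ (n : ℕ) (R : L.Relations n) (x : Fin n → M), (∀ i, x i ∈ Z.image k ∪ W) →
      RelMap R x → (∀ i, x i ∈ Z.image k) ∨ ∀ i, x i ∈ W)
    {b' : M} (hb' : b' ∈ W) (hrel : RelMap R (fun i => if t i = c then b' else k (t i))) :
    b' = b := by
  obtain ⟨i, hi⟩ := hi
  obtain ⟨j, hj⟩ := hZt c hc
  rcases hk n R _ (fun i => by
      split_ifs
      · exact Finset.mem_union_right _ hb'
      · exact Finset.mem_union_left _ (Finset.mem_image_of_mem _ (htZ i))) hrel with h | h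
  · have := h j
    rw [if_pos hj] at this
    obtain ⟨z, hz, hzb⟩ := Finset.mem_image.1 this
    rw [← hzb, hkW z hz (hzb ▸ hb'), hkc]
  · have := h i
    rw [if_neg hi] at this
    exact absurd (hkW _ (htZ i) this) hi

/-- There is no relation between `a` and the elements of `A`. -/
def FreeFrom (L : FirstOrder.Language.{u, v}) {M : Type w} [L.Structure M] (a : M) (A : Finset M) :
    Prop :=
  a ∉ A ∧ ∀ (n : ℕ) (R : L.Relations n) (x : Fin n → M), (∀ i, x i = a ∨ x i ∈ A) → RelMap R x →
    (∀ i, x i = a) ∨ ∀ i, x i ∈ A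

/-- All free points have the same type over `A`: relations either stay inside `A` or are constant at
the point, where transitivity applies. -/
theorem FreeFrom.exists_aut (hM : IsFraisseLimit K M) (htr : IsTransitive L M) {a b : M}
    {A : Finset M} (ha : FreeFrom L a A) (hb : FreeFrom L b A) :
    ∃ h : M ≃[L] M, (∀ x ∈ A, h x = x) ∧ h a = b := by
  have hA : ∀ x ∈ A, (if x = a then b else x) = x := fun x hx =>
    if_neg (ne_of_mem_of_not_mem hx ha.1)
  obtain ⟨h, hh⟩ := exists_aut_eqOn hM (insert a A) (fun x => if x = a then b else x) (by
    intro x hx y hy hxy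
    rw [Finset.mem_coe, Finset.mem_insert] at hx hy
    dsimp only at hxy
    split_ifs at hxy with h1 h2 h2
    · exact h1.trans h2.symm
    · exact absurd (hxy ▸ hy.resolve_left h2) hb.1
    · exact absurd (hxy ▸ hx.resolve_left h1) hb.1
    · exact hxy) (by
    intro n R x hx
    by_cases hxA : ∀ i, x i ∈ A
    · simp only [hA _ (hxA _)]
    by_cases hxa : ∀ i, x i = a
    · exact relMap_iff_of_constant htr R (fun i j => by rw [hxa i, hxa j])
        (fun i j => by rw [hxa i, hxa j])
    refine iff_of_false (fun hR => ?_) fun hR => ?_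
    · rcases hb.2 n R _ (fun i => by
          split_ifs with h1
          exacts [Or.inl rfl, Or.inr ((Finset.mem_insert.1 (hx i)).resolve_left h1)]) hR with h | h
      · refine hxa fun i => ?_
        have := h i
        by_contra hne
        rw [if_neg hne] at this
        exact hb.1 (this ▸ (Finset.mem_insert.1 (hx i)).resolve_left hne)
      · refine hxA fun i => ?_
        have := h i
        split_ifs at this with h1
        exacts [absurd this hb.1, this]
    · rcases ha.2 n R x (fun i => Finset.mem_insert.1 (hx i)) hR with h | h
      exacts [hxa h, hxA h])
  refine ⟨h, fun x hx => by rw [hh x (Finset.mem_insert_of_mem hx), hA x hx], ?_⟩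
  rw [hh a (Finset.mem_insert_self _ _), if_pos rfl]

/-- The conjugates are produced one by one, each free over `A` from the earlier ones. -/
theorem exists_relFree_conjugates (hM : IsFraisseLimit K M) (hK : IsFreeAmalgamationClass K)
    (A : Finset M) {q : M} (hq : q ∉ A) (m : ℕ) :
    ∃ Q : Finset M, Q.card = m ∧ RelFree L Q ∧
      ∀ x ∈ Q, ∃ h : M ≃[L] M, (∀ a ∈ A, h a = a) ∧ h q = x := by
  induction m with
  | zero =>
    refine ⟨∅, rfl, fun n R x hx _ i => ?_, by simp⟩
    exact absurd (hx i) (Finset.notMem_empty _)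
  | succ m ih =>
    obtain ⟨Q, hQ, hfree, hconj⟩ := ih
    have hQA : ∀ x ∈ Q, x ∉ A := by
      intro x hx hxA
      obtain ⟨h, hA, rfl⟩ := hconj x hx
      exact hq (h.injective (hA _ hxA) ▸ hxA)
    obtain ⟨k, h1, h2, h3⟩ := exists_aut_free hM hK (A := A) (B := insert q A) (C := A ∪ Q)
      (Finset.subset_insert _ _) Finset.subset_union_left
    have hkq : k q ∉ A ∪ Q := fun h => hq (h2 q (Finset.mem_insert_self _ _) h)
    refine ⟨insert (k q) Q, ?_, fun n R x hx hR => ?_, fun x hx => ?_⟩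
    · rw [Finset.card_insert_of_notMem fun h => hkq (Finset.mem_union_right _ h), hQ]
    · rcases h3 n R x (fun i => by
          rcases Finset.mem_insert.1 (hx i) with hi | hi
          · exact Finset.mem_union_left _ (Finset.mem_image.2
              ⟨q, Finset.mem_insert_self _ _, hi.symm⟩)
          · exact Finset.mem_union_right _ (Finset.mem_union_right _ hi)) hR with h | h
      · have : ∀ i, x i = k q := by
          intro i
          rcases Finset.mem_insert.1 (hx i) with hi | hi
          · exact hi
          · obtain ⟨b, hb, hbx⟩ := Finset.mem_image.1 (h i)
            rcases Finset.mem_insert.1 hb with rfl | hb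
            · exact hbx.symm
            · rw [h1 b hb] at hbx
              exact absurd (hbx ▸ hb) (hQA _ hi)
        intro i j
        rw [this i, this j]
      · refine hfree n R x (fun i => (Finset.mem_insert.1 (hx i)).resolve_left fun hi => hkq ?_) hR
        exact hi ▸ h i
    · rcases Finset.mem_insert.1 hx with rfl | hx
      · exact ⟨k, h1, rfl⟩
      · exact hconj x hx

/-- A set all of whose relations are constant except for those involving `c` can be moved so
that `c` becomes free from `A` and the other elements are in the orbit of `q` over `A`. -/
theorem exists_aut_conjugates (hM : IsFraisseLimit K M) (hK : IsFreeAmalgamationClass K)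
    (htr : IsTransitive L M) {Z : Finset M} {c : M} (hZ : RelFree L (Z.erase c))
    (A : Finset M) {q : M} (hq : q ∉ A) :
    ∃ k : M ≃[L] M, FreeFrom L (k c) A ∧
      ∀ z ∈ Z, z ≠ c → ∃ h : M ≃[L] M, (∀ a ∈ A, h a = a) ∧ h q = k z := by
  obtain ⟨Q, hQ, hfree, hconj⟩ := exists_relFree_conjugates hM hK A hq (Z.erase c).card
  have hQA : ∀ x ∈ Q, x ∉ A := by
    intro x hx hxA
    obtain ⟨h, hA, rfl⟩ := hconj x hx
    exact hq (h.injective (hA _ hxA) ▸ hxA)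
  let e := Finset.equivOfCardEq hQ.symm
  -- Any bijection between two relation-free sets preserves all relations, because only constant
  -- tuples occur.
  obtain ⟨k₁, hk₁⟩ := exists_aut_eqOn hM (Z.erase c)
    (fun x => if h : x ∈ Z.erase c then e ⟨x, h⟩ else x) (by
      intro x hx y hy hxy
      rw [Finset.mem_coe] at hx hy
      simp only [dif_pos hx, dif_pos hy] at hxy
      exact congrArg Subtype.val (e.injective (Subtype.ext hxy))) (by
      intro n R x hx
      simp only [dif_pos (hx _)]
      constructor
      · intro h
        have hcst := hfree n R _ (fun i => (e ⟨x i, hx i⟩).2) h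
        refine (relMap_iff_of_constant htr R (fun i j => ?_) hcst).2 h
        exact congrArg Subtype.val (e.injective (Subtype.ext (hcst i j)))
      · intro h
        have hcst := hZ n R _ hx h
        refine (relMap_iff_of_constant htr R (fun i j => ?_) hcst).2 h
        simp only [hcst i j])
  have hk₁Z : ∀ z ∈ Z.erase c, k₁ z ∈ Q := fun z hz => by
    rw [hk₁ z hz, dif_pos hz]
    exact (e _).2
  have hcQ : k₁ c ∉ Q := by
    intro h
    have h1 := (e.symm ⟨k₁ c, h⟩).2
    have h2 : k₁ (e.symm ⟨k₁ c, h⟩) = k₁ c := by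
      rw [hk₁ _ h1, dif_pos h1]
      simp
    exact (Finset.mem_erase.1 h1).1 (k₁.injective h2)
  -- The image of `c` is made free from `A` while the conjugates in `Q` stay where they are.
  obtain ⟨k₂, h1, h2, h3⟩ := exists_aut_free hM hK (A := Q) (B := insert (k₁ c) Q) (C := A ∪ Q)
    (Finset.subset_insert _ _) Finset.subset_union_right
  have hcC : k₂ (k₁ c) ∉ A ∪ Q := fun h => hcQ (h2 _ (Finset.mem_insert_self _ _) h)
  refine ⟨k₂ * k₁, ⟨fun h => hcC (Finset.mem_union_left _ h), fun n R x hx hR => ?_⟩,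
    fun z hz hzc => ?_⟩
  · replace hx : ∀ i, x i = k₂ (k₁ c) ∨ x i ∈ A := hx
    show (∀ i, x i = k₂ (k₁ c)) ∨ _
    rcases h3 n R x (fun i => by
        rcases hx i with hi | hi
        · exact Finset.mem_union_left _ (Finset.mem_image.2
            ⟨k₁ c, Finset.mem_insert_self _ _, hi.symm⟩)
        · exact Finset.mem_union_right _ (Finset.mem_union_left _ hi)) hR with h | h
    · refine Or.inl fun i => (hx i).resolve_right fun hi => ?_
      obtain ⟨b, hb, hbx⟩ := Finset.mem_image.1 (h i)
      rcases Finset.mem_insert.1 hb with rfl | hb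
      · exact hcC (Finset.mem_union_left _ (hbx ▸ hi))
      · rw [h1 b hb] at hbx
        exact hQA b hb (hbx ▸ hi)
    · exact Or.inr fun i => (hx i).resolve_left fun hi => hcC (hi ▸ h i)
  · have hzQ := hk₁Z z (Finset.mem_erase.2 ⟨hzc, hz⟩)
    obtain ⟨h, hA, hh⟩ := hconj _ hzQ
    refine ⟨h, hA, ?_⟩
    show h q = k₂ (k₁ z)
    rw [hh, h1 _ hzQ]

/-- Fixed points spread along copies of one minimal relation: when all entries but one are fixed and
the remaining entry is free from the others' alternatives, it is fixed as well. Three rounds reach,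
in turn, points free from `A` with image outside of `A`, points outside of `A`, and all points. -/
theorem not_zariski_free (hM : IsFraisseLimit K M) (hK : IsFreeAmalgamationClass K)
    (htr : IsTransitive L M) (hnt : ¬ IsTrivial L M) :
    ¬ ZariskiIsGroupTopology (M ≃[L] M) := by
  obtain ⟨Z, c, n, R, t, hc, hRt, htZ, hZt, hi, hfree⟩ := exists_minimal_relation htr hnt
  have : Nonempty M := ⟨c⟩
  refine (movesTypes_univ (fun A q hq F => ?_) fun A q hq F g hg => ?_).not_zariskiIsGroupTopology
  · obtain ⟨k, h1, h2, -⟩ := exists_aut_free hM hK (A := A) (B := insert q A) (C := A ∪ F)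
      (Finset.subset_insert _ _) Finset.subset_union_left
    exact ⟨k, h1, fun h => hq (h2 q (Finset.mem_insert_self _ _) (Finset.mem_union_right _ h))⟩
  -- the image under `g` of the relation at `k t`
  have himage : ∀ k : M ≃[L] M, (∀ z ∈ Z, z ≠ c → g (k z) = k z) →
      RelMap R (fun i => if t i = c then g (k c) else k (t i)) := by
    intro k hk
    have h1 : RelMap R (fun i => g (k (t i))) := by rwa [aut_relMap g, aut_relMap k]
    convert h1 using 3 with i
    split_ifs with h
    · rw [h]
    · rw [hk _ (htZ i) h]
  have hfixed₁ : ∀ a, FreeFrom L a A → g a ∉ A → g a = a := by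
    intro a ha hga
    by_contra hne
    obtain ⟨k₁, hk₁c, hk₁⟩ := exists_aut_conjugates hM hK htr hfree A hq
    obtain ⟨h₁, hh₁A, hh₁⟩ := hk₁c.exists_aut hM htr ha
    -- The copy of `Z` at `a` has conjugates of `q` as its other points. Over `A` and `a` it is
    -- moved off `F`, so that these are fixed by `g`, and made free from `g a`.
    obtain ⟨k₂, h1, h2, h3⟩ := exists_aut_free hM hK (A := insert a A)
      (B := insert a A ∪ (Z.image k₁).image h₁) (C := insert a A ∪ insert (g a) F)
      Finset.subset_union_left Finset.subset_union_left
    have hconj : ∀ z ∈ Z, z ≠ c → ∃ h : M ≃[L] M, (∀ a ∈ A, h a = a) ∧ h q = h₁ (k₁ z) := by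
      intro z hz hzc
      obtain ⟨h, hA, hh⟩ := hk₁ z hz hzc
      refine ⟨h₁ * h, fun x hx => ?_, ?_⟩
      · show h₁ (h x) = x
        rw [hA x hx, hh₁A x hx]
      · show h₁ (h q) = _
        rw [hh]
    have hnotC : ∀ z ∈ Z, z ≠ c → k₂ (h₁ (k₁ z)) ∉ insert a A ∪ insert (g a) F := by
      intro z hz hzc hmem
      have := h2 _ (Finset.mem_union_right _ (Finset.mem_image_of_mem _
        (Finset.mem_image_of_mem _ hz))) hmem
      rcases Finset.mem_insert.1 this with h | h
      · rw [← hh₁] at h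
        exact hzc (k₁.injective (h₁.injective h))
      · obtain ⟨h', hA, hh⟩ := hconj z hz hzc
        rw [← hh] at h
        exact hq (h'.injective (hA _ h) ▸ h)
    have hrel := himage (k₂ * h₁ * k₁) (fun z hz hzc => by
      obtain ⟨h, hA, hh⟩ := hconj z hz hzc
      have h4 : (k₂ * h₁ * k₁ : M ≃[L] M) z = (k₂ * h : M ≃[L] M) q := by
        show k₂ (h₁ (k₁ z)) = k₂ (h q)
        rw [hh]
      rw [h4]
      refine hg (k₂ * h) (fun x hx => ?_) fun hF => ?_
      · show k₂ (h x) = x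
        rw [hA x hx, h1 x (Finset.mem_insert_of_mem hx)]
      · rw [← h4] at hF
        exact hnotC z hz hzc (Finset.mem_union_right _ (Finset.mem_insert_of_mem hF)))
    have hkc : (k₂ * h₁ * k₁ : M ≃[L] M) c = a := by
      show k₂ (h₁ (k₁ c)) = a
      rw [hh₁, h1 a (Finset.mem_insert_self _ _)]
    rw [hkc] at hrel
    have hgaC : g a ∈ insert a A ∪ insert (g a) F :=
      Finset.mem_union_right _ (Finset.mem_insert_self _ _)
    rcases h3 n R _ (fun i => by
        split_ifs with hi
        · exact Finset.mem_union_right _ hgaC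
        · exact Finset.mem_union_left _ (Finset.mem_image.2 ⟨h₁ (k₁ (t i)),
            Finset.mem_union_right _ (Finset.mem_image_of_mem _ (Finset.mem_image_of_mem _ (htZ i))),
            rfl⟩)) hrel with h | h
    · obtain ⟨i, hi⟩ := hZt c hc
      have := h i
      rw [if_pos hi] at this
      obtain ⟨b, hb, hbg⟩ := Finset.mem_image.1 this
      have hbA := h2 b hb (hbg ▸ hgaC)
      rw [h1 b hbA] at hbg
      rw [hbg] at hbA
      exact (Finset.mem_insert.1 hbA).elim hne hga
    · obtain ⟨i, hi⟩ := hi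
      have := h i
      rw [if_neg hi] at this
      exact hnotC _ (htZ i) hi this
  have hfixed₂ : ∀ b ∉ A, g b = b := by
    intro b hb
    -- The set `W` is chosen so that the other points of the copy are free from `A` and `g` maps
    -- them outside of `A`; then `hfixed₁` applies to them.
    obtain ⟨k, hkc, hkW, hk⟩ := exists_aut_glue hM hK htr hc
      (W := A ∪ A.image g.symm ∪ {b, g b}) (b := b) (by simp)
    refine eq_of_glue htZ hZt hc hi hkc hkW hk (by simp)
      (hkc ▸ himage k fun z hz hzc => hfixed₁ _ ⟨fun h => hzc (hkW z hz ?_), ?_⟩ fun h => ?_)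
    · simp [h]
    · intro m S x hx hS
      rcases hk m S x (fun i => by
          rcases hx i with hi | hi
          · rw [hi]
            exact Finset.mem_union_left _ (Finset.mem_image_of_mem _ hz)
          · simp [hi]) hS with h | h
      · refine Or.inl fun i => (hx i).resolve_right fun hi => hb ?_
        obtain ⟨z', hz', hzx⟩ := Finset.mem_image.1 (h i)
        have := hkW z' hz' (by rw [hzx]; simp [hi])
        rw [← hzx, this, hkc] at hi
        exact hi
      · refine Or.inr fun i => (hx i).resolve_left fun hi => hzc (hkW z hz ?_)
        exact hi ▸ h i
    · refine hzc (hkW z hz ?_)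
      have : k z ∈ A.image g.symm := Finset.mem_image.2 ⟨_, h, g.symm_apply_apply _⟩
      simp only [Finset.mem_union, this, or_true, true_or]
  intro b
  obtain ⟨k, hkc, hkW, hk⟩ := exists_aut_glue hM hK htr hc (W := A ∪ {b, g b}) (b := b) (by simp)
  exact eq_of_glue htZ hZt hc hi hkc hkW hk (by simp) (hkc ▸ himage k fun z hz hzc =>
    hfixed₂ _ fun h => hzc (hkW z hz (by simp [h])))

end Free

end ZariskiAut

namespace ZariskiAut

open FirstOrder FirstOrder.Language FirstOrder.Language.Structure

/-! ### Closed sets and charts -/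

section Closed

/-- A finite set that is closed under the functions of the language. -/
def FunClosed (L : FirstOrder.Language.{u, v}) {M : Type*} [L.Structure M] (X : Finset M) : Prop :=
  ∀ (n : ℕ) (F : L.Functions n) (x : Fin n → M), (∀ i, x i ∈ X) → funMap F x ∈ X

/-- A map that is an embedding of the closed set `C`. -/
structure IsChart (L : FirstOrder.Language.{u, v}) {M N : Type*} [L.Structure M] [L.Structure N]
    (C : Finset M) (e : M → N) : Prop where
  inj : Set.InjOn e C
  closed : FunClosed L C
  map_fun : ∀ (n : ℕ) (F : L.Functions n) (x : Fin n → M), (∀ i, x i ∈ C) →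
    e (funMap F x) = funMap F (fun i => e (x i))
  map_rel : ∀ (n : ℕ) (R : L.Relations n) (x : Fin n → M), (∀ i, x i ∈ C) →
    (RelMap R (fun i => e (x i)) ↔ RelMap R x)

variable {L : FirstOrder.Language.{u, v}} {M N : Type*} [L.Structure M] [L.Structure N]
  [DecidableEq N]

theorem IsChart.funClosed_image_iff {C : Finset M} {e : M → N} (he : IsChart L C e) {X : Finset M}
    (hX : X ⊆ C) : FunClosed L (X.image e) ↔ FunClosed L X := by
  constructor
  · intro h n F x hx
    have h1 := h n F (fun i => e (x i)) fun i => Finset.mem_image_of_mem _ (hx i)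
    rw [← he.map_fun n F x fun i => hX (hx i)] at h1
    obtain ⟨y, hy, hye⟩ := Finset.mem_image.1 h1
    have := he.inj (hX hy) (he.closed n F x fun i => hX (hx i)) hye
    exact this ▸ hy
  · intro h n F x hx
    choose y hy hyx using fun i => Finset.mem_image.1 (hx i)
    have : x = fun i => e (y i) := funext fun i => (hyx i).symm
    rw [this, ← he.map_fun n F y fun i => hX (hy i)]
    exact Finset.mem_image_of_mem _ (h n F y hy)

/-- The binary relation of a symbol. -/
def symbRel (ρ : L.Relations 2) {M : Type*} [L.Structure M] (x y : M) : Prop := RelMap ρ ![x, y]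

omit [DecidableEq N] in
theorem IsChart.symbRel_iff {C : Finset M} {e : M → N} (he : IsChart L C e) (ρ : L.Relations 2)
    {x y : M} (hx : x ∈ C) (hy : y ∈ C) : symbRel ρ (e x) (e y) ↔ symbRel ρ x y := by
  unfold symbRel
  rw [← he.map_rel 2 ρ ![x, y] (fun i => by fin_cases i <;> assumption)]
  have : (fun i => e (![x, y] i)) = ![e x, e y] := by
    ext i
    fin_cases i <;> rfl
  rw [this]

omit [DecidableEq N] in
theorem isChart_univ {D : Type*} [L.Structure D] [Fintype D] (f : D ↪[L] N) :
    IsChart L Finset.univ f :=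
  ⟨f.injective.injOn, fun _ _ _ _ => Finset.mem_univ _, fun _ F x _ => f.map_fun F x,
    fun _ R x _ => f.map_rel R x⟩

/-- Two elements have the same relations to the elements of `X`. -/
def SameRel (ρ : L.Relations 2) {M : Type*} [L.Structure M] (X : Finset M) (a b : M) : Prop :=
  ∀ x ∈ X, (symbRel ρ a x ↔ symbRel ρ b x) ∧ (symbRel ρ x a ↔ symbRel ρ x b)

theorem SameRel.mono {ρ : L.Relations 2} {X Y : Finset M} {a b : M} (h : SameRel ρ Y a b)
    (hXY : X ⊆ Y) : SameRel ρ X a b := fun x hx => h x (hXY hx)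

end Closed

/-! ### The two factors of a product -/

/-- What is needed from the first factor of a product: types over subsets can be realised by new
points, and any two points are separated by a relation to new points. -/
structure IsSeparatingClass {L : FirstOrder.Language.{u, v}} [L.IsRelational]
    (K : Set (Bundled.{w} L.Structure)) : Prop where
  finite : ∀ D ∈ K, Finite D
  hereditary : Hereditary K
  point : ∃ D ∈ K, Nonempty D
  amalgam : ∀ (C : Type w) [L.Structure C], (⟨C, inferInstance⟩ : Bundled L.Structure) ∈ K →
    ∀ (B : Set C) (q : C), q ∉ B → ∃ s : L.Structure (Option C),
      (⟨Option C, s⟩ : Bundled L.Structure) ∈ K ∧ IsRelEmb L (some : C → Option C) ∧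
      ∀ κ : C → Option C, κ q = none → (∀ b ∈ B, κ b = some b) →
        ∀ (n : ℕ) (R : L.Relations n) (x : Fin n → C), (∀ i, x i = q ∨ x i ∈ B) →
          (RelMap R (fun i => κ (x i)) ↔ RelMap R x)
  separate : ∀ (C : Type w) [L.Structure C], (⟨C, inferInstance⟩ : Bundled L.Structure) ∈ K →
    ∀ a a' : C, a ≠ a' → ∃ (D : Type w) (s : L.Structure D),
      (⟨D, s⟩ : Bundled L.Structure) ∈ K ∧ ∃ ι : C → D, IsRelEmb L ι ∧
        ∃ (n : ℕ) (R : L.Relations n) (t : Fin n → Option D),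
          (∀ i d, t i = some d → d ∉ Set.range ι) ∧
          ¬ (RelMap R (fun i => (t i).getD (ι a)) ↔ RelMap R (fun i => (t i).getD (ι a')))

/-- There are points which are related to `c` and cannot be distinguished from `c` by the other
members of a given finite closed set. -/
def HasCompanions {L : FirstOrder.Language.{u, v}} (ρ : L.Relations 2) (M : Type*)
    [L.Structure M] [DecidableEq M] : Prop :=
  ∀ C : Finset M, FunClosed L C → ∀ c ∈ C, ∃ z ∉ C, FunClosed L (insert z C) ∧ symbRel ρ z c ∧
    SameRel ρ (C.erase c) z c ∧
    ∀ X ⊆ C, c ∉ X → FunClosed L X → FunClosed L (insert c X) → FunClosed L (insert z X)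

/-- Each further companion is taken over the closed set that includes the earlier ones, which keeps
the union closed. -/
theorem HasCompanions.exists_finset {L : FirstOrder.Language.{u, v}} {ρ : L.Relations 2}
    {M : Type*} [L.Structure M] [DecidableEq M] (h : HasCompanions ρ M) {C : Finset M}
    (hC : FunClosed L C) {c : M} (hc : c ∈ C) (m : ℕ) :
    ∃ N : Finset M, N.card = m ∧ FunClosed L (C ∪ N) ∧ ∀ z ∈ N, z ∉ C ∧ symbRel ρ z c ∧
      SameRel ρ (C.erase c) z c ∧
      ∀ X ⊆ C, c ∉ X → FunClosed L X → FunClosed L (insert c X) → FunClosed L (insert z X) := by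
  induction m with
  | zero => exact ⟨∅, rfl, by rwa [Finset.union_empty], by simp⟩
  | succ m ih =>
    obtain ⟨N, hN, hCN, hz⟩ := ih
    obtain ⟨z, hzN, h1, h2, h3, h4⟩ := h (C ∪ N) hCN c (Finset.mem_union_left _ hc)
    refine ⟨insert z N, ?_, ?_, fun y hy => ?_⟩
    · rw [Finset.card_insert_of_notMem fun h => hzN (Finset.mem_union_right _ h), hN]
    · rwa [Finset.union_insert]
    · rcases Finset.mem_insert.1 hy with rfl | hy
      · exact ⟨fun h => hzN (Finset.mem_union_left _ h), h2,
          h3.mono (Finset.erase_subset_erase _ Finset.subset_union_left),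
          fun X hX => h4 X (hX.trans Finset.subset_union_left)⟩
      · exact hz y hy

/-! ### Products of classes -/

section Prod

variable {L₁ : FirstOrder.Language.{u, v}} [L₁.IsRelational] {L₂ : FirstOrder.Language.{u', v'}}
  [Countable (Σ l, L₂.Functions l)] {K₁ : Set (Bundled.{w} L₁.Structure)}
  {K₂ : Set (Bundled.{w} L₂.Structure)} {M : Type w} [L₁.Structure M] [L₂.Structure M]
  [Countable M]

omit [Countable (Σ l, L₂.Functions l)] [Countable M] in
theorem FunClosed.sum {X : Finset M} (hX : FunClosed L₂ X) : FunClosed (L₁.sum L₂) X := by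
  rintro n (F | F) x hx
  · exact isEmptyElim F
  · exact hX n F x hx

theorem mem_first_of_closed (hM : IsFraisseLimit (prodClass K₁ K₂) M) {C : Finset M}
    (hC : FunClosed L₂ C) :
    (⟨C, pullback L₁ (Subtype.val : C → M)⟩ : Bundled L₁.Structure) ∈ K₁ ∧
      ∃ S : L₂.Substructure M, (S : Set M) = C ∧
        (⟨S, inferInstance⟩ : Bundled L₂.Structure) ∈ K₂ := by
  let S : (L₁.sum L₂).Substructure M := ⟨C, fun {n} F x hx => FunClosed.sum hC n F x hx⟩
  have : Finite S := C.finite_toSet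
  have hS : (⟨S, inferInstance⟩ : Bundled (L₁.sum L₂).Structure) ∈ prodClass K₁ K₂ := by
    rw [← hM.age]
    exact age.fg_substructure Substructure.FG.of_finite
  refine ⟨?_, ⟨C, fun {n} F x hx => hC n F x hx⟩, rfl, ?_⟩
  · convert hS.1 using 1
    congr 1
    ext n F x
    · exact isEmptyElim F
    · exact Iff.rfl
  · exact hS.2

/-- Charts avoid identifying the reduct of `M` with `M₂`: finite closed pieces are compared one at a
time, for which the age suffices. Values outside of `C` are irrelevant. -/
theorem exists_chart (hM : IsFraisseLimit (prodClass K₁ K₂) M) {M₂ : Type w} [L₂.Structure M₂]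
    [Nonempty M₂] (hM₂ : L₂.age M₂ = K₂) {C : Finset M} (hC : FunClosed L₂ C) :
    ∃ e : M → M₂, IsChart L₂ C e := by
  classical
  obtain ⟨-, S, hSC, hS⟩ := mem_first_of_closed hM hC
  rw [← hM₂] at hS
  obtain ⟨-, ⟨e⟩⟩ := hS
  have hmem : ∀ {x}, x ∈ C → x ∈ S := fun {x} hx => by
    rw [← SetLike.mem_coe, hSC]
    exact hx
  let p : M₂ := Classical.arbitrary M₂
  have hval : ∀ {x} (hx : x ∈ S), (if h : x ∈ S then e ⟨x, h⟩ else p) = e ⟨x, hx⟩ :=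
    fun hx => dif_pos hx
  refine ⟨fun x => if h : x ∈ S then e ⟨x, h⟩ else p, fun x hx y hy hxy => ?_, hC,
    fun n F x hx => ?_, fun n R x hx => ?_⟩
  · dsimp only at hxy
    rw [hval (hmem hx), hval (hmem hy)] at hxy
    exact congrArg Subtype.val (e.injective hxy)
  · simp only [hval (hmem (hx _)), hval (hmem (hC n F x hx))]
    exact e.map_fun F (fun i => (⟨x i, hmem (hx i)⟩ : S))
  · simp only [hval (hmem (hx _))]
    exact e.map_rel R (fun i => (⟨x i, hmem (hx i)⟩ : S))

/-- A finitely generated substructure has its first reduct in `K₁`, hence is finite even though the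
second language may have functions. -/
theorem exists_closed_superset (hM : IsFraisseLimit (prodClass K₁ K₂) M)
    (hK₁ : ∀ D ∈ K₁, Finite D) (F : Finset M) : ∃ C : Finset M, F ⊆ C ∧ FunClosed L₂ C := by
  let S : (L₁.sum L₂).Substructure M := Substructure.closure _ (F : Set M)
  have hS : (⟨S, inferInstance⟩ : Bundled (L₁.sum L₂).Structure) ∈ prodClass K₁ K₂ := by
    rw [← hM.age]
    exact age.fg_substructure (Substructure.fg_closure F.finite_toSet)
  have hfin : (S : Set M).Finite := hK₁ _ hS.1
  refine ⟨hfin.toFinset, fun x hx => ?_, fun n f x hx => ?_⟩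
  · rw [Set.Finite.mem_toFinset]
    exact Substructure.subset_closure hx
  · rw [Set.Finite.mem_toFinset]
    exact S.fun_mem (Sum.inr f : (L₁.sum L₂).Functions n) x fun i => hfin.mem_toFinset.1 (hx i)

theorem prod_exists_aut (hM : IsFraisseLimit (prodClass K₁ K₂) M) {X : Finset M} {f : M → M}
    (hf : IsChart L₂ X f) (hrel : ∀ (n : ℕ) (R : L₁.Relations n) (x : Fin n → M),
      (∀ i, x i ∈ X) → (RelMap R (fun i => f (x i)) ↔ RelMap R x)) :
    ∃ h : M ≃[L₁.sum L₂] M, ∀ x ∈ X, h x = f x := by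
  let S : (L₁.sum L₂).Substructure M := ⟨X, fun {n} F x hx => FunClosed.sum hf.closed n F x hx⟩
  have : Finite S := X.finite_toSet
  let φ : S ↪[L₁.sum L₂] M :=
    { toFun := fun x => f x
      inj' := fun x y hxy => Subtype.ext (hf.inj x.2 y.2 hxy)
      map_fun' := by
        rintro n (F | F) x
        · exact isEmptyElim F
        · exact hf.map_fun n F (fun i => x i) fun i => (x i).2
      map_rel' := by
        rintro n (R | R) x
        · exact hrel n R (fun i => x i) fun i => (x i).2
        · exact hf.map_rel n R (fun i => x i) fun i => (x i).2 }
  obtain ⟨h, hh⟩ := hM.ultrahomogeneous S Substructure.FG.of_finite φ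
  exact ⟨h, fun x hx => (DFunLike.congr_fun hh ⟨x, hx⟩).symm⟩

variable [DecidableEq M]

/-- An extension of the reduct of `C` to the first language, together with a placement of it in
`M₂`, is realised in the product. -/
theorem prod_place (hM : IsFraisseLimit (prodClass K₁ K₂) M) {M₂ : Type w} [L₂.Structure M₂]
    [DecidableEq M₂] (hM₂ : L₂.age M₂ = K₂) {C : Finset M} {e : M → M₂} (he : IsChart L₂ C e)
    {D : Type w} [Fintype D] [L₁.Structure D]
    (hD : (⟨D, inferInstance⟩ : Bundled L₁.Structure) ∈ K₁) (ι : C → D)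
    (hι : ∀ (n : ℕ) (R : L₁.Relations n) (x : Fin n → C),
      RelMap R (fun i => ι (x i)) ↔ RelMap R (fun i => (x i : M)))
    {φ : D → M₂} (hφ : Function.Injective φ) (hφe : ∀ x, φ (ι x) = e x)
    (hcl : FunClosed L₂ (Finset.univ.image φ)) :
    ∃ j : D → M, IsRelEmb L₁ j ∧ (∀ x, j (ι x) = x) ∧
      (∀ X : Finset D, FunClosed L₂ (X.image j) ↔ FunClosed L₂ (X.image φ)) ∧
      ∀ (ρ : L₂.Relations 2) (x y : D), symbRel ρ (j x) (j y) ↔ symbRel ρ (φ x) (φ y) := by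
  have hfun : ∀ (n : ℕ) (F : L₂.Functions n) (x : Fin n → D), ∃ d, φ d = funMap F (φ ∘ x) := by
    intro n F x
    obtain ⟨d, -, hd⟩ := Finset.mem_image.1
      (hcl n F (φ ∘ x) fun i => Finset.mem_image_of_mem _ (Finset.mem_univ _))
    exact ⟨d, hd⟩
  choose fn hfn using hfun
  -- The second structure on `D` is pulled back along `φ`, with functions available because the
  -- image is closed. Membership in the product class imposes nothing beyond the two reducts.
  let s₂ : L₂.Structure D := ⟨fun {n} F x => fn n F x, fun R x => RelMap R (φ ∘ x)⟩
  let Φ : D ↪[L₂] M₂ := ⟨⟨φ, hφ⟩, fun F x => hfn _ F x, fun _ _ => Iff.rfl⟩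
  have hD₂ : (⟨D, s₂⟩ : Bundled L₂.Structure) ∈ K₂ := by
    rw [← hM₂]
    exact ⟨Structure.FG.of_finite, ⟨Φ⟩⟩
  have hDprod : (⟨D, inferInstance⟩ : Bundled (L₁.sum L₂).Structure) ∈ prodClass K₁ K₂ := ⟨hD, hD₂⟩
  rw [← hM.age] at hDprod
  have := hDprod.2
  let S : (L₁.sum L₂).Substructure M := ⟨C, fun {n} F x hx => FunClosed.sum he.closed n F x hx⟩
  have : Finite S := C.finite_toSet
  have hinj : Function.Injective ι := fun x y hxy =>
    Subtype.ext (he.inj x.2 y.2 (by rw [← hφe, ← hφe, hxy]))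
  let ψ : S ↪[L₁.sum L₂] D :=
    { toFun := fun x => ι x
      inj' := hinj
      map_fun' := by
        rintro n (F | F) x
        · exact isEmptyElim F
        · refine hφ ((hφe _).trans (Eq.trans ?_ (hfn n F _).symm))
          refine (he.map_fun n F (fun i => x i) fun i => (x i).2).trans ?_
          exact congrArg _ (funext fun i => (hφe (x i)).symm)
      map_rel' := by
        rintro n (R | R) x
        · exact hι n R x
        · refine Iff.trans ?_ (he.map_rel n R (fun i => x i) fun i => (x i).2)
          exact iff_of_eq (congrArg (RelMap R) (funext fun i => hφe (x i))) }
  obtain ⟨j, hj⟩ := hM.ultrahomogeneous.extend_embedding (Structure.FG.of_finite (M := S))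
    S.subtype ψ (T := D)
  let j₂ : D ↪[L₂] M := ⟨j.toEmbedding,
    fun {n} F x => j.map_fun' (Sum.inr F : (L₁.sum L₂).Functions n) x,
    fun {n} R x => j.map_rel' (Sum.inr R : (L₁.sum L₂).Relations n) x⟩
  refine ⟨j, ⟨j.injective, fun n R x => j.map_rel (Sum.inl R : (L₁.sum L₂).Relations n) x⟩,
    fun x => (DFunLike.congr_fun hj x).symm, fun X => ?_, fun ρ x y => ?_⟩
  · exact ((isChart_univ j₂).funClosed_image_iff (Finset.subset_univ X)).trans
      ((isChart_univ Φ).funClosed_image_iff (Finset.subset_univ X)).symm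
  · exact ((isChart_univ j₂).symbRel_iff ρ (Finset.mem_univ x) (Finset.mem_univ y)).trans
      ((isChart_univ Φ).symbRel_iff ρ (Finset.mem_univ x) (Finset.mem_univ y)).symm

omit [L₁.IsRelational] [DecidableEq M] [Countable (Σ l, L₂.Functions l)] [Countable M] in
theorem prod_aut_relMap (g : M ≃[L₁.sum L₂] M) {n : ℕ} (R : L₁.Relations n) (x : Fin n → M) :
    RelMap R (fun i => g (x i)) ↔ RelMap R x := g.map_rel (Sum.inl R : (L₁.sum L₂).Relations n) x

omit [L₁.IsRelational] [DecidableEq M] [Countable (Σ l, L₂.Functions l)] [Countable M] in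
theorem prod_aut_symbRel (g : M ≃[L₁.sum L₂] M) (ρ : L₂.Relations 2) (x y : M) :
    symbRel ρ (g x) (g y) ↔ symbRel ρ x y := by
  unfold symbRel
  have h := g.map_rel (Sum.inr ρ : (L₁.sum L₂).Relations 2) ![x, y]
  have h2 : g ∘ ![x, y] = ![g x, g y] := by
    ext i
    fin_cases i <;> rfl
  rw [h2] at h
  exact h

omit [L₁.IsRelational] [Countable (Σ l, L₂.Functions l)] [Countable M] in
theorem FunClosed.image_aut {X : Finset M} (hX : FunClosed L₂ X) (g : M ≃[L₁.sum L₂] M) :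
    FunClosed L₂ (X.image g) := by
  intro n F x hx
  choose y hy hyx using fun i => Finset.mem_image.1 (hx i)
  have h1 : x = g ∘ y := funext fun i => (hyx i).symm
  have h2 : g (funMap F y) = funMap F (g ∘ y) :=
    g.map_fun (Sum.inr F : (L₁.sum L₂).Functions n) y
  rw [h1, ← h2]
  exact Finset.mem_image_of_mem _ (hX n F y hy)

end Prod

end ZariskiAut

namespace ZariskiAut

open FirstOrder FirstOrder.Language FirstOrder.Language.Structure

/-! ### The criterion for products -/

section ProdCriterion

/-- Bijections between closed sets that preserve the symbol `ρ` preserve the whole structure. -/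
def DeterminesStructure {L : FirstOrder.Language.{u, v}} (ρ : L.Relations 2) (M : Type*)
    [L.Structure M] [DecidableEq M] : Prop :=
  ∀ (X : Finset M) (f : M → M), FunClosed L X → FunClosed L (X.image f) → Set.InjOn f X →
    (∀ x ∈ X, ∀ y ∈ X, (symbRel ρ (f x) (f y) ↔ symbRel ρ x y)) → IsChart L X f

theorem image_filter_mem {M N : Type*} [DecidableEq M] [DecidableEq N] {A C : Finset M}
    (hAC : A ⊆ C) (g : M → N) :
    (Finset.univ.filter fun x : C => (x : M) ∈ A).image (fun x : C => g x) = A.image g := by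
  ext y
  simp only [Finset.mem_image, Finset.mem_filter, Finset.mem_univ, true_and, Subtype.exists]
  constructor
  · rintro ⟨a, _, ha, rfl⟩
    exact ⟨a, ha, rfl⟩
  · rintro ⟨a, ha, rfl⟩
    exact ⟨a, hAC ha, ha, rfl⟩

theorem image_filter_val {M : Type*} [DecidableEq M] {A C : Finset M} (hAC : A ⊆ C) :
    (Finset.univ.filter fun x : C => (x : M) ∈ A).image (fun x : C => (x : M)) = A := by
  have := image_filter_mem hAC (id : M → M)
  rwa [Finset.image_id] at this

variable {L₁ : FirstOrder.Language.{u, v}} [L₁.IsRelational] {L₂ : FirstOrder.Language.{u', v'}}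
  [Countable (Σ l, L₂.Functions l)] {K₁ : Set (Bundled.{w} L₁.Structure)}
  {K₂ : Set (Bundled.{w} L₂.Structure)} {M : Type w} [L₁.Structure M] [L₂.Structure M]
  [Countable M] [DecidableEq M] {M₂ : Type w} [L₂.Structure M₂] [DecidableEq M₂]
  {ρ : L₂.Relations 2}

omit [DecidableEq M] [DecidableEq M₂] in
theorem prod_nonempty (hM : IsFraisseLimit (prodClass K₁ K₂) M) (hK₁ : IsSeparatingClass K₁)
    (hM₂ : L₂.age M₂ = K₂) {p : M₂} (hp : FunClosed L₂ {p}) : Nonempty M := by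
  obtain ⟨D, hD, ⟨d⟩⟩ := hK₁.point
  let T : L₂.Substructure M₂ := ⟨({p} : Finset M₂), fun {n} F x hx => hp n F x hx⟩
  have hpT : p ∈ T := Finset.mem_coe.2 (Finset.mem_singleton_self p)
  have hT : ∀ x : T, (x : M₂) = p := fun x => Finset.mem_singleton.1 (Finset.mem_coe.1 x.2)
  have : Finite T := ({p} : Finset M₂).finite_toSet
  have hT₁ := mem_pullback (X := T) hK₁.hereditary hD (f := fun _ => d) fun x y _ =>
    Subtype.ext ((hT x).trans (hT y).symm)
  have hT₂ : (⟨T, inferInstance⟩ : Bundled L₂.Structure) ∈ K₂ := by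
    rw [← hM₂]
    exact age.fg_substructure Substructure.FG.of_finite
  let _ : L₁.Structure T := pullback L₁ fun _ => d
  have hprod : (⟨T, inferInstance⟩ : Bundled (L₁.sum L₂).Structure) ∈ prodClass K₁ K₂ :=
    ⟨hT₁, hT₂⟩
  rw [← hM.age] at hprod
  obtain ⟨-, ⟨j⟩⟩ := hprod
  exact ⟨j ⟨p, hpT⟩⟩

/-- A conjugate of `q` over `A` can be placed at any position in the second structure which has
the same type over `A` as `q`. -/
theorem prod_exists_conjugate (hM : IsFraisseLimit (prodClass K₁ K₂) M)
    (hK₁ : IsSeparatingClass K₁) (hM₂ : L₂.age M₂ = K₂) (hρ : DeterminesStructure ρ M)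
    {C : Finset M} {e : M → M₂} (he : IsChart L₂ C e) {A : Finset M} (hAC : A ⊆ C)
    {q : M} (hqC : q ∈ C) (hqA : q ∉ A) (hqA' : FunClosed L₂ (insert q A)) {z : M₂}
    (hz : z ∉ C.image e) (hzC : FunClosed L₂ (insert z (C.image e)))
    (hzA : FunClosed L₂ (insert z (A.image e))) (hzz : symbRel ρ z z ↔ symbRel ρ q q)
    (hsame : ∀ a ∈ A, (symbRel ρ z (e a) ↔ symbRel ρ q a) ∧
      (symbRel ρ (e a) z ↔ symbRel ρ a q)) :
    ∃ h : M ≃[L₁.sum L₂] M, (∀ a ∈ A, h a = a) ∧ h q ∉ C ∧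
      ∀ x ∈ C, (symbRel ρ (h q) x ↔ symbRel ρ z (e x)) ∧
        (symbRel ρ x (h q) ↔ symbRel ρ (e x) z) := by
  let s₀ := pullback L₁ (Subtype.val : C → M)
  obtain ⟨s, hD, hsome, hκ⟩ := hK₁.amalgam C (mem_first_of_closed hM he.closed).1
    {x | (x : M) ∈ A} ⟨q, hqC⟩ hqA
  -- The new point `none` has the first-factor type of `q` over `A` and the position `z` in the
  -- second factor.
  let φ : Option C → M₂ := fun x => x.elim z fun c => e c
  have hφ : Function.Injective φ := by
    rintro (_ | x) (_ | y) hxy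
    · rfl
    · exact absurd ((show e y = z from hxy.symm) ▸ Finset.mem_image_of_mem e y.2) hz
    · exact absurd ((show e x = z from hxy) ▸ Finset.mem_image_of_mem e x.2) hz
    · exact congrArg some (Subtype.ext (he.inj x.2 y.2 hxy))
  have hφimg : Finset.univ.image φ = insert z (C.image e) := by
    ext y
    simp only [Finset.mem_image, Finset.mem_univ, true_and, Finset.mem_insert]
    constructor
    · rintro ⟨_ | x, rfl⟩
      · exact Or.inl rfl
      · exact Or.inr ⟨x, x.2, rfl⟩
    · rintro (rfl | ⟨x, hx, rfl⟩)
      · exact ⟨none, rfl⟩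
      · exact ⟨some ⟨x, hx⟩, rfl⟩
  obtain ⟨j, hj, hjι, hjcl, hjρ⟩ := prod_place hM hM₂ he hD some (fun n R x => hsome.rel n R x)
    hφ (fun _ => rfl) (hφimg ▸ hzC)
  have hjn : j none ∉ C := fun h => by
    have := hj.inj (hjι ⟨_, h⟩)
    simp at this
  let f : M → M := fun x => if x = q then j none else x
  have hfA : ∀ a ∈ A, f a = a := fun a ha => if_neg (ne_of_mem_of_not_mem ha hqA)
  have hfq : f q = j none := if_pos rfl
  have himg : (insert q A).image f = insert (j none) A := by
    rw [Finset.image_insert, hfq]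
    congr 1
    ext x
    simp only [Finset.mem_image]
    exact ⟨fun ⟨a, ha, hax⟩ => hax ▸ (hfA a ha).symm ▸ ha, fun hx => ⟨x, hx, hfA x hx⟩⟩
  have hcl : FunClosed L₂ ((insert q A).image f) := by
    have h1 := hjcl (insert none ((Finset.univ.filter fun x : C => (x : M) ∈ A).image some))
    rw [Finset.image_insert, Finset.image_insert, Finset.image_image, Finset.image_image] at h1
    have h2 : (Finset.univ.filter fun x : C => (x : M) ∈ A).image (φ ∘ some) = A.image e :=
      image_filter_mem hAC e
    have h3 : (Finset.univ.filter fun x : C => (x : M) ∈ A).image (j ∘ some) = A := by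
      have : (j ∘ some : C → M) = fun x : C => (x : M) := funext hjι
      rw [this]
      exact image_filter_val hAC
    rw [h2, h3] at h1
    rw [himg]
    exact h1.2 hzA
  have hinj : Set.InjOn f (insert q A : Finset M) := by
    intro x hx y hy hxy
    rw [Finset.mem_coe, Finset.mem_insert] at hx hy
    rcases hx with rfl | hx <;> rcases hy with rfl | hy
    · rfl
    · rw [hfq, hfA y hy] at hxy
      exact absurd (hAC (hxy ▸ hy)) hjn
    · rw [hfq, hfA x hx] at hxy
      exact absurd (hAC (hxy ▸ hx)) hjn
    · rwa [hfA x hx, hfA y hy] at hxy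
  have hjx : ∀ x ∈ C, (symbRel ρ (j none) x ↔ symbRel ρ z (e x)) ∧
      (symbRel ρ x (j none) ↔ symbRel ρ (e x) z) := fun x hx => by
    have h1 := hjρ ρ none (some ⟨x, hx⟩)
    have h2 := hjρ ρ (some ⟨x, hx⟩) none
    rw [hjι] at h1 h2
    exact ⟨h1, h2⟩
  have hchart : IsChart L₂ (insert q A) f := by
    refine hρ _ f hqA' hcl hinj fun x hx y hy => ?_
    rw [Finset.mem_insert] at hx hy
    rcases hx with rfl | hx <;> rcases hy with rfl | hy
    · rw [hfq, hjρ]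
      exact hzz
    · rw [hfq, hfA y hy]
      exact (hjx y (hAC hy)).1.trans (hsame y hy).1
    · rw [hfq, hfA x hx]
      exact (hjx x (hAC hx)).2.trans (hsame x hx).2
    · rw [hfA x hx, hfA y hy]
  obtain ⟨h, hh⟩ := prod_exists_aut hM hchart fun n R x hx => by
    have hxC : ∀ i, x i ∈ C := fun i =>
      (Finset.mem_insert.1 (hx i)).elim (fun h => h ▸ hqC) fun h => hAC h
    -- The amalgamation clause says that replacing `q` by the new point keeps all first-factor
    -- relations over `A`.
    have h1 := hκ (fun c => if (c : M) = q then none else some c) (if_pos rfl)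
      (fun b hb => if_neg (ne_of_mem_of_not_mem (show (b : M) ∈ A from hb) hqA)) n R (fun i => ⟨x i, hxC i⟩)
      fun i => (Finset.mem_insert.1 (hx i)).imp (fun h => Subtype.ext h) id
    rw [← hj.rel] at h1
    refine Iff.trans (iff_of_eq (congrArg _ (funext fun i => ?_))) h1
    show (if x i = q then j none else x i) = j (if x i = q then none else some ⟨x i, hxC i⟩)
    split_ifs
    · rfl
    · rw [hjι]
  have hhq : h q = j none := by rw [hh q (Finset.mem_insert_self _ _), hfq]
  exact ⟨h, fun a ha => by rw [hh a (Finset.mem_insert_of_mem ha), hfA a ha], hhq ▸ hjn, hhq ▸ hjx⟩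

/-- Points which are separated by the first factor are separated by points next to `q`. -/
theorem prod_eq_of_fixes (hM : IsFraisseLimit (prodClass K₁ K₂) M)
    (hK₁ : IsSeparatingClass K₁) (hM₂ : L₂.age M₂ = K₂) (hcomp : HasCompanions ρ M₂) [Nonempty M₂]
    {A : Finset M} (hA : FunClosed L₂ A) {q : M} (hqA : q ∉ A) (hqA' : FunClosed L₂ (insert q A))
    {g : M ≃[L₁.sum L₂] M} (hg : ∀ c ∉ A, c ≠ q → FunClosed L₂ (insert c A) → symbRel ρ c q →
      SameRel ρ A c q → g c = c) (a : M) : g a = a := by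
  by_contra hne
  obtain ⟨C, hFC, hC⟩ := exists_closed_superset hM hK₁.finite (insert a (insert (g a) (insert q A)))
  have haC : a ∈ C := hFC (by simp)
  have hgaC : g a ∈ C := hFC (by simp)
  have hqC : q ∈ C := hFC (by simp)
  have hAC : A ⊆ C := fun x hx => hFC (by simp [hx])
  obtain ⟨e, he⟩ := exists_chart hM hM₂ hC
  let s₀ := pullback L₁ (Subtype.val : C → M)
  obtain ⟨D, s, hD, ι, hι, n, R, t, ht, hsep⟩ := hK₁.separate C (mem_first_of_closed hM hC).1
    ⟨a, haC⟩ ⟨g a, hgaC⟩ fun h => hne (congrArg Subtype.val h).symm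
  classical
  have := hK₁.finite _ hD
  let _ : Fintype D := Fintype.ofFinite D
  have hCe : FunClosed L₂ (C.image e) := (he.funClosed_image_iff subset_rfl).2 hC
  -- One companion of `q` in `M₂` for each point of `D` outside of `C`: the separating points are to
  -- be placed where `hg` makes `g` fix them.
  obtain ⟨N, hN, hCN, hNz⟩ := hcomp.exists_finset hCe (Finset.mem_image_of_mem e hqC)
    (Finset.univ.filter fun d : D => d ∉ Set.range ι).card
  let E := Finset.equivOfCardEq hN.symm
  have hmem : ∀ {d}, d ∉ Set.range ι → d ∈ Finset.univ.filter fun d : D => d ∉ Set.range ι :=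
    fun hd => Finset.mem_filter.2 ⟨Finset.mem_univ _, hd⟩
  let φ : D → M₂ := fun d => if h : d ∈ Set.range ι then e h.choose else E ⟨d, hmem h⟩
  have hφι : ∀ x, φ (ι x) = e x := by
    intro x
    have hx : ι x ∈ Set.range ι := ⟨x, rfl⟩
    have h1 : φ (ι x) = e hx.choose := dif_pos hx
    rw [h1, hι.inj hx.choose_spec]
  have hφN : ∀ d (hd : d ∉ Set.range ι), φ d = E ⟨d, hmem hd⟩ := fun d hd => dif_neg hd
  have hφN' : ∀ d, d ∉ Set.range ι → φ d ∈ N := fun d hd => hφN d hd ▸ (E _).2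
  have hφ : Function.Injective φ := by
    intro d d' hdd
    by_cases h : d ∈ Set.range ι <;> by_cases h' : d' ∈ Set.range ι
    · obtain ⟨x, rfl⟩ := h
      obtain ⟨y, rfl⟩ := h'
      rw [hφι, hφι] at hdd
      rw [Subtype.ext (he.inj x.2 y.2 hdd)]
    · obtain ⟨x, rfl⟩ := h
      rw [hφι] at hdd
      exact absurd (Finset.mem_image_of_mem e x.2) (hdd ▸ (hNz _ (hφN' d' h')).1)
    · obtain ⟨y, rfl⟩ := h'
      rw [hφι] at hdd
      exact absurd (Finset.mem_image_of_mem e y.2) (hdd ▸ (hNz _ (hφN' d h)).1)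
    · rw [hφN d h, hφN d' h'] at hdd
      exact congrArg Subtype.val (E.injective (Subtype.ext hdd))
  have hφimg : Finset.univ.image φ = C.image e ∪ N := by
    ext y
    simp only [Finset.mem_image, Finset.mem_univ, true_and, Finset.mem_union]
    constructor
    · rintro ⟨d, rfl⟩
      by_cases h : d ∈ Set.range ι
      · obtain ⟨x, rfl⟩ := h
        exact Or.inl ⟨x, x.2, (hφι x).symm⟩
      · exact Or.inr (hφN' d h)
    · rintro (⟨x, hx, rfl⟩ | hy)
      · exact ⟨_, hφι ⟨x, hx⟩⟩
      · have hd := (Finset.mem_filter.1 (E.symm ⟨y, hy⟩).2).2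
        refine ⟨E.symm ⟨y, hy⟩, ?_⟩
        rw [hφN _ hd]
        simp
  obtain ⟨j, hj, hjι, hjcl, hjρ⟩ := prod_place hM hM₂ he hD ι (fun n R x => hι.rel n R x)
    hφ hφι (hφimg ▸ hCN)
  have hfix : ∀ d, d ∉ Set.range ι → g (j d) = j d := by
    intro d hd
    obtain ⟨hdC, hdq, hdsame, hdcl⟩ := hNz _ (hφN' d hd)
    have hjd : j d ∉ C := fun h => hd ⟨_, hj.inj (hjι ⟨_, h⟩)⟩
    have hrel : ∀ x (hx : x ∈ C), (symbRel ρ (j d) x ↔ symbRel ρ (φ d) (e x)) ∧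
        (symbRel ρ x (j d) ↔ symbRel ρ (e x) (φ d)) := fun x hx => by
      have h1 := hjρ ρ d (ι ⟨x, hx⟩)
      have h2 := hjρ ρ (ι ⟨x, hx⟩) d
      rw [hjι, hφι] at h1 h2
      exact ⟨h1, h2⟩
    refine hg _ (fun h => hjd (hAC h)) (fun h => hjd (h ▸ hqC)) ?_ ((hrel q hqC).1.2 hdq) ?_
    · have h1 := hjcl (insert d ((Finset.univ.filter fun x : C => (x : M) ∈ A).image ι))
      rw [Finset.image_insert, Finset.image_insert, Finset.image_image, Finset.image_image] at h1
      have h2 : (Finset.univ.filter fun x : C => (x : M) ∈ A).image (φ ∘ ι) = A.image e := by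
        have : φ ∘ ι = fun x : C => e x := funext hφι
        rw [this]
        exact image_filter_mem hAC e
      have h3 : (Finset.univ.filter fun x : C => (x : M) ∈ A).image (j ∘ ι) = A := by
        have : (j ∘ ι : C → M) = fun x : C => (x : M) := funext hjι
        rw [this]
        exact image_filter_val hAC
      rw [h2, h3] at h1
      refine h1.2 (hdcl _ (Finset.image_subset_image hAC) (fun h => ?_)
        ((he.funClosed_image_iff hAC).2 hA) ?_)
      · obtain ⟨x, hx, hxq⟩ := Finset.mem_image.1 h
        exact hqA (he.inj (hAC hx) hqC hxq ▸ hx)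
      · rw [← Finset.image_insert]
        exact (he.funClosed_image_iff (Finset.insert_subset hqC hAC)).2 hqA'
    · intro x hx
      have hxC := hAC hx
      have h1 := hdsame (e x) (Finset.mem_erase.2 ⟨fun h => hqA (he.inj hxC hqC h ▸ hx),
        Finset.mem_image_of_mem e hxC⟩)
      exact ⟨(hrel x hxC).1.trans (h1.1.trans (he.symbRel_iff ρ hqC hxC)),
        (hrel x hxC).2.trans (h1.2.trans (he.symbRel_iff ρ hxC hqC))⟩
  refine hsep ?_
  -- As `g` fixes the separating points and maps `a` to `g a`, the separating relation cannot
  -- change.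
  rw [← hj.rel, ← prod_aut_relMap (L₂ := L₂) g, ← hj.rel n R fun i => (t i).getD (ι ⟨g a, hgaC⟩)]
  refine iff_of_eq (congrArg _ (funext fun i => ?_))
  cases hti : t i with
  | none => simp [hjι]
  | some d => simp [hfix d (ht i d hti)]

/-- The criterion for products: it remains to show that an automorphism which fixes almost all
conjugates of a point `q` over `A` also fixes the points next to some `q₀`. -/
theorem not_zariski_prod (hM : IsFraisseLimit (prodClass K₁ K₂) M)
    (hK₁ : IsSeparatingClass K₁) (hM₂ : L₂.age M₂ = K₂) (hρ : DeterminesStructure ρ M)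
    (hcomp : HasCompanions ρ M₂) (hloop : ∀ x y : M₂, symbRel ρ x x ↔ symbRel ρ y y)
    (hpoint : ∃ p : M₂, FunClosed L₂ {p}) (hempty : FunClosed L₂ (∅ : Finset M))
    (hstep : ∀ A : Finset M, FunClosed L₂ A → ∀ u ∉ A, ∃ A₁, FunClosed L₂ A₁ ∧ A ⊆ A₁ ∧ u ∉ A₁ ∧
      FunClosed L₂ (insert u A₁))
    (hfix : ∀ A : Finset M, FunClosed L₂ A → ∀ q ∉ A, FunClosed L₂ (insert q A) →
      ∀ (F : Finset M) (g : M ≃[L₁.sum L₂] M),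
      (∀ h : M ≃[L₁.sum L₂] M, (∀ a ∈ A, h a = a) → h q ∉ F → g (h q) = h q) →
      ∃ q₀ ∉ A, FunClosed L₂ (insert q₀ A) ∧ ∀ c ∉ A, c ≠ q₀ → FunClosed L₂ (insert c A) →
        symbRel ρ c q₀ → SameRel ρ A c q₀ → g c = c) :
    ¬ ZariskiIsGroupTopology (M ≃[L₁.sum L₂] M) := by
  obtain ⟨p, hp⟩ := hpoint
  have : Nonempty M₂ := ⟨p⟩
  have : Nonempty M := prod_nonempty hM hK₁ hM₂ hp
  have hloopM : ∀ x : M, ∀ z : M₂, symbRel ρ z z ↔ symbRel ρ x x := by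
    intro x z
    obtain ⟨C, hFC, hC⟩ := exists_closed_superset hM hK₁.finite {x}
    obtain ⟨e, he⟩ := exists_chart hM hM₂ hC
    have hx := hFC (Finset.mem_singleton_self x)
    exact (hloop z (e x)).trans (he.symbRel_iff ρ hx hx)
  refine MovesTypes.not_zariskiIsGroupTopology (𝒞 := {X : Finset M | FunClosed L₂ X})
    ⟨fun A hA g => FunClosed.image_aut hA g, hempty, hstep, fun A hA q hqA hqA' F => ?_,
      fun A hA q hqA hqA' F g hg => ?_⟩
  · obtain ⟨C, hFC, hC⟩ := exists_closed_superset hM hK₁.finite (F ∪ insert q A)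
    have hqC : q ∈ C := hFC (by simp)
    have hAC : A ⊆ C := fun x hx => hFC (by simp [hx])
    obtain ⟨e, he⟩ := exists_chart hM hM₂ hC
    -- A companion of `q` is a new position with the type of `q` over `A`, and thus the position of
    -- a conjugate outside of `F`.
    obtain ⟨z, h1, h2, -, h3, h4⟩ := hcomp _ ((he.funClosed_image_iff subset_rfl).2 hC) (e q)
      (Finset.mem_image_of_mem e hqC)
    have hne : ∀ x ∈ A, e x ≠ e q := fun x hx h => hqA (he.inj (hAC hx) hqC h ▸ hx)
    obtain ⟨h, hA', hqC', -⟩ := prod_exists_conjugate hM hK₁ hM₂ hρ he hAC hqC hqA hqA' h1 h2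
      (h4 _ (Finset.image_subset_image hAC) (fun h => by
          obtain ⟨x, hx, hxq⟩ := Finset.mem_image.1 h
          exact hne x hx hxq)
        ((he.funClosed_image_iff hAC).2 hA) (by
          rw [← Finset.image_insert]
          exact (he.funClosed_image_iff (Finset.insert_subset hqC hAC)).2 hqA'))
      (hloopM q z) fun a ha => by
        have h5 := h3 (e a) (Finset.mem_erase.2 ⟨hne a ha, Finset.mem_image_of_mem e (hAC ha)⟩)
        exact ⟨h5.1.trans (he.symbRel_iff ρ hqC (hAC ha)),
          h5.2.trans (he.symbRel_iff ρ (hAC ha) hqC)⟩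
    exact ⟨h, hA', fun h => hqC' (hFC (Finset.mem_union_left _ h))⟩
  · by_contra! hcon
    obtain ⟨q₀, hq₀, hq₀', hq₀fix⟩ := hfix A hA q hqA hqA' F g fun h h1 h2 => hcon h h1 h2
    exact hg (FirstOrder.Language.Equiv.ext fun a =>
      prod_eq_of_fixes hM hK₁ hM₂ hcomp hA hq₀ hq₀' hq₀fix a)

end ProdCriterion

end ZariskiAut

namespace ZariskiAut

open FirstOrder FirstOrder.Language FirstOrder.Language.Structure

/-! ### Separating classes -/

section Separating

variable {L : FirstOrder.Language.{u, v}} [L.IsRelational] {K : Set (Bundled.{w} L.Structure)}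
  {M : Type w} [L.Structure M] [Countable M] [DecidableEq M]

/-- The strong amalgam of `B` and `C` over `A` is realised with `C` in place. -/
theorem exists_aut_disjoint (hM : IsFraisseLimit K M) (hK : StrongAmalgamation K)
    {A B C : Finset M} (hAB : A ⊆ B) (hAC : A ⊆ C) :
    ∃ k : M ≃[L] M, (∀ a ∈ A, k a = a) ∧ ∀ b ∈ B, k b ∈ C → b ∈ A := by
  let _ := pullback L (Subtype.val : A → M)
  let _ := pullback L (Subtype.val : B → M)
  let _ := pullback L (Subtype.val : C → M)
  have hf : IsRelEmb L (fun a : A => (⟨a, hAB a.2⟩ : B)) :=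
    ⟨fun a b h => Subtype.ext (congrArg (fun x : B => (x : M)) h), fun _ _ _ => Iff.rfl⟩
  have hg : IsRelEmb L (fun a : A => (⟨a, hAC a.2⟩ : C)) :=
    ⟨fun a b h => Subtype.ext (congrArg (fun x : C => (x : M)) h), fun _ _ _ => Iff.rfl⟩
  obtain ⟨D, i, j, hD, hcomm, hinter⟩ := hK ⟨A, inferInstance⟩ ⟨B, inferInstance⟩
    ⟨C, inferInstance⟩ hf.toEmbedding hg.toEmbedding (mem_class_of_finset hM A)
    (mem_class_of_finset hM B) (mem_class_of_finset hM C)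
  obtain ⟨J, hJ, hJC⟩ := exists_isRelEmb_extending hM C (D := D) hD j j.injective
    fun n R x => j.map_rel R x
  obtain ⟨k, hk⟩ := exists_aut_eqOn hM B (fun x => if h : x ∈ B then J (i ⟨x, h⟩) else x) (by
      intro x hx y hy hxy
      rw [Finset.mem_coe] at hx hy
      simp only [dif_pos hx, dif_pos hy] at hxy
      exact congrArg Subtype.val (i.injective (hJ.inj hxy))) (by
      intro n R x hx
      simp only [dif_pos (hx _)]
      rw [hJ.rel n R (fun l => i ⟨x l, hx l⟩)]
      exact i.map_rel R (fun l => (⟨x l, hx l⟩ : B)))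
  have hkB : ∀ b (hb : b ∈ B), k b = J (i ⟨b, hb⟩) := fun b hb => by rw [hk b hb, dif_pos hb]
  have hcomm' : ∀ a (ha : a ∈ A), i ⟨a, hAB ha⟩ = j ⟨a, hAC ha⟩ := fun a ha =>
    DFunLike.congr_fun hcomm (⟨a, ha⟩ : A)
  refine ⟨k, fun a ha => by rw [hkB a (hAB ha), hcomm' a ha, hJC], fun b hb hbC => ?_⟩
  rw [hkB b hb] at hbC
  have h1 : i ⟨b, hb⟩ = j ⟨_, hbC⟩ := hJ.inj (hJC ⟨_, hbC⟩).symm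
  have h2 : i ⟨b, hb⟩ ∈ Set.range i ∩ Set.range j := ⟨⟨_, rfl⟩, ⟨_, h1.symm⟩⟩
  rw [hinter] at h2
  obtain ⟨a, ha⟩ := h2
  have : (a : M) = b := congrArg Subtype.val (i.injective ha)
  exact this ▸ a.2

/-- Distinct points `a` and `a'` of a finite set `C` are separated by a relation to points outside
of `C`. -/
def SeparatesPoints (L : FirstOrder.Language.{u, v}) (M : Type w) [L.Structure M]
    [DecidableEq M] : Prop :=
  ∀ (C : Finset M), ∀ a ∈ C, ∀ a' ∈ C, a ≠ a' → ∃ (n : ℕ) (R : L.Relations n) (x : Fin n → M),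
    (∀ i, x i = a ∨ x i ∉ C) ∧ ¬ (RelMap R x ↔ RelMap R (fun i => if x i = a then a' else x i))

/-- In a minimal relation glued to `C` at `a`, the point `a` cannot be replaced by `a'`, by
`eq_of_glue`. -/
theorem separatesPoints_of_free (hM : IsFraisseLimit K M) (hK : IsFreeAmalgamationClass K)
    (htr : IsTransitive L M) (hnt : ¬ IsTrivial L M) : SeparatesPoints L M := by
  intro C a ha a' ha' hne
  obtain ⟨Z, c, n, R, t, hc, hRt, htZ, hZt, hi, -⟩ := exists_minimal_relation htr hnt
  obtain ⟨k, hkc, hkW, hk⟩ := exists_aut_glue hM hK htr hc ha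
  refine ⟨n, R, fun i => k (t i), fun i => ?_, fun h => ?_⟩
  · by_cases h : k (t i) ∈ C
    · exact Or.inl (by dsimp only; rw [hkW _ (htZ i) h, hkc])
    · exact Or.inr h
  · refine hne (eq_of_glue (R := R) htZ hZt hc hi hkc hkW hk ha' ?_).symm
    have h1 := h.1 (by rwa [aut_relMap])
    convert h1 using 3 with i
    rw [← hkc, k.injective.eq_iff]

omit [L.IsRelational] [Countable M] in
/-- If one point can be replaced by another one in all relations, then all transpositions, and
hence all permutations, preserve the relations. -/
theorem relMap_perm_of_replace (hinf : ∀ F : Finset M, ∃ b, b ∉ F)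
    (hrep : ∀ (b b' : M) (n : ℕ) (R : L.Relations n) (x : Fin n → M), (∀ i, x i ≠ b') →
      (RelMap R x ↔ RelMap R (fun i => if x i = b then b' else x i)))
    (σ : Equiv.Perm M) (n : ℕ) (R : L.Relations n) (x : Fin n → M) :
    RelMap R (fun i => σ (x i)) ↔ RelMap R x := by
  have hswap : ∀ (a a' : M) (n : ℕ) (R : L.Relations n) (x : Fin n → M),
      RelMap R (fun i => Equiv.swap a a' (x i)) ↔ RelMap R x := by
    intro a a' n R x
    by_cases haa : a = a'
    · simp [haa]
    obtain ⟨b, hb⟩ := hinf (insert a (insert a' (Finset.univ.image x)))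
    simp only [Finset.mem_insert, not_or, Finset.mem_image, Finset.mem_univ, true_and,
      not_exists] at hb
    obtain ⟨hba, hba', hbx⟩ := hb
    -- The transposition is the composite of the replacements of `a` by `b`, of `a'` by `a`, and of
    -- `b` by `a'`, for an unused point `b`.
    have e₁ := hrep a b n R x hbx
    have e₂ := hrep a' a n R (fun i => if x i = a then b else x i) fun i => by
      split_ifs with h <;> assumption
    have e₃ := hrep b a' n R
      (fun i => if (if x i = a then b else x i) = a' then a else if x i = a then b else x i)
      fun i => by split_ifs with h h' <;> assumption
    rw [e₁, e₂, e₃]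
    refine iff_of_eq (congrArg _ (funext fun i => ?_))
    rcases eq_or_ne (x i) a with h | h
    · simp [h, hba']
    · rcases eq_or_ne (x i) a' with h' | h'
      · simp [h', Ne.symm haa, Ne.symm hba]
      · simp [h, h', hbx i, Equiv.swap_apply_of_ne_of_ne]
  -- On a finite set `σ` agrees with a product of transpositions.
  have hX : ∀ X : Finset M, ∃ τ : Equiv.Perm M, (∀ x ∈ X, τ x = σ x) ∧
      ∀ (n : ℕ) (R : L.Relations n) (x : Fin n → M),
        RelMap R (fun i => τ (x i)) ↔ RelMap R x := by
    intro X
    induction X using Finset.induction_on with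
    | empty => exact ⟨1, by simp, fun _ _ _ => Iff.rfl⟩
    | insert a X ha ih =>
      obtain ⟨τ, h1, h2⟩ := ih
      refine ⟨Equiv.swap (τ a) (σ a) * τ, fun x hx => ?_, fun n R x => ?_⟩
      · rcases Finset.mem_insert.1 hx with rfl | hx
        · simp
        · have hxa : x ≠ a := ne_of_mem_of_not_mem hx ha
          rw [Equiv.Perm.mul_apply, Equiv.swap_apply_of_ne_of_ne (τ.injective.ne hxa), h1 x hx]
          rw [h1 x hx]
          exact σ.injective.ne hxa
      · exact (hswap _ _ n R _).trans (h2 n R x)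
  obtain ⟨τ, h1, h2⟩ := hX (Finset.univ.image x)
  rw [← h2 n R x]
  refine iff_of_eq (congrArg _ (funext fun i => ?_))
  rw [h1 _ (Finset.mem_image_of_mem _ (Finset.mem_univ i))]

/-- Suppose `a` and `a'` are not separated over `C`. Strong amalgamation moves the other entries of
a tuple out of `C`, so replacing `a` by `a'` preserves all relations. By double transitivity the
same holds for every pair, and then every permutation is an automorphism. -/
theorem separatesPoints_of_twoTransitive (hM : IsFraisseLimit K M) (hK : StrongAmalgamation K)
    (htr : IsTwoTransitive L M) (hnt : ¬ IsTrivial L M) : SeparatesPoints L M := by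
  intro C a ha a' ha' hne
  by_contra! hcon
  have h1 : ∀ (n : ℕ) (R : L.Relations n) (x : Fin n → M), (∀ i, x i ≠ a') →
      (RelMap R x ↔ RelMap R (fun i => if x i = a then a' else x i)) := by
    intro n R x hx
    obtain ⟨k, hkA, hk⟩ := exists_aut_disjoint hM hK (A := {a, a'})
      (B := {a, a'} ∪ Finset.univ.image x) (C := C) Finset.subset_union_left (by
        intro y hy
        simp only [Finset.mem_insert, Finset.mem_singleton] at hy
        rcases hy with rfl | rfl <;> assumption)
    have hka : k a = a := hkA a (by simp)
    have hka' : k a' = a' := hkA a' (by simp)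
    have h2 := hcon n R (fun i => k (x i)) fun i => by
      by_cases h : k (x i) ∈ C
      · have := hk (x i) (by simp) h
        simp only [Finset.mem_insert, Finset.mem_singleton, hx i, or_false] at this
        exact Or.inl (by rw [this, hka])
      · exact Or.inr h
    rw [aut_relMap] at h2
    rw [h2, ← aut_relMap k R fun i => if x i = a then a' else x i]
    refine iff_of_eq (congrArg _ (funext fun i => ?_))
    by_cases h : x i = a
    · simp [h, hka, hka']
    · have : k (x i) ≠ a := fun h' => h (k.injective (h'.trans hka.symm))
      simp [h, this]
  have h2 : ∀ (b b' : M) (n : ℕ) (R : L.Relations n) (x : Fin n → M), (∀ i, x i ≠ b') →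
      (RelMap R x ↔ RelMap R (fun i => if x i = b then b' else x i)) := by
    intro b b' n R x hx
    rcases eq_or_ne b b' with rfl | hb
    · simp [hx]
    obtain ⟨g, hg, hg'⟩ := htr b b' a a' hb hne
    have h3 := h1 n R (fun i => g (x i)) fun i h => hx i (g.injective (h.trans hg'.symm))
    rw [aut_relMap] at h3
    rw [h3, ← aut_relMap g R fun i => if x i = b then b' else x i]
    refine iff_of_eq (congrArg _ (funext fun i => ?_))
    by_cases h : x i = b
    · simp [h, hg, hg']
    · have : g (x i) ≠ a := fun h' => h (g.injective (h'.trans hg.symm))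
      simp [h, this]
  have hinf : ∀ F : Finset M, ∃ b, b ∉ F := by
    intro F
    obtain ⟨k, -, hk⟩ := exists_aut_disjoint hM hK (A := ∅) (B := {a}) (C := F)
      (Finset.empty_subset _) (Finset.empty_subset _)
    exact ⟨k a, fun h => absurd (hk a (by simp) h) (by simp)⟩
  refine hnt fun σ => ⟨⟨σ, fun F => isEmptyElim F, fun {n} R x => ?_⟩, fun x => rfl⟩
  exact relMap_perm_of_replace hinf h2 σ n R x

theorem isSeparatingClass_of_limit (hM : IsFraisseLimit K M) (hK : StrongAmalgamation K)
    (hne : Nonempty M) (hsep : SeparatesPoints L M) : IsSeparatingClass K where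
  finite D hD := finite_of_mem_class hM hD
  hereditary := hM.age ▸ age.hereditary M
  point := by
    obtain ⟨p⟩ := hne
    exact ⟨_, mem_class_of_finset hM {p}, ⟨⟨p, Finset.mem_singleton_self p⟩⟩⟩
  amalgam C _ hC B q hq := by
    have hher : Hereditary K := hM.age ▸ age.hereditary M
    have : Finite C := finite_of_mem_class hM hC
    let A : Type w := {x : C // x = q ∨ x ∈ B}
    let _ : L.Structure B := pullback L (Subtype.val : B → C)
    let _ : L.Structure A := pullback L (Subtype.val : A → C)
    have hf : IsRelEmb L (fun b : B => (⟨b, Or.inr b.2⟩ : A)) :=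
      ⟨fun a b h => Subtype.ext (congrArg (fun x : A => (x : C)) h), fun _ _ _ => Iff.rfl⟩
    have hg : IsRelEmb L (Subtype.val : B → C) := isRelEmb_pullback Subtype.val_injective
    obtain ⟨D, h₁, h₂, hD, hcomm, hinter⟩ := hK ⟨B, inferInstance⟩ ⟨A, inferInstance⟩
      ⟨C, inferInstance⟩ hf.toEmbedding hg.toEmbedding (mem_pullback hher hC Subtype.val_injective)
      (mem_pullback hher hC Subtype.val_injective) hC
    have hcomm' : ∀ b : B, h₁ (⟨b, Or.inr b.2⟩ : A) = h₂ (b : C) := fun b =>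
      DFunLike.congr_fun hcomm b
    -- The second copy of `q` in the strong amalgam of `C` with `B ∪ {q}` over `B`; strength keeps
    -- it off `C`.
    let φ : Option C → D := fun x => x.elim (h₁ (⟨q, Or.inl rfl⟩ : A)) h₂
    have hq' : ∀ c : C, h₁ (⟨q, Or.inl rfl⟩ : A) ≠ h₂ c := by
      intro c hc
      have : h₁ (⟨q, Or.inl rfl⟩ : A) ∈ Set.range h₁ ∩ Set.range h₂ := ⟨⟨_, rfl⟩, ⟨c, hc.symm⟩⟩
      rw [hinter] at this
      obtain ⟨b, hb⟩ := this
      have hbq : ((b : B) : C) = q := congrArg (fun x : A => (x : C)) (h₁.injective hb)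
      exact hq (hbq ▸ b.2)
    have hφ : Function.Injective φ := by
      rintro (_ | x) (_ | y) hxy
      · rfl
      · exact absurd hxy (hq' y)
      · exact absurd hxy.symm (hq' x)
      · exact congrArg some (h₂.injective hxy)
    refine ⟨pullback L φ, mem_pullback hher hD hφ, ?_, fun κ hκq hκB n R x hx => ?_⟩
    · exact @IsRelEmb.mk L _ _ _ (pullback L φ) _ (Option.some_injective _)
        fun n R x => h₂.map_rel R x
    · have h1 : ∀ i, φ (κ (x i)) = h₁ (⟨x i, hx i⟩ : A) := by
        intro i
        rcases hx i with h | h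
        · simp only [h, hκq]
          rfl
        · rw [hκB _ h]
          exact (hcomm' ⟨x i, h⟩).symm
      refine Iff.trans (iff_of_eq ?_) (h₁.map_rel R fun i => (⟨x i, hx i⟩ : A))
      exact congrArg (RelMap R) (funext h1)
  separate C _ hC a a' haa := by
    have : Finite C := finite_of_mem_class hM hC
    let _ : Fintype C := Fintype.ofFinite C
    rw [← hM.age] at hC
    obtain ⟨-, ⟨ε⟩⟩ := hC
    obtain ⟨n, R, x, hx, hR⟩ := hsep (Finset.univ.image ε) (ε a) (by simp) (ε a') (by simp)
      (ε.injective.ne haa)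
    -- The copy of `C` together with the entries of the separating tuple; entries equal to `ε a`
    -- become placeholders.
    let W : Finset M := Finset.univ.image ε ∪ Finset.univ.image x
    have hεW : ∀ c, ε c ∈ W := fun c => Finset.mem_union_left _ (by simp)
    have hxW : ∀ i, x i ∈ W := fun i => Finset.mem_union_right _ (by simp)
    refine ⟨W, pullback L Subtype.val, mem_class_of_finset hM W, fun c => ⟨ε c, hεW c⟩, ?_, n, R,
      fun i => if x i = ε a then none else some ⟨x i, hxW i⟩, fun i d hd => ?_, fun h => hR ?_⟩
    · exact @IsRelEmb.mk L _ _ _ (pullback L Subtype.val) _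
        (fun c c' h => ε.injective (congrArg Subtype.val h)) fun n R x => ε.map_rel R x
    · dsimp only at hd
      split_ifs at hd with h
      rintro ⟨c, hc⟩
      have hd' := congrArg Subtype.val (Option.some_injective _ hd)
      have hc' := congrArg Subtype.val hc
      dsimp only at hd' hc'
      refine (hx i).resolve_left h ?_
      rw [hd', ← hc']
      simp
    · refine Iff.trans (iff_of_eq ?_) (h.trans (iff_of_eq ?_))
      · refine congrArg (RelMap (M := M) R) (funext fun i => ?_)
        by_cases hi : x i = ε a <;> simp [hi]
      · refine congrArg (RelMap (M := M) R) (funext fun i => ?_)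
        by_cases hi : x i = ε a <;> simp [hi]

omit [L.IsRelational] [Countable M] [DecidableEq M] in
theorem nonempty_of_not_isTrivial (hnt : ¬ IsTrivial L M) : Nonempty M := by
  by_contra hcon
  rw [not_nonempty_iff] at hcon
  exact hnt fun σ => ⟨FirstOrder.Language.Equiv.refl L M, fun x => isEmptyElim x⟩

end Separating

/-! ### The classes of rational metric spaces are separating -/

section RatMetricSeparating

variable {R : Set ℚ}

theorem isSeparatingClass_ratMetric (hR : IsRatDistanceSet R) :
    IsSeparatingClass (ratMetricClass.{w} R) where
  finite D hD := hD.1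
  hereditary := by
    rintro D hD N ⟨hN, ⟨f⟩⟩
    obtain ⟨d, hm, hd⟩ := exists_dist_of_mem hD
    have : Finite N := hN.finite
    refine mem_ratMetricClass (hm.comap f.injective) fun q x y => ?_
    rw [← hd q, dist_relMap_comp f]
    exact (f.map_rel _ _).symm
  point := by
    refine ⟨⟨PUnit, distStructure R fun _ _ => 0⟩, mem_ratMetricClass (d := fun _ _ => 0)
      ⟨fun _ _ => hR.zero_mem, fun _ _ => by simp, fun _ _ => rfl, fun _ _ _ => by simp⟩
      (interpretsDist_distStructure _), ⟨PUnit.unit⟩⟩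
  amalgam C _ hC B q hq := by
    classical
    have : Finite C := hC.1
    let _ : Fintype C := Fintype.ofFinite C
    obtain ⟨d, hm, hd⟩ := exists_dist_of_mem hC
    obtain ⟨g, h1, h2, h3, h4, h5, -⟩ := hm.exists_extension hR (Finset.univ.filter (· ∈ B))
      (d q) (fun x _ => hm.mem q x) (fun x hx => hm.pos fun h => hq (by
        rw [h]
        exact (Finset.mem_filter.1 hx).2))
      (fun x _ y _ => by rw [hm.symm x y]; exact hm.tri _ _ _)
      (fun x _ y _ => by rw [hm.symm q x]; exact hm.tri _ _ _) Finset.univ hR.zero_mem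
    have hmO := hm.option hR (fun x => h2 x (Finset.mem_univ x)) (fun x => h3 x (Finset.mem_univ x))
      (fun x y => h4 x (Finset.mem_univ x) y (Finset.mem_univ y))
      (fun x y => h5 x (Finset.mem_univ x) y (Finset.mem_univ y))
    have hdO := interpretsDist_distStructure (R := R) (IsRatMetric.optionDist d g)
    let _ := distStructure R (IsRatMetric.optionDist d g)
    refine ⟨inferInstance, mem_ratMetricClass hmO hdO, ⟨Option.some_injective _, fun n S x =>
      hd.rel_iff hdO some S x fun _ _ => rfl⟩, fun κ hκq hκB n S x hx =>
      hd.rel_iff hdO κ S x fun i j => ?_⟩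
    have hg : ∀ b ∈ B, g b = d q b := fun b hb => h1 b (by simp [hb])
    rcases hx i with hi | hi <;> rcases hx j with hj | hj
    · rw [hi, hj, hκq, hm.self]
      rfl
    · rw [hi, hκq, hκB _ hj]
      exact hg _ hj
    · rw [hj, hκq, hκB _ hi, hm.symm]
      exact hg _ hi
    · rw [hκB _ hi, hκB _ hj]
      rfl
  separate C _ hC a a' haa := by
    classical
    have : Finite C := hC.1
    let _ : Fintype C := Fintype.ofFinite C
    obtain ⟨d, hm, hd⟩ := exists_dist_of_mem hC
    obtain ⟨b, hb, hb0⟩ := hR.exists_pos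
    have hδ : b / 2 ∈ R := hR.mem_of_le hb (by linarith) (by linarith)
    -- The new point is at distance `b / 2` from `a`. By maximality its distance to `a'` is at least
    -- `b` or equal to `b / 2 + d a a'`, so the relation of index `b / 2` separates.
    obtain ⟨g, h1, h2, h3, h4, h5, h6⟩ := hm.exists_extension hR {a} (fun _ => b / 2)
      (fun _ _ => hδ) (fun _ _ => by linarith) (fun x _ y _ => by linarith [hm.nonneg x y])
      (fun x hx y hy => by
        rw [Finset.mem_singleton.1 hx, Finset.mem_singleton.1 hy, hm.self]
        linarith) Finset.univ hb
    have hmO := hm.option hR (fun x => h2 x (Finset.mem_univ x)) (fun x => h3 x (Finset.mem_univ x))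
      (fun x y => h4 x (Finset.mem_univ x) y (Finset.mem_univ y))
      (fun x y => h5 x (Finset.mem_univ x) y (Finset.mem_univ y))
    have hdO := interpretsDist_distStructure (R := R) (IsRatMetric.optionDist d g)
    let _ := distStructure R (IsRatMetric.optionDist d g)
    refine ⟨Option C, inferInstance, mem_ratMetricClass hmO hdO, some, ⟨Option.some_injective _,
      fun n S x => hd.rel_iff hdO some S x fun _ _ => rfl⟩, 2, distLE ⟨b / 2, hδ⟩,
      ![some none, none], fun i c hc => ?_, fun h => ?_⟩
    · fin_cases i
      · simp only [Fin.zero_eta, Matrix.cons_val_zero, Option.some.injEq] at hc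
        rw [← hc]
        simp
      · simp at hc
    · have hga : g a ≤ b / 2 := (h1 a (Finset.mem_singleton_self a)).le
      have hga' : g a' ≤ b / 2 := h.1 hga
      rcases h6 a' with h | ⟨y, hy, h⟩
      · linarith
      · rw [Finset.mem_singleton.1 hy] at h
        linarith [hm.pos haa]

end RatMetricSeparating

end ZariskiAut

namespace ZariskiAut

open FirstOrder FirstOrder.Language FirstOrder.Language.Structure

/-! ### Products with tournaments -/

section BinaryFactor

theorem funClosed_bin {M : Type*} [binLanguage.Structure M] (X : Finset M) :
    FunClosed binLanguage X := fun _ F => nomatch F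

/-- A tournament in which every vertex `c` can be replaced, on both sides, by new vertices that
have the same edges to a given finite set of other vertices. -/
structure HasNeighbours (M : Type*) [binLanguage.Structure M] [DecidableEq M] : Prop where
  asymm : ∀ x y : M, Edge x y → ¬ Edge y x
  total : ∀ x y : M, x ≠ y → Edge x y ∨ Edge y x
  left : ∀ (C : Finset M), ∀ c ∈ C, ∃ z ∉ C, Edge z c ∧ SameRel edgeRel (C.erase c) z c
  right : ∀ (C : Finset M), ∀ c ∈ C, ∃ z ∉ C, Edge c z ∧ SameRel edgeRel (C.erase c) z c

/-- Let `c` have the edges of `q` to `A`, and suppose `g c ≠ c`. A conjugate of `q` placed next to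
`c` looks like `c` from `g c`, while its edge to `c` can be given the opposite direction; a fixed
point cannot do this. -/
theorem not_zariski_prod_tournament {L₁ : FirstOrder.Language.{u, v}} [L₁.IsRelational]
    {K₁ : Set (Bundled.{w} L₁.Structure)} {K₂ : Set (Bundled.{w} binLanguage.Structure)}
    [Countable (Σ l, binLanguage.Functions l)]
    {M : Type w} [L₁.Structure M] [binLanguage.Structure M] [Countable M] [DecidableEq M]
    (hM : IsFraisseLimit (prodClass K₁ K₂) M) (hK₁ : IsSeparatingClass K₁)
    {M₂ : Type w} [binLanguage.Structure M₂] [DecidableEq M₂] [Nonempty M₂]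
    (hM₂ : binLanguage.age M₂ = K₂) (hn : HasNeighbours M₂) :
    ¬ ZariskiIsGroupTopology (M ≃[L₁.sum binLanguage] M) := by
  have hirr : ∀ x : M₂, ¬ symbRel edgeRel x x := fun x hx => hn.asymm x x hx hx
  have hρ : DeterminesStructure edgeRel M := fun X f _ _ hinj hf =>
    ⟨hinj, funClosed_bin X, (fun _ F => nomatch F), fun n R x hx =>
      bin_rel_iff f R x fun i j => hf _ (hx i) _ (hx j)⟩
  refine not_zariski_prod hM hK₁ hM₂ hρ
    (fun C _ c hc => ?_) (fun x y => iff_of_false (hirr x) (hirr y))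
    ⟨Classical.arbitrary M₂, funClosed_bin _⟩ (funClosed_bin _)
    (fun A _ u hu => ⟨A, funClosed_bin _, subset_rfl, hu, funClosed_bin _⟩)
    fun A _ q hqA _ F g hg => ⟨q, hqA, funClosed_bin _, fun c hcA hcq _ _ hsame => ?_⟩
  · obtain ⟨z, h1, h2, h3⟩ := hn.left C c hc
    exact ⟨z, h1, funClosed_bin _, h2, h3, fun _ _ _ _ _ => funClosed_bin _⟩
  by_contra hne
  let C : Finset M := insert c (insert (g c) (insert q (A ∪ F)))
  have hcC : c ∈ C := by simp [C]
  have hgcC : g c ∈ C := by simp [C]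
  have hqC : q ∈ C := by simp [C]
  have hAC : A ⊆ C := fun x hx => by simp [C, hx]
  have hFC : F ⊆ C := fun x hx => by simp [C, hx]
  obtain ⟨e, he⟩ := exists_chart hM hM₂ (funClosed_bin C)
  have hne' : e (g c) ≠ e c := fun h => hne (he.inj hgcC hcC h)
  -- a new point that looks like `c` is the position of a conjugate of `q`
  have key : ∀ z ∉ C.image e, SameRel edgeRel ((C.image e).erase (e c)) z (e c) →
      ∃ q' : M, g q' = q' ∧ ∀ x ∈ C, (symbRel edgeRel q' x ↔ symbRel edgeRel z (e x)) ∧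
        (symbRel edgeRel x q' ↔ symbRel edgeRel (e x) z) := by
    intro z hz hzs
    obtain ⟨h, hA, hqC', hx⟩ := prod_exists_conjugate hM hK₁ hM₂ hρ he hAC hqC hqA
      (funClosed_bin _) hz (funClosed_bin _) (funClosed_bin _)
      (iff_of_false (hirr z) fun h => hirr (e q) ((he.symbRel_iff _ hqC hqC).2 h))
      fun a ha => by
        have haC := hAC ha
        have hac : e a ≠ e c := fun h => hcA (he.inj haC hcC h ▸ ha)
        have h1 := hzs (e a) (Finset.mem_erase.2 ⟨hac, Finset.mem_image_of_mem e haC⟩)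
        exact ⟨h1.1.trans ((he.symbRel_iff _ hcC haC).trans (hsame a ha).1),
          h1.2.trans ((he.symbRel_iff _ haC hcC).trans (hsame a ha).2)⟩
    exact ⟨h q, hg h hA fun h => hqC' (hFC h), hx⟩
  have hgcm : e (g c) ∈ (C.image e).erase (e c) :=
    Finset.mem_erase.2 ⟨hne', Finset.mem_image_of_mem e hgcC⟩
  rcases hn.total _ _ hne' with h | h
  · obtain ⟨z, hz, hzc, hzs⟩ := hn.left _ _ (Finset.mem_image_of_mem e hcC)
    obtain ⟨q', hq', hx⟩ := key z hz hzs
    have h1 : symbRel edgeRel q' c := (hx c hcC).1.2 hzc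
    rw [← prod_aut_symbRel g, hq'] at h1
    exact hn.asymm _ _ h ((hzs _ hgcm).1.1 ((hx _ hgcC).1.1 h1))
  · obtain ⟨z, hz, hzc, hzs⟩ := hn.right _ _ (Finset.mem_image_of_mem e hcC)
    obtain ⟨q', hq', hx⟩ := key z hz hzs
    have h1 : symbRel edgeRel c q' := (hx c hcC).2.2 hzc
    rw [← prod_aut_symbRel g, hq'] at h1
    exact hn.asymm _ _ h ((hzs _ hgcm).2.1 ((hx _ hgcC).2.1 h1))

theorem IsRatOrder.hasNeighbours {M : Type*} [binLanguage.Structure M] [DecidableEq M]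
    (hM : IsRatOrder M) : HasNeighbours M := by
  obtain ⟨e, he⟩ := hM
  have key : ∀ (C : Finset M) (c : M) (r : ℚ), r ≠ e c →
      (∀ x ∈ C.erase c, (r < e x ↔ e c < e x) ∧ (e x < r ↔ e x < e c)) →
      e.symm r ∉ C ∧ SameRel edgeRel (C.erase c) (e.symm r) c := by
    intro C c r hrc hr
    refine ⟨fun h => ?_, fun x hx => ⟨?_, ?_⟩⟩
    · have hne : e.symm r ≠ c := fun h => hrc (by rw [← h, e.apply_symm_apply])
      obtain ⟨h1, h2⟩ := hr _ (Finset.mem_erase.2 ⟨hne, h⟩)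
      rw [e.apply_symm_apply] at h1 h2
      rcases lt_or_gt_of_ne hrc with h | h
      · exact lt_irrefl _ (h2.2 h)
      · exact lt_irrefl _ (h1.2 h)
    · refine (he _ _).trans (Iff.trans ?_ (he _ _).symm)
      rw [e.apply_symm_apply]
      exact (hr x hx).1
    · refine (he _ _).trans (Iff.trans ?_ (he _ _).symm)
      rw [e.apply_symm_apply]
      exact (hr x hx).2
  refine ⟨fun x y h h' => lt_asymm ((he _ _).1 h) ((he _ _).1 h'), fun x y h => ?_,
    fun C c hc => ?_, fun C c hc => ?_⟩
  · rw [he, he]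
    exact lt_or_gt_of_ne (e.injective.ne h)
  · obtain ⟨r, h1, h2⟩ := Order.exists_between_finsets
      (lo := (C.filter fun x => e x < e c).image e) (hi := {e c})
      (by simp; rintro _ x _ h rfl; exact h)
    have hrc : r < e c := h2 _ (Finset.mem_singleton_self _)
    obtain ⟨h3, h4⟩ := key C c r hrc.ne fun x hx => by
      obtain ⟨hxc, hxC⟩ := Finset.mem_erase.1 hx
      rcases lt_or_gt_of_ne (e.injective.ne hxc) with h | h
      · have := h1 (e x) (Finset.mem_image_of_mem e (Finset.mem_filter.2 ⟨hxC, h⟩))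
        exact ⟨iff_of_false this.not_gt h.not_gt, iff_of_true this h⟩
      · exact ⟨iff_of_true (hrc.trans h) h, iff_of_false (hrc.trans h).not_gt h.not_gt⟩
    exact ⟨_, h3, (he _ _).2 (by rwa [e.apply_symm_apply]), h4⟩
  · obtain ⟨r, h1, h2⟩ := Order.exists_between_finsets
      (lo := {e c}) (hi := (C.filter fun x => e c < e x).image e)
      (by simp; rintro _ x _ h rfl; exact h)
    have hrc : e c < r := h1 _ (Finset.mem_singleton_self _)
    obtain ⟨h3, h4⟩ := key C c r hrc.ne' fun x hx => by
      obtain ⟨hxc, hxC⟩ := Finset.mem_erase.1 hx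
      rcases lt_or_gt_of_ne (e.injective.ne hxc) with h | h
      · exact ⟨iff_of_false (h.trans hrc).not_gt h.not_gt, iff_of_true (h.trans hrc) h⟩
      · have := h2 (e x) (Finset.mem_image_of_mem e (Finset.mem_filter.2 ⟨hxC, h⟩))
        exact ⟨iff_of_true this h, iff_of_false this.not_gt h.not_gt⟩
    exact ⟨_, h3, (he _ _).2 (by rwa [e.apply_symm_apply]), h4⟩

theorem circle_im_div_swap (x y : Circle) : ((x : ℂ) / y).im = -((y : ℂ) / x).im := by
  have : (x : ℂ) / y = (starRingEnd ℂ) ((y : ℂ) / x) := by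
    rw [← Circle.coe_div, ← Circle.coe_div, ← Circle.coe_inv_eq_conj, inv_div]
  rw [this, Complex.conj_im]

theorem circle_eq_or_eq_neg_of_im {x y : Circle} (h : ((y : ℂ) / x).im = 0) :
    (y : ℂ) = x ∨ (y : ℂ) = -x := by
  have hx : (x : ℂ) ≠ 0 := x.coe_ne_zero
  have h1 : ‖(y : ℂ) / x‖ = 1 := by rw [← Circle.coe_div, Circle.norm_coe]
  have h2 : (y : ℂ) / x = (((y : ℂ) / x).re : ℂ) := Complex.ext (by simp) (by simpa using h)
  rw [h2, Complex.norm_real, Real.norm_eq_abs] at h1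
  rcases eq_or_eq_neg_of_abs_eq h1 with h3 | h3
  · left
    rw [h3, div_eq_iff hx] at h2
    simpa using h2
  · right
    rw [h3, div_eq_iff hx] at h2
    simpa using h2

/-- The imaginary parts that decide the edges at `c` are non-zero, so a small rotation of `f c`
preserves their signs. These are open conditions, and density provides a vertex; the sign `σ`
selects the side of `c`. -/
theorem IsCyclicTournament.hasNeighbours {M : Type*} [binLanguage.Structure M] [DecidableEq M]
    (hM : IsCyclicTournament M) : HasNeighbours M := by
  obtain ⟨f, hinj, hdense, hanti, hf⟩ := hM
  have hne : ∀ x y : M, x ≠ y → ((f y : ℂ) / f x).im ≠ 0 := by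
    intro x y hxy h
    rcases circle_eq_or_eq_neg_of_im h with h | h
    · exact hxy (hinj (Circle.ext h)).symm
    · exact hanti y x h
  have hself : ∀ x : M, ((f x : ℂ) / f x).im = 0 := fun x => by
    rw [div_self (f x).coe_ne_zero, Complex.one_im]
  have key : ∀ σ : ℝ, σ = 1 ∨ σ = -1 → ∀ (C : Finset M) (c : M), ∃ z ∉ C,
      0 < σ * ((f z : ℂ) / f c).im ∧ SameRel edgeRel (C.erase c) z c := by
    intro σ hσ C c
    have hcont : ∀ x : M, Continuous fun w : Circle => ((w : ℂ) / f x).im := fun x =>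
      Complex.continuous_im.comp (Continuous.div_const continuous_subtype_val _)
    let U : Set Circle := {w | 0 < σ * ((w : ℂ) / f c).im} ∩
      ⋂ x ∈ C.erase c, {w | 0 < ((w : ℂ) / f x).im * ((f c : ℂ) / f x).im}
    have hU : IsOpen U := by
      refine (isOpen_lt continuous_const (continuous_const.mul (hcont c))).inter
        (isOpen_biInter_finset fun x _ => ?_)
      exact isOpen_lt continuous_const ((hcont x).mul continuous_const)
    have hUne : U.Nonempty := by
      let γ : ℝ → Circle := fun θ => f c * Circle.exp (σ * θ)
      have hγ : Continuous γ :=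
        continuous_const.mul (Circle.exp.continuous.comp (continuous_const.mul continuous_id))
      have h0 : γ 0 = f c := by simp [γ]
      have h1 : ∀ᶠ θ in nhdsWithin (0 : ℝ) (Set.Ioi 0), ∀ x ∈ C.erase c,
          0 < ((γ θ : ℂ) / f x).im * ((f c : ℂ) / f x).im := by
        refine Filter.Eventually.filter_mono nhdsWithin_le_nhds
          ((Filter.eventually_all_finset _).2 fun x hx => ?_)
        refine ContinuousAt.eventually_lt continuousAt_const
          (((hcont x).comp hγ).mul continuous_const).continuousAt ?_
        show 0 < ((γ 0 : ℂ) / f x).im * _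
        rw [h0]
        exact mul_self_pos.2 (hne x c (Finset.ne_of_mem_erase hx))
      have h2 : ∀ᶠ θ in nhdsWithin (0 : ℝ) (Set.Ioi 0), θ ∈ Set.Ioo 0 Real.pi :=
        Ioo_mem_nhdsGT Real.pi_pos
      obtain ⟨θ, hθ1, hθ2⟩ := (h1.and h2).exists
      refine ⟨γ θ, ?_, Set.mem_iInter₂.2 hθ1⟩
      have h3 : (γ θ : ℂ) / f c = Complex.exp ((σ * θ : ℝ) * Complex.I) := by
        simp only [γ, Circle.coe_mul, Circle.coe_exp]
        exact mul_div_cancel_left₀ _ (f c).coe_ne_zero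
      show 0 < σ * ((γ θ : ℂ) / f c).im
      rw [h3, Complex.exp_ofReal_mul_I_im]
      have h4 := Real.sin_pos_of_pos_of_lt_pi hθ2.1 hθ2.2
      rcases hσ with rfl | rfl
      · simpa using h4
      · simpa using h4
    obtain ⟨z, hz1, hz2⟩ := hdense.exists_mem_open hU hUne
    have hz2' : ∀ x ∈ C.erase c, 0 < ((f z : ℂ) / f x).im * ((f c : ℂ) / f x).im :=
      Set.mem_iInter₂.1 hz2
    refine ⟨z, fun hzC => ?_, hz1, fun x hx => ?_⟩
    · rcases eq_or_ne z c with rfl | hzc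
      · have : 0 < σ * ((f z : ℂ) / f z).im := hz1
        rw [hself, mul_zero] at this
        exact lt_irrefl _ this
      · have := hz2' z (Finset.mem_erase.2 ⟨hzc, hzC⟩)
        rw [hself, zero_mul] at this
        exact lt_irrefl _ this
    · have hx' := hz2' x hx
      have h1 : 0 < ((f z : ℂ) / f x).im ↔ 0 < ((f c : ℂ) / f x).im :=
        pos_iff_pos_of_mul_pos hx'
      have h2 : ((f z : ℂ) / f x).im < 0 ↔ ((f c : ℂ) / f x).im < 0 :=
        neg_iff_neg_of_mul_pos hx'
      refine ⟨(hf _ _).trans (Iff.trans ?_ (hf _ _).symm),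
        (hf _ _).trans (Iff.trans h1 (hf _ _).symm)⟩
      rw [circle_im_div_swap, circle_im_div_swap (f x) (f c), neg_pos, neg_pos]
      exact h2
  refine ⟨fun x y h h' => ?_, fun x y h => ?_, fun C c _ => ?_, fun C c _ => ?_⟩
  · rw [hf] at h h'
    rw [circle_im_div_swap] at h'
    linarith
  · rw [hf, hf, circle_im_div_swap (f x), neg_pos]
    exact (lt_or_gt_of_ne (hne x y h)).symm
  · obtain ⟨z, h1, h2, h3⟩ := key (-1) (Or.inr rfl) C c
    refine ⟨z, h1, ?_, h3⟩
    rw [hf, circle_im_div_swap]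
    linarith
  · obtain ⟨z, h1, h2, h3⟩ := key 1 (Or.inl rfl) C c
    refine ⟨z, h1, ?_, h3⟩
    rw [hf]
    linarith

end BinaryFactor

end ZariskiAut

namespace ZariskiAut

open FirstOrder FirstOrder.Language FirstOrder.Language.Structure

/-! ### Positions in a dense meet tree -/

section TreeOrder

variable {T : Type*} [SemilatticeInf T] {X C : Finset T} {c z : T}

/-- The elements of `C` below `c` form a chain, so a point between its maximum and `c` suffices. -/
theorem exists_just_below
    (hlin : ∀ t x y : T, x ≤ t → y ≤ t → x ≤ y ∨ y ≤ x)
    [DenselyOrdered T] [NoMinOrder T] (C : Finset T) (c : T) :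
    ∃ z < c, ∀ x ∈ C, x < c → x < z := by
  classical
  rcases (C.filter (· < c)).eq_empty_or_nonempty with h | h
  · obtain ⟨z, hz⟩ := exists_lt c
    exact ⟨z, hz, fun x hx hxc => absurd hxc (Finset.filter_eq_empty_iff.1 h hx)⟩
  · obtain ⟨m, hm⟩ := Finset.exists_maximal h
    have hmc : m < c := (Finset.mem_filter.1 hm.prop).2
    obtain ⟨z, hmz, hzc⟩ := exists_between hmc
    refine ⟨z, hzc, fun x hx hxc => lt_of_le_of_lt ?_ hmz⟩
    rcases hlin c x m hxc.le hmc.le with h | h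
    · exact h
    · exact hm.le_of_ge (Finset.mem_filter.2 ⟨hx, hxc⟩) h

theorem exists_just_above
    (hlin : ∀ t x y : T, x ≤ t → y ≤ t → x ≤ y ∨ y ≤ x)
    [DenselyOrdered T] (C : Finset T) {a : T} (ha : a ∈ C) (hca : c < a) :
    ∃ z, c < z ∧ ∀ x ∈ C, c < x → x ≤ a → z < x := by
  classical
  obtain ⟨m, hm⟩ := Finset.exists_minimal
    (s := C.filter fun x => c < x ∧ x ≤ a) ⟨a, Finset.mem_filter.2 ⟨ha, hca, le_rfl⟩⟩
  obtain ⟨-, hcm, hma⟩ := Finset.mem_filter.1 hm.prop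
  obtain ⟨z, hcz, hzm⟩ := exists_between hcm
  refine ⟨z, hcz, fun x hx hcx hxa => lt_of_lt_of_le hzm ?_⟩
  rcases hlin a m x hma hxa with h | h
  · exact h
  · exact hm.le_of_le (Finset.mem_filter.2 ⟨hx, hcx, hxa⟩) h

/-- Each `x` excludes at most one element of `S`: if `x ⊓ z` and `x ⊓ z'` are both not below `c`,
the smaller of these two comparable elements lies below `z ⊓ z' = c`. -/
theorem exists_new_cone
    (hlin : ∀ t x y : T, x ≤ t → y ≤ t → x ≤ y ∨ y ≤ x)
    (C : Finset T) (c : T) (hbr : ∃ S : Set T, S.Infinite ∧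
    (∀ x ∈ S, c < x) ∧ ∀ x ∈ S, ∀ y ∈ S, x ≠ y → x ⊓ y = c) :
    ∃ z, c < z ∧ ∀ x ∈ C, x ⊓ z = x ⊓ c := by
  obtain ⟨S, hS, hcS, hSS⟩ := hbr
  have hbad : (⋃ x ∈ C, {z ∈ S | ¬ x ⊓ z ≤ c}).Finite := by
    refine C.finite_toSet.biUnion fun x _ => Set.Subsingleton.finite ?_
    rintro z ⟨hz, hxz⟩ z' ⟨hz', hxz'⟩
    by_contra hne
    have hw : ∀ w, w ≤ z → w ≤ z' → w ≤ c := fun w h h' => hSS z hz z' hz' hne ▸ le_inf h h'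
    rcases hlin x (x ⊓ z) (x ⊓ z') inf_le_left inf_le_left with h | h
    · exact hxz (hw _ inf_le_right (h.trans inf_le_right))
    · exact hxz' (hw _ (h.trans inf_le_right) inf_le_right)
  obtain ⟨z, hzS, hz⟩ := hS.exists_notMem_finite hbad
  refine ⟨z, hcS z hzS, fun x hx => le_antisymm (le_inf inf_le_left ?_)
    (inf_le_inf_left x (hcS z hzS).le)⟩
  by_contra h
  exact hz (Set.mem_biUnion (Finset.mem_coe.2 hx) ⟨hzS, h⟩)

variable [DecidableEq T]

theorem infClosed_insert (hX : InfClosed (X : Set T)) (h : ∀ x ∈ X, x ⊓ z ∈ insert z X) :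
    InfClosed (↑(insert z X) : Set T) := by
  intro x hx y hy
  rw [Finset.mem_coe, Finset.mem_insert] at hx hy
  rw [Finset.mem_coe]
  rcases hx with rfl | hx <;> rcases hy with rfl | hy
  · rw [inf_idem]
    exact Finset.mem_insert_self _ _
  · rw [inf_comm]
    exact h y hy
  · exact h x hx
  · exact Finset.mem_insert_of_mem (hX hx hy)

theorem infClosed_insert_below (hX : InfClosed (X : Set T))
    (hcX : InfClosed (↑(insert c X) : Set T)) (hzc : z < c) (h : ∀ x ∈ X, x < c → x ≤ z) :
    InfClosed (↑(insert z X) : Set T) := by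
  refine infClosed_insert hX fun x hx => ?_
  by_cases hcx : c ≤ x
  · rw [inf_eq_right.2 (hzc.le.trans hcx)]
    exact Finset.mem_insert_self _ _
  · have hlt : x ⊓ c < c := lt_of_le_of_ne inf_le_right fun h => hcx (inf_eq_right.1 h)
    have hmem : x ⊓ c ∈ X := (Finset.mem_insert.1 (hcX (Finset.mem_coe.2 (Finset.mem_insert_of_mem hx))
      (Finset.mem_coe.2 (Finset.mem_insert_self c X)))).resolve_left hlt.ne
    rw [show x ⊓ z = x ⊓ c from le_antisymm (inf_le_inf_left x hzc.le)
      (le_inf inf_le_left (h _ hmem hlt))]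
    exact Finset.mem_insert_of_mem hmem

theorem infClosed_insert_of_le
    (hlin : ∀ t x y : T, x ≤ t → y ≤ t → x ≤ y ∨ y ≤ x)
    (hX : InfClosed (X : Set T)) {a : T} (ha : a ∈ X) (hza : z ≤ a) :
    InfClosed (↑(insert z X) : Set T) := by
  refine infClosed_insert hX fun x hx => ?_
  rcases hlin a z (x ⊓ a) hza inf_le_right with h | h
  · rw [inf_eq_right.2 (h.trans inf_le_left)]
    exact Finset.mem_insert_self _ _
  · rw [show x ⊓ z = x ⊓ a from le_antisymm (inf_le_inf_left x hza) (le_inf inf_le_left h)]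
    exact Finset.mem_insert_of_mem (hX hx ha)

/-- A point below some member of `X` can be added at once. Otherwise all meets with `t` are added
first, and `t` is not among them. -/
theorem exists_closed_step
    (hlin : ∀ t x y : T, x ≤ t → y ≤ t → x ≤ y ∨ y ≤ x)
    (hX : InfClosed (X : Set T)) {t : T} (ht : t ∉ X) :
    ∃ Y : Finset T, InfClosed (Y : Set T) ∧ X ⊆ Y ∧ t ∉ Y ∧ InfClosed (↑(insert t Y) : Set T) := by
  by_cases hta : ∃ a ∈ X, t ≤ a
  · obtain ⟨a, ha, hta⟩ := hta
    exact ⟨X, hX, subset_rfl, ht, infClosed_insert_of_le hlin hX ha hta⟩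
  push Not at hta
  have hY : InfClosed (↑(X ∪ X.image (t ⊓ ·)) : Set T) := by
    intro x hx y hy
    simp only [Finset.coe_union, Finset.coe_image, Set.mem_union, Set.mem_image,
      Finset.mem_coe] at hx hy ⊢
    rcases hx with hx | ⟨x, hx, rfl⟩ <;> rcases hy with hy | ⟨y, hy, rfl⟩
    · exact Or.inl (hX hx hy)
    · exact Or.inr ⟨x ⊓ y, hX hx hy, inf_left_comm _ _ _⟩
    · exact Or.inr ⟨x ⊓ y, hX hx hy, (inf_assoc _ _ _).symm⟩
    · exact Or.inr ⟨x ⊓ y, hX hx hy, inf_inf_distrib_left _ _ _⟩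
  refine ⟨_, hY, Finset.subset_union_left, fun h => ?_, infClosed_insert hY fun x hx => ?_⟩
  · rcases Finset.mem_union.1 h with h | h
    · exact ht h
    · obtain ⟨a, ha, h⟩ := Finset.mem_image.1 h
      exact hta a ha (inf_eq_left.1 h)
  · refine Finset.mem_insert_of_mem (Finset.mem_union_right _ (Finset.mem_image.2 ?_))
    rcases Finset.mem_union.1 hx with hx | hx
    · exact ⟨x, hx, inf_comm _ _⟩
    · obtain ⟨a, ha, rfl⟩ := Finset.mem_image.1 hx
      exact ⟨a, ha, (inf_eq_left.2 inf_le_left).symm⟩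

theorem exists_position_below
    (hlin : ∀ t x y : T, x ≤ t → y ≤ t → x ≤ y ∨ y ≤ x)
    [DenselyOrdered T] [NoMinOrder T] (hC : InfClosed (C : Set T))
    (hc : c ∈ C) : ∃ z ∉ C, z < c ∧ (∀ x ∈ C.erase c, (z ≤ x ↔ c ≤ x) ∧ (x ≤ z ↔ x ≤ c)) ∧
      ∀ X ⊆ C, InfClosed (X : Set T) → InfClosed (↑(insert c X) : Set T) →
        InfClosed (↑(insert z X) : Set T) := by
  obtain ⟨z, hzc, hz⟩ := exists_just_below hlin C c
  refine ⟨z, fun h => lt_irrefl _ (hz z h hzc), hzc, fun x hx => ?_, fun X hXC hX hcX =>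
    infClosed_insert_below hX hcX hzc fun x hx hxc => (hz x (hXC hx) hxc).le⟩
  obtain ⟨hxc, hxC⟩ := Finset.mem_erase.1 hx
  refine ⟨⟨fun h => ?_, hzc.le.trans⟩, fun h => h.trans hzc.le,
    fun h => (hz x hxC (lt_of_le_of_ne h hxc)).le⟩
  by_contra hcx
  have hlt : x ⊓ c < c := lt_of_le_of_ne inf_le_right fun h => hcx (inf_eq_right.1 h)
  exact (le_inf h hzc.le).not_gt (hz _ (hC hxC hc) hlt)

/-- The new point must keep the order type of `c` over `X`. If `X` has elements above `c`, it goes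
just above `c` on the way to one of them; otherwise it opens a new cone at `c`. -/
theorem exists_position_above
    (hlin : ∀ t x y : T, x ≤ t → y ≤ t → x ≤ y ∨ y ≤ x)
    [DenselyOrdered T] (hbr : ∀ t : T, ∃ S : Set T, S.Infinite ∧
      (∀ x ∈ S, t < x) ∧ ∀ x ∈ S, ∀ y ∈ S, x ≠ y → x ⊓ y = t)
    (hC : InfClosed (C : Set T)) (hc : c ∈ C) (hXC : X ⊆ C) (hX : InfClosed (X : Set T))
    (hcX : c ∉ X) (hcX' : InfClosed (↑(insert c X) : Set T)) :
    ∃ z ∉ C, c < z ∧ (∀ x ∈ C, x ≤ z → x ≤ c) ∧ (∀ x ∈ X, z ≤ x ↔ c ≤ x) ∧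
      InfClosed (↑(insert z C) : Set T) ∧ InfClosed (↑(insert z X) : Set T) := by
  by_cases hca : ∃ a ∈ X, c ≤ a
  · obtain ⟨a, ha, hca⟩ := hca
    have hca' : c < a := lt_of_le_of_ne hca fun h => hcX (h ▸ ha)
    obtain ⟨z, hcz, hz⟩ := exists_just_above hlin C (hXC ha) hca'
    have hza : z < a := hz a (hXC ha) hca' le_rfl
    refine ⟨z, fun h => lt_irrefl _ (hz z h hcz hza.le), hcz, fun x hx hxz => ?_,
      fun x hx => ⟨hcz.le.trans, fun h => ?_⟩, infClosed_insert_of_le hlin hC (hXC ha) hza.le,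
      infClosed_insert_of_le hlin hX ha hza.le⟩
    · rcases hlin a x c (hxz.trans hza.le) hca with h | h
      · exact h
      · rcases h.eq_or_lt with h | h
        · exact h.ge
        · exact absurd hxz (hz x hx h (hxz.trans hza.le)).not_ge
    · have hne : c ≠ x ⊓ a := fun h => hcX (h ▸ hX hx ha)
      exact (hz _ (hXC (hX hx ha)) (lt_of_le_of_ne (le_inf h hca) hne) inf_le_right).le.trans
        inf_le_left
  · push Not at hca
    obtain ⟨z, hcz, hz⟩ := exists_new_cone hlin C c (hbr c)
    have hle : ∀ x ∈ C, x ≤ z → x ≤ c := fun x hx h => by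
      rw [← inf_eq_left, ← hz x hx, inf_eq_left.2 h]
    refine ⟨z, fun h => (hle z h le_rfl).not_gt hcz, hcz, hle,
      fun x hx => iff_of_false (fun h => hca x hx (hcz.le.trans h)) (hca x hx),
      infClosed_insert hC fun x hx => ?_, infClosed_insert hX fun x hx => ?_⟩
    · rw [hz x hx]
      exact Finset.mem_insert_of_mem (hC hx hc)
    · rw [hz x (hXC hx)]
      refine Finset.mem_insert_of_mem ((Finset.mem_insert.1 (hcX'
        (Finset.mem_coe.2 (Finset.mem_insert_of_mem hx))
        (Finset.mem_coe.2 (Finset.mem_insert_self c X)))).resolve_left fun h => ?_)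
      exact hca x hx (inf_eq_right.1 h)

end TreeOrder

/-! ### Products with dense meet trees -/

section TreeFactor

/-- The order symbol of meet trees. -/
def leRel : meetTreeLanguage.Relations 2 := MeetTreeRel.le

/-- The universal axioms of meet trees. -/
structure IsMeetTree (M : Type*) [meetTreeLanguage.Structure M] : Prop where
  refl : ∀ x : M, TreeLE x x
  antisymm : ∀ x y : M, TreeLE x y → TreeLE y x → x = y
  trans : ∀ x y z : M, TreeLE x y → TreeLE y z → TreeLE x z
  linear : ∀ t x y : M, TreeLE x t → TreeLE y t → TreeLE x y ∨ TreeLE y x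
  meet : ∀ x y s : M, TreeLE s (treeMeet x y) ↔ TreeLE s x ∧ TreeLE s y

theorem IsDenseMeetTree.isMeetTree {M : Type*} [meetTreeLanguage.Structure M]
    (h : IsDenseMeetTree M) : IsMeetTree M := ⟨h.refl, h.antisymm, h.trans, h.linear, h.meet⟩

/-- The order of a meet tree. -/
@[reducible] def IsMeetTree.semilatticeInf {M : Type*} [meetTreeLanguage.Structure M]
    (h : IsMeetTree M) : SemilatticeInf M where
  le := TreeLE
  le_refl := h.refl
  le_trans := h.trans
  le_antisymm := h.antisymm
  inf := treeMeet
  inf_le_left x y := ((h.meet x y _).1 (h.refl _)).1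
  inf_le_right x y := ((h.meet x y _).1 (h.refl _)).2
  le_inf s x y hx hy := (h.meet x y s).2 ⟨hx, hy⟩

theorem funMap_meet {M : Type*} [meetTreeLanguage.Structure M] (F : meetTreeLanguage.Functions 2)
    (x : Fin 2 → M) : funMap F x = treeMeet (x 0) (x 1) := by
  cases F
  unfold treeMeet
  congr 1
  ext i
  fin_cases i <;> rfl

theorem funClosed_tree {M : Type*} [meetTreeLanguage.Structure M] {X : Finset M} :
    FunClosed meetTreeLanguage X ↔ ∀ x ∈ X, ∀ y ∈ X, treeMeet x y ∈ X := by
  constructor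
  · intro h x hx y hy
    exact h 2 MeetTreeFunc.meet ![x, y] fun i => by fin_cases i <;> assumption
  · intro h n F x hx
    have hn : n = 2 := by cases F; rfl
    subst hn
    rw [funMap_meet]
    exact h _ (hx 0) _ (hx 1)

theorem IsMeetTree.funClosed_iff {M : Type*} [meetTreeLanguage.Structure M] (h : IsMeetTree M)
    {X : Finset M} :
    FunClosed meetTreeLanguage X ↔ @InfClosed M h.semilatticeInf (X : Set M) :=
  funClosed_tree.trans ⟨fun h _ hx _ hy => h _ hx _ hy, fun h _ hx _ hy => h hx hy⟩

/-- The axioms are universal and involve at most three elements and one meet, so they can be checked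
inside a chart. -/
theorem IsMeetTree.of_charts {M M₂ : Type*} [meetTreeLanguage.Structure M]
    [meetTreeLanguage.Structure M₂] (h : IsMeetTree M₂) (hC : ∀ F : Finset M, ∃ C, F ⊆ C ∧
      ∃ e : M → M₂, IsChart meetTreeLanguage C e) : IsMeetTree M := by
  classical
  have key : ∀ x y z : M, ∃ e : M → M₂, (∀ a ∈ ({x, y, z, treeMeet x y} : Finset M),
      ∀ b ∈ ({x, y, z, treeMeet x y} : Finset M), (TreeLE (e a) (e b) ↔ TreeLE a b) ∧
        (e a = e b → a = b)) ∧ e (treeMeet x y) = treeMeet (e x) (e y) := by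
    intro x y z
    obtain ⟨C, hFC, e, he⟩ := hC {x, y, z}
    have hx : x ∈ C := hFC (by simp)
    have hy : y ∈ C := hFC (by simp)
    have hsub : ({x, y, z, treeMeet x y} : Finset M) ⊆ C := by
      have h1 := funClosed_tree.1 he.closed x hx y hy
      intro a ha
      simp only [Finset.mem_insert, Finset.mem_singleton] at ha
      rcases ha with rfl | rfl | rfl | rfl
      exacts [hx, hy, hFC (by simp), h1]
    refine ⟨e, fun a ha b hb => ⟨he.symbRel_iff leRel (hsub ha) (hsub hb),
      he.inj (hsub ha) (hsub hb)⟩, ?_⟩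
    have h1 := he.map_fun 2 MeetTreeFunc.meet ![x, y] fun i => by fin_cases i <;> assumption
    exact h1.trans (funMap_meet (MeetTreeFunc.meet : meetTreeLanguage.Functions 2) _)
  refine ⟨fun x => ?_, fun x y hxy hyx => ?_, fun x y z hxy hyz => ?_, fun t x y hx hy => ?_,
    fun x y s => ?_⟩
  · obtain ⟨e, he, -⟩ := key x x x
    exact (he x (by simp) x (by simp)).1.1 (h.refl _)
  · obtain ⟨e, he, -⟩ := key x y y
    have h1 := he x (by simp) y (by simp)
    exact h1.2 (h.antisymm _ _ (h1.1.2 hxy) ((he y (by simp) x (by simp)).1.2 hyx))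
  · obtain ⟨e, he, -⟩ := key x y z
    exact (he x (by simp) z (by simp)).1.1 (h.trans _ _ _ ((he x (by simp) y (by simp)).1.2 hxy)
      ((he y (by simp) z (by simp)).1.2 hyz))
  · obtain ⟨e, he, -⟩ := key x y t
    exact (h.linear _ _ _ ((he x (by simp) t (by simp)).1.2 hx)
      ((he y (by simp) t (by simp)).1.2 hy)).imp (he x (by simp) y (by simp)).1.1
      (he y (by simp) x (by simp)).1.1
  · obtain ⟨e, he, hm⟩ := key x y s
    rw [← (he s (by simp) _ (by simp)).1, hm, h.meet, (he s (by simp) x (by simp)).1,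
      (he s (by simp) y (by simp)).1]

/-- Meets are determined by the order. Closedness of the image is needed so that the meet of two
images is itself an image. -/
theorem IsMeetTree.determinesStructure {M : Type*} [meetTreeLanguage.Structure M] [DecidableEq M]
    (h : IsMeetTree M) : DeterminesStructure leRel M := by
  intro X f hX hfX hinj hf
  refine ⟨hinj, hX, fun n F x hx => ?_, fun n R x hx => ?_⟩
  · have hn : n = 2 := by cases F; rfl
    subst hn
    rw [funMap_meet, funMap_meet]
    have hm := funClosed_tree.1 hX _ (hx 0) _ (hx 1)
    obtain ⟨w, hw, hwe⟩ := Finset.mem_image.1 (funClosed_tree.1 hfX _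
      (Finset.mem_image_of_mem f (hx 0)) _ (Finset.mem_image_of_mem f (hx 1)))
    have h1 := (h.meet (x 0) (x 1) _).1 (h.refl _)
    have h2 := (h.meet (f (x 0)) (f (x 1)) _).1 (h.refl _)
    rw [← hwe] at h2 ⊢
    refine h.antisymm _ _ ?_ ((hf w hw _ hm).2 ((h.meet _ _ _).2
      ⟨(hf w hw _ (hx 0)).1 h2.1, (hf w hw _ (hx 1)).1 h2.2⟩))
    rw [hwe]
    exact (h.meet _ _ _).2 ⟨(hf _ hm _ (hx 0)).2 h1.1, (hf _ hm _ (hx 1)).2 h1.2⟩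
  · have hn : n = 2 := by cases R; rfl
    subst hn
    cases R
    have hvec : ∀ y : Fin 2 → M, y = ![y 0, y 1] := fun y => by
      ext i
      fin_cases i <;> rfl
    have := hf _ (hx 0) _ (hx 1)
    unfold symbRel at this
    rw [hvec x]
    rw [hvec fun i => f (![x 0, x 1] i)]
    exact this

theorem not_zariski_prod_tree {L₁ : FirstOrder.Language.{u, v}} [L₁.IsRelational]
    {K₁ : Set (Bundled.{w} L₁.Structure)} {K₂ : Set (Bundled.{w} meetTreeLanguage.Structure)}
    [Countable (Σ l, meetTreeLanguage.Functions l)]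
    {M : Type w} [L₁.Structure M] [meetTreeLanguage.Structure M] [Countable M] [DecidableEq M]
    (hM : IsFraisseLimit (prodClass K₁ K₂) M) (hK₁ : IsSeparatingClass K₁)
    {M₂ : Type w} [meetTreeLanguage.Structure M₂] [DecidableEq M₂]
    (hM₂ : meetTreeLanguage.age M₂ = K₂) (ht : IsDenseMeetTree M₂) :
    ¬ ZariskiIsGroupTopology (M ≃[L₁.sum meetTreeLanguage] M) := by
  have := ht.nonempty
  have h₂ := ht.isMeetTree
  have hMt : IsMeetTree M := h₂.of_charts fun F => by
    obtain ⟨C, hFC, hC⟩ := exists_closed_superset hM hK₁.finite F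
    exact ⟨C, hFC, exists_chart hM hM₂ hC⟩
  have hρ := hMt.determinesStructure
  let _ : SemilatticeInf M := hMt.semilatticeInf
  let _ : SemilatticeInf M₂ := h₂.semilatticeInf
  have hlt : ∀ {x y : M₂}, TreeLT x y ↔ x < y := fun {x y} =>
    Iff.symm (lt_iff_le_and_ne (a := x) (b := y))
  have : DenselyOrdered M₂ := ⟨fun x y hxy => by
    obtain ⟨z, h1, h2⟩ := ht.dense x y (hlt.2 hxy)
    exact ⟨z, hlt.1 h1, hlt.1 h2⟩⟩
  have : NoMinOrder M₂ := ⟨fun t => (ht.noFirst t).imp fun _ h => hlt.1 h⟩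
  have hbr : ∀ t : M₂, ∃ S : Set M₂, S.Infinite ∧ (∀ x ∈ S, t < x) ∧
      ∀ x ∈ S, ∀ y ∈ S, x ≠ y → x ⊓ y = t := fun t =>
    (ht.branching t).imp fun S h => ⟨h.1, fun x hx => hlt.1 (h.2.1 x hx), h.2.2⟩
  have hlin₂ : ∀ t x y : M₂, x ≤ t → y ≤ t → x ≤ y ∨ y ≤ x := ht.linear
  have hlin : ∀ t x y : M, x ≤ t → y ≤ t → x ≤ y ∨ y ≤ x := hMt.linear
  refine not_zariski_prod hM hK₁ hM₂ hρ
    (fun C hC c hc => ?_) (fun x y => iff_of_true (h₂.refl x) (h₂.refl y))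
    ⟨Classical.arbitrary M₂, ?_⟩ (funClosed_tree.2 (by simp))
    (fun A hA t htA => ?_)
    fun A hA q hqA hqA' F g hg => ⟨q, hqA, hqA', fun c hcA hcq hcA' hle hsame => ?_⟩
  · obtain ⟨z, h1, h2, h3, h4⟩ := exists_position_below hlin₂ (h₂.funClosed_iff.1 hC) hc
    have hCc : FunClosed meetTreeLanguage (insert c C) := by rwa [Finset.insert_eq_of_mem hc]
    exact ⟨z, h1, h₂.funClosed_iff.2 (h4 C subset_rfl (h₂.funClosed_iff.1 hC)
      (h₂.funClosed_iff.1 hCc)), h2.le, h3, fun X hXC _ hX hcX => h₂.funClosed_iff.2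
      (h4 X hXC (h₂.funClosed_iff.1 hX) (h₂.funClosed_iff.1 hcX))⟩
  · refine h₂.funClosed_iff.2 ?_
    rw [Finset.coe_singleton]
    exact infClosed_singleton
  · obtain ⟨Y, h1, h2, h3, h4⟩ := exists_closed_step hlin (hMt.funClosed_iff.1 hA) htA
    exact ⟨Y, hMt.funClosed_iff.2 h1, h2, h3, hMt.funClosed_iff.2 h4⟩
  by_contra hne
  obtain ⟨C, hC₀, hC⟩ := exists_closed_superset hM hK₁.finite
    (insert c (insert (g c) (insert q (A ∪ F))))
  have hcC : c ∈ C := hC₀ (by simp)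
  have hgcC : g c ∈ C := hC₀ (by simp)
  have hqC : q ∈ C := hC₀ (by simp)
  have hAC : A ⊆ C := fun x hx => hC₀ (by simp [hx])
  have hFC : F ⊆ C := fun x hx => hC₀ (by simp [hx])
  obtain ⟨e, he⟩ := exists_chart hM hM₂ hC
  have hle_iff : ∀ {x y : M}, x ∈ C → y ∈ C → (e x ≤ e y ↔ x ≤ y) := fun hx hy =>
    he.symbRel_iff leRel hx hy
  have hcCe := Finset.mem_image_of_mem e hcC
  have hCe : InfClosed (↑(C.image e) : Set M₂) :=
    h₂.funClosed_iff.1 ((he.funClosed_image_iff subset_rfl).2 hC)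
  have hAe : InfClosed (↑(A.image e) : Set M₂) :=
    h₂.funClosed_iff.1 ((he.funClosed_image_iff hAC).2 hA)
  have hcAe : InfClosed (↑(insert (e c) (A.image e)) : Set M₂) := by
    rw [← Finset.image_insert]
    exact h₂.funClosed_iff.1 ((he.funClosed_image_iff (Finset.insert_subset hcC hAC)).2 hcA')
  have hcAe' : e c ∉ A.image e := fun h => by
    obtain ⟨a, ha, hac⟩ := Finset.mem_image.1 h
    exact hcA (he.inj (hAC ha) hcC hac ▸ ha)
  -- a new point that looks like `c` over `A` is the position of a conjugate of `q`
  have key : ∀ z ∉ C.image e, InfClosed (↑(insert z (C.image e)) : Set M₂) →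
      InfClosed (↑(insert z (A.image e)) : Set M₂) →
      (∀ a ∈ A, (z ≤ e a ↔ e c ≤ e a) ∧ (e a ≤ z ↔ e a ≤ e c)) →
      ∃ q' : M, g q' = q' ∧ ∀ x ∈ C, (q' ≤ x ↔ z ≤ e x) ∧ (x ≤ q' ↔ e x ≤ z) := by
    intro z hz hzC hzA hzs
    obtain ⟨h, hA', hqC', hx⟩ := prod_exists_conjugate hM hK₁ hM₂ hρ he hAC hqC hqA hqA' hz
      (h₂.funClosed_iff.2 hzC) (h₂.funClosed_iff.2 hzA)
      (iff_of_true (h₂.refl z) (hMt.refl q)) fun a ha => by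
        have haC := hAC ha
        exact ⟨(hzs a ha).1.trans ((hle_iff hcC haC).trans (hsame a ha).1),
          (hzs a ha).2.trans ((hle_iff haC hcC).trans (hsame a ha).2)⟩
    exact ⟨h q, hg h hA' fun h => hqC' (hFC h), hx⟩
  have hg_le : ∀ {x y : M}, g x ≤ g y ↔ x ≤ y := fun {x y} => prod_aut_symbRel g leRel x y
  by_cases hcg : c ≤ g c
  -- A fixed conjugate `q'` just above `c` is also above `g c`; as nothing of `C` lies below `q'`
  -- except below `c`, this gives `g c ≤ c`.
  · obtain ⟨z, h1, h2, h3, h4, h5, h6⟩ :=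
      exists_position_above hlin₂ hbr hCe hcCe (Finset.image_subset_image hAC) hAe hcAe' hcAe
    obtain ⟨q', hq', hx⟩ := key z h1 h5 h6 fun a ha =>
      ⟨h4 _ (Finset.mem_image_of_mem e ha),
        h3 _ (Finset.mem_image_of_mem e (hAC ha)), fun h => h.trans h2.le⟩
    have h7 : g c ≤ q' := by
      rw [← hq', hg_le]
      exact (hx c hcC).2.2 h2.le
    have h8 := h3 _ (Finset.mem_image_of_mem e hgcC) ((hx _ hgcC).2.1 h7)
    exact hne (le_antisymm ((hle_iff hgcC hcC).1 h8) hcg)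
  -- A fixed conjugate `q'` just below `c` is also below `g c`, and such a `q'` has the same upper
  -- bounds in `C` as `c`, apart from `c`.
  · obtain ⟨z, h1, h2, h3, h4⟩ := exists_position_below hlin₂ hCe hcCe
    obtain ⟨q', hq', hx⟩ := key z h1 (h4 _ subset_rfl hCe (by rwa [Finset.insert_eq_of_mem hcCe]))
      (h4 _ (Finset.image_subset_image hAC) hAe hcAe) fun a ha =>
        h3 _ (Finset.mem_erase.2 ⟨ne_of_mem_of_not_mem (Finset.mem_image_of_mem e ha) hcAe',
          Finset.mem_image_of_mem e (hAC ha)⟩)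
    have h7 : q' ≤ g c := by
      rw [← hq', hg_le]
      exact (hx c hcC).1.2 h2.le
    have h8 := (h3 _ (Finset.mem_erase.2 ⟨fun h => hne (he.inj hgcC hcC h),
      Finset.mem_image_of_mem e hgcC⟩)).1.1 ((hx _ hgcC).1.1 h7)
    exact hcg ((hle_iff hcC hgcC).1 h8)

end TreeFactor

end ZariskiAut

namespace ZariskiAut

open FirstOrder FirstOrder.Language FirstOrder.Language.Structure

/-! ### Assembling the product cases -/

section SecondFactor

/-- A structure in the sum of two languages is determined by its two reducts. -/
theorem exists_eq_sumStructure {L₁ : FirstOrder.Language.{u, v}} {L₂ : FirstOrder.Language.{u', v'}}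
    {M : Type w} (s : (L₁.sum L₂).Structure M) :
    ∃ (s₁ : L₁.Structure M) (s₂ : L₂.Structure M), s = @sumStructure L₁ L₂ M s₁ s₂ := by
  refine ⟨(LHom.sumInl : L₁ →ᴸ L₁.sum L₂).reduct M, (LHom.sumInr : L₂ →ᴸ L₁.sum L₂).reduct M, ?_⟩
  ext n x
  · rcases x with F | F <;> rfl
  · rcases x with R | R <;> exact Iff.rfl

theorem not_zariski_secondFactor {L₁ : FirstOrder.Language.{u, v}} [L₁.IsRelational]
    {K₁ : Set (Bundled.{w} L₁.Structure)} (hK₁ : IsSeparatingClass K₁)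
    {L₂ : FirstOrder.Language.{0, 0}} [Countable (Σ l, L₂.Functions l)]
    {K₂ : Set (Bundled.{w} L₂.Structure)} (hK₂ : IsSecondFactor L₂ K₂)
    {M : Type w} [s : (L₁.sum L₂).Structure M] [Countable M]
    (hM : IsFraisseLimit (prodClass K₁ K₂) M) : ¬ ZariskiIsGroupTopology (M ≃[L₁.sum L₂] M) := by
  classical
  obtain ⟨_, _, rfl⟩ := exists_eq_sumStructure s
  cases hK₂ with
  | ratOrder _ M₂ h₂ hord =>
    have : Nonempty M₂ := ⟨hord.choose.symm 0⟩
    exact not_zariski_prod_tournament hM hK₁ h₂.age hord.hasNeighbours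
  | cyclicTournament _ M₂ h₂ hcyc =>
    have : Nonempty M₂ := by
      obtain ⟨f, -, hf, -⟩ := hcyc
      exact hf.nonempty
    exact not_zariski_prod_tournament hM hK₁ h₂.age hcyc.hasNeighbours
  | denseMeetTree _ M₂ h₂ htree => exact not_zariski_prod_tree hM hK₁ h₂.age htree

end SecondFactor

end ZariskiAut

theorem theoremE :
    -- non-trivial free amalgamation classes with transitive automorphism group
    (∀ (L : FirstOrder.Language.{u, v}) [L.IsRelational] (K : Set (Bundled.{w} L.Structure))
        (M : Type w) [L.Structure M] [Countable M],
      FirstOrder.Language.IsFraisseLimit K M → IsFreeAmalgamationClass K → ¬ IsTrivial L M →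
      IsTransitive L M → ¬ ZariskiIsGroupTopology (M ≃[L] M)) ∧
    -- the rational Urysohn space, unbounded and bounded
    (∀ (R : Set ℚ), IsRatDistanceSet R →
      ∀ (M : Type w) [(ratMetricLanguage R).Structure M] [Countable M],
      FirstOrder.Language.IsFraisseLimit (ratMetricClass R) M →
      ¬ ZariskiIsGroupTopology (M ≃[ratMetricLanguage R] M)) ∧
    -- the random tournament
    (∀ (M : Type w) [binLanguage.Structure M] [Countable M],
      FirstOrder.Language.IsFraisseLimit tournamentClass M →
      ¬ ZariskiIsGroupTopology (M ≃[binLanguage] M)) ∧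
    -- products whose first factor has a doubly transitive automorphism group, or is a free
    -- amalgamation class with transitive automorphism group
    (∀ (L₁ : FirstOrder.Language.{u, v}) [L₁.IsRelational] (K₁ : Set (Bundled.{w} L₁.Structure))
        (M₁ : Type w) [L₁.Structure M₁] [Countable M₁],
      FirstOrder.Language.IsFraisseLimit K₁ M₁ → StrongAmalgamation K₁ → ¬ IsTrivial L₁ M₁ →
      (IsTwoTransitive L₁ M₁ ∨ (IsFreeAmalgamationClass K₁ ∧ IsTransitive L₁ M₁)) →
      ∀ (L₂ : FirstOrder.Language.{0, 0}) [Countable (Σ l, L₂.Functions l)]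
        (K₂ : Set (Bundled.{w} L₂.Structure)), IsSecondFactor L₂ K₂ →
      ∀ (M : Type w) [(L₁.sum L₂).Structure M] [Countable M],
      FirstOrder.Language.IsFraisseLimit (prodClass K₁ K₂) M →
      ¬ ZariskiIsGroupTopology (M ≃[L₁.sum L₂] M)) ∧
    -- products whose first factor is the class of a rational Urysohn space
    (∀ (R : Set ℚ), IsRatDistanceSet R →
      ∀ (L₂ : FirstOrder.Language.{0, 0}) [Countable (Σ l, L₂.Functions l)]
        (K₂ : Set (Bundled.{w} L₂.Structure)), IsSecondFactor L₂ K₂ →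
      ∀ (M : Type w) [((ratMetricLanguage R).sum L₂).Structure M] [Countable M],
      FirstOrder.Language.IsFraisseLimit (prodClass (ratMetricClass R) K₂) M →
      ¬ ZariskiIsGroupTopology (M ≃[(ratMetricLanguage R).sum L₂] M)) := by
  refine ⟨fun L _ K M _ _ hM hK hnt htr => ?_, fun R hR M _ _ hM => not_zariski_urysohn hR hM,
    fun M _ _ hM => not_zariski_tournament hM,
    fun L₁ _ K₁ M₁ _ _ hM₁ hK₁ hnt hor L₂ _ K₂ hK₂ M _ _ hM => ?_,
    fun R hR L₂ _ K₂ hK₂ M _ _ hM =>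
      not_zariski_secondFactor (isSeparatingClass_ratMetric hR) hK₂ hM⟩
  · classical exact not_zariski_free hM hK htr hnt
  · classical exact not_zariski_secondFactor (isSeparatingClass_of_limit hM₁ hK₁
      (nonempty_of_not_isTrivial hnt) (hor.elim
        (fun h => separatesPoints_of_twoTransitive hM₁ hK₁ h hnt)
        fun h => separatesPoints_of_free hM₁ h.1 h.2 hnt)) hK₂ hM
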